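/- Let $V$ be a simple Euclidean Jordan algebra of dimension $n$, rank $r$ and characteristic number $d$ (so $n=r+\frac{r(r-1)}2 d$), with unit $e$, trace $\operatorname{tr}$, determinant $\det$, inner product $(x,y)=\operatorname{tr}(xy)$ and the corresponding Lebesgue measure. Let $\Omega$ be the open cone of squares (the interior of $\{x^2 : x\in V\}$) and $]-e,e[\,=\{v\in V : e\pm v\in\Omega\}$. For a polynomial $p$ on $V$ let $p(\partial)$ be the constant coefficient differential operator with $p(\partial)e^{(x,\xi)}=p(\xi)e^{(x,\xi)}$. For $s,t\in\mathbb R$, $k\in\mathbb N=\{0,1,2,\dots\}$ and $x,y\in\Omega$ put $$c^{(k)}_{s,t}(x,y)=(\det x)^{-s}(\det y)^{-t}\det\Big(\frac{\partial}{\partial x}-\frac{\partial}{\partial y}\Big)^k\big((\det x)^{s+k}(\det y)^{t+k}\big),$$ and for $v\in\,]-e,e[$ put $C^{(k)}_{s,t}(v)=c^{(k)}_{s,t}\big(\frac{e-v}2,\frac{e+v}2\big)$. Let $$L^2_\nu(\Omega)=L^2\big(\Omega,(\det\xi)^{-\nu+\frac nr}d\xi\big),\qquad L^2_{\lambda,\mu}(\Omega\times\Omega)=L^2\big(\Omega\times\Omega,(\det\xi)^{-\lambda+\frac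 nr}(\det\zeta)^{-\mu+\frac nr}d\xi\,d\zeta\big)$$ be the spaces of complex-valued square-integrable functions. Let $k\in\mathbb N$ and let $\lambda,\mu$ be real numbers with $\lambda,\mu>1+d(r-1)$. For a function $h:\Omega\to\mathbb C$ let $$\big(\Phi^{(k)}_{\lambda,\mu}h\big)(\xi,\zeta)=i^{rk}(\det\xi)^{\lambda-\frac nr}(\det\zeta)^{\mu-\frac nr}\det(\xi+\zeta)^{-\lambda-\mu-2k+\frac nr}\,c^{(k)}_{\lambda-\frac nr,\mu-\frac nr}(\xi,\zeta)\,h(\xi+\zeta)\qquad(\xi,\zeta\in\Omega).$$ Then the integral in $$c(\lambda,\mu;k)=2^{-r\lambda-r\mu+n}\int_{]-e,e[}\big|C^{(k)}_{\lambda-\frac nr,\mu-\frac nr}(v)\big|^2\det(e-v)^{\lambda-\frac nr}\det(e+v)^{\mu-\frac nr}\,dv$$ converges absolutely, and $c(\lambda,\mu;k)>0$. Moreover $C^\infty_c(\Omega)\subset L^2_{\lambda+\mu+2k}(\Omega)$, and $h\mapsto\Phi^{(k)}_{\lambda,\mu}h$ is (well defined and) a bounded linear operator from $L^2_{\lambda+\mu+2k}(\Omega)$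 into $L^2_{\lambda,\mu}(\Omega\times\Omega)$ of the form $\sqrt{c(\lambda,\mu;k)}\,U$ with $U$ a partial isometry; in fact $$\big\|\Phi^{(k)}_{\lambda,\mu}h\big\|^2_{L^2_{\lambda,\mu}(\Omega\times\Omega)}=c(\lambda,\mu;k)\,\|h\|^2_{L^2_{\lambda+\mu+2k}(\Omega)}\qquad\text{for all }h\in L^2_{\lambda+\mu+2k}(\Omega).$$ -/

import Mathlib

open MeasureTheory Polynomial
open scoped ContDiff

noncomputable section

/-- A Euclidean Jordan algebra: a real inner product space with a commutative bilinear product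
satisfying the Jordan identity `(x * y) * x² = x * (y * x²)`, with a unit, such that all
multiplications `y ↦ x * y` are symmetric for the inner product. -/
class EuclideanJordanAlgebra (V : Type*) [NormedAddCommGroup V] [InnerProductSpace ℝ V]
    extends CommMagma V, IsCommJordan V, One V where
  jmul_add : ∀ x y z : V, x * (y + z) = x * y + x * z
  jmul_smul : ∀ (a : ℝ) (x y : V), x * (a • y) = a • (x * y)
  one_jmul : ∀ x : V, 1 * x = x
  inner_jmul : ∀ x y z : V, inner ℝ (x * y) z = inner ℝ y (x * z)

namespace EuclideanJordan

section Algebra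

variable {V : Type*} [NormedAddCommGroup V] [InnerProductSpace ℝ V] [EuclideanJordanAlgebra V]

/-- The multiplication operator `L(x) : y ↦ x * y`. -/
def mulOp (x : V) : Module.End ℝ V where
  toFun y := x * y
  map_add' := EuclideanJordanAlgebra.jmul_add x
  map_smul' a y := EuclideanJordanAlgebra.jmul_smul a x y

variable [FiniteDimensional ℝ V]

theorem exists_monic_annihilating (x : V) :
    {p : ℝ[X] | p.Monic ∧ aeval (mulOp x) p (1 : V) = 0}.Nonempty :=
  ⟨minpoly ℝ (mulOp x), minpoly.monic (Algebra.IsIntegral.isIntegral _), by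
    simp [minpoly.aeval]⟩

/-- The minimal polynomial of `x`: the monic polynomial `p` of least degree with `p(x) = 0`.
Since the powers of `x` are `x ^ 0 = 1`, `x ^ (m + 1) = x * x ^ m`, one has `p(x) = p(L(x)) 1`. -/
def minPoly (x : V) : ℝ[X] :=
  WellFounded.min degree_lt_wf {p : ℝ[X] | p.Monic ∧ aeval (mulOp x) p (1 : V) = 0}
    (exists_monic_annihilating x)

variable (V) in
/-- The rank `r` of `V`: the maximal degree of a minimal polynomial. -/
def rank : ℕ := ⨆ x : V, (minPoly x).natDegree

variable (V) in
/-- The regular elements: those whose minimal polynomial has degree `r`. They form a dense open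
subset of `V`. -/
def regular : Set V := {x | (minPoly x).natDegree = rank V}

/-- The trace of `V`. For regular `x` the minimal polynomial is
`X ^ r - a₁(x) X ^ (r - 1) + ⋯ + (-1) ^ r aᵣ(x)` and `tr x = a₁(x)`; the trace is the (unique)
continuous extension of this function from the regular elements to `V`. -/
def tr : V → ℝ := extendFrom (regular V) fun x => -(minPoly x).coeff (rank V - 1)

/-- The determinant of `V`: for regular `x`, `det x = aᵣ(x)` is the signed constant term of the
minimal polynomial; the determinant is the continuous extension of this function to `V`. -/
def det : V → ℝ := extendFrom (regular V) fun x => (-1) ^ rank V * (minPoly x).coeff 0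

end Algebra

end EuclideanJordan

/-- A simple Euclidean Jordan algebra with inner product `(x, y) = tr (x * y)`. -/
class SimpleEuclideanJordanAlgebra (V : Type*) [NormedAddCommGroup V] [InnerProductSpace ℝ V]
    [FiniteDimensional ℝ V] extends EuclideanJordanAlgebra V, Nontrivial V where
  simple : ∀ I : Submodule ℝ V, (∀ x : V, ∀ y ∈ I, x * y ∈ I) → I = ⊥ ∨ I = ⊤
  inner_eq_tr : ∀ x y : V, inner ℝ x y = EuclideanJordan.tr (x * y)

namespace EuclideanJordan

variable (V : Type*) [NormedAddCommGroup V] [InnerProductSpace ℝ V] [FiniteDimensional ℝ V]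
  [SimpleEuclideanJordanAlgebra V]

/-- The dimension `n` of `V`. -/
abbrev dim : ℕ := Module.finrank ℝ V

/-- The ratio `n / r`. -/
def ratio : ℝ := (dim V : ℝ) / rank V

/-- The characteristic number `d`, determined by `n = r + r (r - 1) d / 2` (for `r = 1` this
gives `0`; there only the product `d * (r - 1) = 0` is used). -/
def charNumber : ℝ := 2 * ((dim V : ℝ) - rank V) / (rank V * (rank V - 1))

/-- The open cone `Ω`: the interior of the set of squares. -/
def cone : Set V := interior (Set.range fun x : V => x * x)

/-- The interval `]-e, e[`. -/
def orderInterval : Set V := {v | 1 + v ∈ cone V ∧ 1 - v ∈ cone V}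

variable {V}

/-- The constant coefficient operator `det (∂/∂x - ∂/∂y)`, with symbol `det (ξ - ζ)`. As `det` is a
homogeneous polynomial of degree `r`, in an orthonormal basis `b` it reads
`det ξ = (1 / r!) ∑ D^r det (0) (b_{i₁}, …, b_{iᵣ}) (ξ, b_{i₁}) ⋯ (ξ, b_{iᵣ})`, and each factor
`(ξ, b_i)` is replaced by the derivative in the direction `(b_i, -b_i)`. -/
def detDiff (F : V × V → ℝ) (p : V × V) : ℝ :=
  ((rank V).factorial : ℝ)⁻¹ * ∑ i : Fin (rank V) → Fin (dim V),
    iteratedFDeriv ℝ (rank V) (det : V → ℝ) 0 (fun j => stdOrthonormalBasis ℝ V (i j)) *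
    iteratedFDeriv ℝ (rank V) F p
      (fun j => (stdOrthonormalBasis ℝ V (i j), -stdOrthonormalBasis ℝ V (i j)))

/-- `c_{s,t}^{(k)}(x, y) = (det x)^{-s} (det y)^{-t} det(∂/∂x - ∂/∂y)^k ((det x)^{s+k} (det y)^{t+k})`
for `x, y ∈ Ω`. -/
def cPoly (s t : ℝ) (k : ℕ) (x y : V) : ℝ :=
  det x ^ (-s) * det y ^ (-t) *
    (detDiff^[k] (fun p : V × V => det p.1 ^ (s + k) * det p.2 ^ (t + k))) (x, y)

/-- `C_{s,t}^{(k)}(v) = c_{s,t}^{(k)}((e - v) / 2, (e + v) / 2)`. -/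
def CPoly (s t : ℝ) (k : ℕ) (v : V) : ℝ :=
  cPoly s t k ((1 / 2 : ℝ) • (1 - v)) ((1 / 2 : ℝ) • (1 + v))

/-- The operator `Φ_{lam,mu}^{(k)}`; its values matter only on `Ω × Ω`. -/
def Phi (lam mu : ℝ) (k : ℕ) (h : V → ℂ) (p : V × V) : ℂ :=
  Complex.I ^ (rank V * k) *
    ((det p.1 ^ (lam - ratio V) * det p.2 ^ (mu - ratio V) *
      det (p.1 + p.2) ^ (-lam - mu - 2 * k + ratio V) *
      cPoly (lam - ratio V) (mu - ratio V) k p.1 p.2 : ℝ) : ℂ) * h (p.1 + p.2)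

variable (V)

/-- The function `|C|² det(e - v)^{lam - n/r} det(e + v)^{mu - n/r}` with
`C = C_{lam - n/r, mu - n/r}^{(k)}`. -/
def normDensity (lam mu : ℝ) (k : ℕ) (v : V) : ℝ :=
  |CPoly (lam - ratio V) (mu - ratio V) k v| ^ 2 *
    det (1 - v) ^ (lam - ratio V) * det (1 + v) ^ (mu - ratio V)

variable [MeasurableSpace V] [BorelSpace V]

/-- The measure `(det ξ)^{-ν + n/r} dξ` on `Ω`, where `dξ` is the Lebesgue measure of the Euclidean
space `V`; thus `L²_ν(Ω)` is `Lp ℂ 2 (coneMeasure V ν)`. -/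
def coneMeasure (nu : ℝ) : Measure V :=
  ((volume : Measure V).restrict (cone V)).withDensity
    fun x => ENNReal.ofReal (det x ^ (-nu + ratio V))

/-- The measure `(det ξ)^{-lam + n/r} (det ζ)^{-mu + n/r} dξ dζ` on `Ω × Ω`; thus
`L²_{lam,mu}(Ω × Ω)` is `Lp ℂ 2 (coneMeasure₂ V lam mu)`. -/
def coneMeasure₂ (lam mu : ℝ) : Measure (V × V) :=
  (((volume : Measure V).prod (volume : Measure V)).restrict (cone V ×ˢ cone V)).withDensity
    fun p => ENNReal.ofReal (det p.1 ^ (-lam + ratio V) * det p.2 ^ (-mu + ratio V))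

/-- The scalar `2^{-r lam - r mu + n} ∫_{]-e,e[} |C|² det(e - v)^{lam - n/r} det(e + v)^{mu - n/r} dv`.
-/
def normConst (lam mu : ℝ) (k : ℕ) : ℝ :=
  (2 : ℝ) ^ (-(rank V : ℝ) * lam - rank V * mu + dim V) *
    ∫ v in orderInterval V, normDensity V lam mu k v

end EuclideanJordan

/-- A bounded operator between Hilbert spaces is a partial isometry if it is isometric on the
orthogonal complement of its kernel. -/
def IsPartialIsometry {H K : Type*} [NormedAddCommGroup H] [InnerProductSpace ℂ H]
    [NormedAddCommGroup K] [InnerProductSpace ℂ K] (U : H →L[ℂ] K) : Prop :=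
  ∀ x ∈ (LinearMap.ker (U : H →ₗ[ℂ] K))ᗮ, ‖U x‖ = ‖x‖

end

open EuclideanJordan

/-! Write s = λ - n/r, t = μ - n/r, ν = λ + μ + 2k. The squared norm of Φh is the integral over Ω ×
Ω of K(ξ, ζ) G(ξ + ζ), where K = (det ξ)^s (det ζ)^t c(ξ, ζ)² and G(x) = (det x)^(2(n/r - ν))
|h(x)|². Substituting x = ξ + ζ and using Tonelli, everything reduces to the inner integral I(x) = ∫
K(y, x - y) dy.

Let g = exp L(a) and χ = e^(tr a). Then g preserves Ω, multiplies det by χ and c by χ^k, and has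
Jacobian χ^(n/r); moreover every x in Ω is g e for some a. Hence I(x) = (det x)^(ν - n/r) I(e), and
y = (e - v)/2 turns I(e) into the constant c(λ, μ; k). This is `lintegral_kernelFun`; the norm
identity, boundedness and the partial isometry follow. The action of the exponentials is obtained
from the spectral theorem, from the formula D det(y)(a y) = tr(a) det y integrated along the flow,
and, for the Jacobian, from simplicity, which forces Tr L(x) = (n/r) tr x.

Two facts about the constant remain. Finiteness: since s, t > 0 (`ratio_le`), it is enough that c is
bounded on bounded sets (`exists_cPoly_le`). Transported to (e, e), c at (g₁ e, g₂ e) is governed by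
the symbol χ₁ χ₂ det(g₁⁻¹ξ - g₂⁻¹ζ), whose coefficients extend continuously to all operators g₁, g₂;
and ‖g‖ is controlled by ‖g e‖ when g preserves the cone.

Positivity: c does not vanish identically. Moving along (e, ε⁻¹ e) replaces the operator by det(∂x -
ε ∂y) at (e, e); as ε → 0 the value tends to a product of Bernstein numbers b(s + j). These are
nonzero because b(s) Γ(s) = Γ(s + 1) for the positive integrals Γ(s) = ∫ e^(-tr x) (det x)^s dx, by
integration by parts for large s and by analytic continuation for s > 0. -/

namespace EuclideanJordan

/-! ### Jordan identities, power associativity, positivity of idempotents -/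

section Basics

variable {V : Type*} [NormedAddCommGroup V] [InnerProductSpace ℝ V] [EuclideanJordanAlgebra V]

theorem mulOp_apply (x y : V) : mulOp x y = x * y := rfl

theorem jmul_add (x y z : V) : x * (y + z) = x * y + x * z := EuclideanJordanAlgebra.jmul_add x y z

theorem jmul_smul (a : ℝ) (x y : V) : x * (a • y) = a • (x * y) :=
  EuclideanJordanAlgebra.jmul_smul a x y

theorem one_jmul (x : V) : 1 * x = x := EuclideanJordanAlgebra.one_jmul x

theorem jmul_one (x : V) : x * 1 = x := by rw [mul_comm, one_jmul]

theorem add_jmul (x y z : V) : (x + y) * z = x * z + y * z := by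
  rw [mul_comm, jmul_add, mul_comm z x, mul_comm z y]

theorem smul_jmul (a : ℝ) (x y : V) : (a • x) * y = a • (x * y) := by
  rw [mul_comm, jmul_smul, mul_comm]

variable (V) in
/-- The multiplication operators as a linear map `x ↦ L(x)`. -/
noncomputable def mulOpLinear : V →ₗ[ℝ] Module.End ℝ V where
  toFun := mulOp
  map_add' x y := LinearMap.ext fun z => add_jmul x y z
  map_smul' a x := LinearMap.ext fun z => smul_jmul a x z

theorem mulOp_add (x y : V) : mulOp (x + y) = mulOp x + mulOp y := (mulOpLinear V).map_add x y

theorem mulOp_smul (a : ℝ) (x : V) : mulOp (a • x) = a • mulOp x := (mulOpLinear V).map_smul a x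

theorem mulOp_one : mulOp (1 : V) = 1 := LinearMap.ext one_jmul

theorem jmul_sum {ι : Type*} (x : V) (s : Finset ι) (f : ι → V) :
    x * ∑ i ∈ s, f i = ∑ i ∈ s, x * f i := map_sum (mulOp x) f s

theorem sum_jmul {ι : Type*} (x : V) (s : Finset ι) (f : ι → V) :
    (∑ i ∈ s, f i) * x = ∑ i ∈ s, f i * x := by
  simp only [mul_comm _ x, jmul_sum]

theorem neg_jmul (x y : V) : (-x) * y = -(x * y) := by
  rw [← neg_one_smul ℝ x, smul_jmul, neg_one_smul]

theorem sub_jmul (x y z : V) : (x - y) * z = x * z - y * z := by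
  rw [sub_eq_add_neg, add_jmul, neg_jmul, ← sub_eq_add_neg]

theorem jmul_zero (x : V) : x * 0 = 0 := (mulOp x).map_zero

theorem zero_jmul (x : V) : 0 * x = 0 := by rw [mul_comm, jmul_zero]

theorem inner_jmul (x y z : V) : inner ℝ (x * y) z = inner ℝ y (x * z) :=
  EuclideanJordanAlgebra.inner_jmul x y z

theorem isSymmetric_mulOp (x : V) : (mulOp x).IsSymmetric := fun y z => inner_jmul x y z

theorem jordan_identity (x y : V) : (x * y) * (x * x) = x * (y * (x * x)) :=
  IsCommJordan.lmul_comm_rmul_rmul x y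

/-- The first linearization of the Jordan identity. -/
theorem jordan_linear (x y z : V) :
    (z * y) * (x * x) + (2 : ℝ) • ((x * y) * (x * z)) =
      z * (y * (x * x)) + (2 : ℝ) • (x * (y * (x * z))) := by
  have h := fun t : ℝ => jordan_identity (x + t • z) y
  have h0 := jordan_identity x y
  have hz := jordan_identity z y
  have h1 := h 1
  have h2 := h (-1)
  have hzx : z * x = x * z := mul_comm _ _
  simp only [add_jmul, jmul_add, smul_jmul, jmul_smul, hzx] at h1 h2 ⊢
  have h3 : (2 : ℝ) • ((z * y) * (x * x) + (2 : ℝ) • ((x * y) * (x * z))) =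
      (2 : ℝ) • (z * (y * (x * x)) + (2 : ℝ) • (x * (y * (x * z)))) := by
    -- The identities at x + z and x - z differ by twice the part odd in z; its cubic part is the
    -- identity at z.
    linear_combination (norm := module) h1 - h2 - (2 : ℝ) • hz
  exact smul_right_injective V (two_ne_zero' ℝ) h3

/-- The operator form `L(x²y) = 2 L(xy) L(x) + L(x²) L(y) - 2 L(x) L(y) L(x)`. -/
theorem mulOp_sq_mul (x y : V) :
    mulOp ((x * x) * y) = (2 : ℝ) • (mulOp (x * y) * mulOp x) + mulOp (x * x) * mulOp y -
      (2 : ℝ) • (mulOp x * mulOp y * mulOp x) := by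
  ext z
  have h := jordan_linear x y z
  simp only [mulOp_apply, LinearMap.sub_apply, LinearMap.add_apply, LinearMap.smul_apply,
    Module.End.mul_apply]
  rw [mul_comm (x * x) (y * z), mul_comm y z, mul_comm (x * x * y) z, mul_comm (x * x) y]
  rw [eq_sub_iff_add_eq, ← h, add_comm]

/-- The full linearization of the Jordan identity, in operator form. -/
theorem mulOp_linear (x w y : V) :
    mulOp ((x * w) * y) + mulOp x * mulOp y * mulOp w + mulOp w * mulOp y * mulOp x =
      mulOp (x * y) * mulOp w + mulOp (w * y) * mulOp x + mulOp (x * w) * mulOp y := by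
  have h1 := mulOp_sq_mul (x + w) y
  have h2 := mulOp_sq_mul x y
  have h3 := mulOp_sq_mul w y
  have hw : w * x = x * w := mul_comm _ _
  simp only [jmul_add, add_jmul, mulOp_add, hw, mul_add, add_mul, smul_add] at h1
  have h4 : (2 : ℝ) • (mulOp ((x * w) * y) + mulOp x * mulOp y * mulOp w +
      mulOp w * mulOp y * mulOp x) = (2 : ℝ) • (mulOp (x * y) * mulOp w +
      mulOp (w * y) * mulOp x + mulOp (x * w) * mulOp y) := by
    linear_combination (norm := module) h1 - h2 - h3
  exact smul_right_injective _ (two_ne_zero' ℝ) h4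

theorem commute_mulOp_sq (x : V) : Commute (mulOp x) (mulOp (x * x)) := by
  ext z
  simp only [Module.End.mul_apply, mulOp_apply]
  rw [mul_comm (x * x) z, ← jordan_identity, mul_comm]

/-- The value `p(x)` of a polynomial at `x`. -/
noncomputable def polyVal (x : V) (p : ℝ[X]) : V := aeval (mulOp x) p (1 : V)

theorem polyVal_add (x : V) (p q : ℝ[X]) : polyVal x (p + q) = polyVal x p + polyVal x q := by
  simp [polyVal]

theorem polyVal_smul (x : V) (a : ℝ) (p : ℝ[X]) : polyVal x (a • p) = a • polyVal x p := by
  simp [polyVal]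

theorem polyVal_sum {ι : Type*} (x : V) (s : Finset ι) (p : ι → ℝ[X]) :
    polyVal x (∑ i ∈ s, p i) = ∑ i ∈ s, polyVal x (p i) := by
  simp [polyVal]

theorem polyVal_X (x : V) : polyVal x X = x := by simp [polyVal, mulOp_apply, jmul_one]

theorem polyVal_one (x : V) : polyVal x 1 = 1 := by simp [polyVal]

theorem polyVal_zero (x : V) : polyVal x 0 = 0 := by simp [polyVal]

theorem polyVal_X_mul (x : V) (p : ℝ[X]) : polyVal x (X * p) = x * polyVal x p := by
  simp [polyVal, mulOp_apply]

theorem polyVal_X_pow_succ (x : V) (m : ℕ) : polyVal x (X ^ (m + 1)) = x * polyVal x (X ^ m) := by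
  rw [pow_succ', polyVal_X_mul]

/-- `mulOp_sq_mul` with y = x^m expresses L(x^(m+2)) through L(x), L(x²), L(x^m) and L(x^(m+1)), so
commutation propagates by a two-step induction from `commute_mulOp_sq`. -/
theorem commute_mulOp_pow (x : V) (m : ℕ) :
    Commute (mulOp (polyVal x (X ^ m))) (mulOp x) ∧
      Commute (mulOp (polyVal x (X ^ m))) (mulOp (x * x)) := by
  induction m using Nat.strong_induction_on with
  | _ m ih =>
    match m with
    | 0 => simp [polyVal_one, mulOp_one]
    | 1 => simpa [polyVal_X] using commute_mulOp_sq x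
    | m + 2 =>
      -- Powers are nested products, so this needs L(x)^m and L(x²) to commute.
      have hpow : polyVal x (X ^ (m + 2)) = (x * x) * polyVal x (X ^ m) := by
        have h1 : ((mulOp x ^ m) * mulOp (x * x)) (1 : V) = (mulOp (x * x) * mulOp x ^ m) 1 := by
          rw [((commute_mulOp_sq x).pow_left m).eq]
        have h2 : polyVal x (X ^ (m + 2)) = ((mulOp x ^ m) * mulOp (x * x)) (1 : V) := by
          simp [polyVal, pow_add, pow_two, mulOp_apply, jmul_one]
        rw [h2, h1]
        simp [polyVal, mulOp_apply]
      obtain ⟨a1, a2⟩ := ih m (by omega)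
      obtain ⟨b1, b2⟩ := ih (m + 1) (by omega)
      rw [polyVal_X_pow_succ] at b1 b2
      have c1 := commute_mulOp_sq x
      rw [hpow, mulOp_sq_mul]
      constructor
      · exact (((b1.mul_left (Commute.refl _)).smul_left _).add_left (c1.symm.mul_left a1)).sub_left
          ((((Commute.refl _).mul_left a1).mul_left (Commute.refl _)).smul_left _)
      · exact (((b2.mul_left c1).smul_left _).add_left ((Commute.refl _).mul_left a2)).sub_left
          (((c1.mul_left a2).mul_left c1).smul_left _)

theorem commute_mulOp_polyVal (x : V) (p : ℝ[X]) : Commute (mulOp (polyVal x p)) (mulOp x) := by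
  induction p using Polynomial.induction_on' with
  | add p q hp hq => rw [polyVal_add, mulOp_add]; exact hp.add_left hq
  | monomial m a =>
    rw [← smul_X_eq_monomial, polyVal_smul, mulOp_smul]
    exact ((commute_mulOp_pow x m).1).smul_left a

/-- Power associativity. -/
theorem polyVal_mul (x : V) (p q : ℝ[X]) : polyVal x (p * q) = polyVal x p * polyVal x q := by
  -- L(p(x)) commutes with L(x), hence with q(L(x)); evaluating both orders at the unit gives the
  -- product rule.
  have h : Commute (mulOp (polyVal x p)) (aeval (mulOp x) q) := by
    induction q using Polynomial.induction_on' with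
    | add q r hq hr => rw [map_add]; exact hq.add_right hr
    | monomial m a =>
      rw [← smul_X_eq_monomial, map_smul, map_pow, aeval_X]
      exact ((commute_mulOp_polyVal x p).pow_right m).smul_right a
  have := congrArg (fun T : Module.End ℝ V => T 1) h.eq
  simp only [Module.End.mul_apply, mulOp_apply, jmul_one] at this
  rw [mul_comm p q]
  change aeval (mulOp x) (q * p) 1 = polyVal x p * aeval (mulOp x) q 1
  rw [this, map_mul]; rfl

/-- Multiplication by an idempotent is positive semidefinite. -/
theorem inner_idempotent_nonneg {c : V} (hc : c * c = c) (y : V) : 0 ≤ inner ℝ (c * y) y := by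
  have h := mulOp_sq_mul c c
  simp only [hc] at h
  set T := mulOp c with hT
  have hs : ∀ u v : V, inner ℝ (T u) v = inner ℝ u (T v) := isSymmetric_mulOp c
  -- So T can only have the eigenvalues 0, 1/2 and 1.
  have h3 : ∀ u : V, (2 : ℝ) • T (T (T u)) = (3 : ℝ) • T (T u) - T u := by
    intro u
    have := congrArg (fun T : Module.End ℝ V => T u) h
    simp only [LinearMap.sub_apply, LinearMap.add_apply, LinearMap.smul_apply,
      Module.End.mul_apply] at this
    linear_combination (norm := module) this
  set w := T y - T (T y) with hw
  -- The polynomial identity τ = τ² + 4(τ - τ²)² holds at 0, 1/2, 1 and exhibits T as a sum of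
  -- squares of symmetric operators.
  have hkey : T y = T (T y) + (4 : ℝ) • (T w - T (T w)) := by
    have e1 := h3 y
    have e2 := congrArg T e1
    simp only [map_sub, map_smul] at e2
    simp only [hw, map_sub]
    linear_combination (norm := module) e1 - (2 : ℝ) • e2
  have hval : inner ℝ (T y) y = ‖T y‖ ^ 2 + 4 * ‖w‖ ^ 2 := by
    have h1 : inner ℝ (T w - T (T w)) y = inner ℝ w w := by
      nth_rewrite 4 [hw]
      rw [inner_sub_left, inner_sub_right, hs, hs (T w), hs w (T y)]
    rw [hkey, inner_add_left, inner_smul_left, h1, hs, real_inner_self_eq_norm_sq,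
      real_inner_self_eq_norm_sq, ← hkey]
    simp
  rw [← mulOp_apply, ← hT, hval]
  positivity

end Basics
end EuclideanJordan

namespace EuclideanJordan

/-! ### Frames, minimal polynomials and the spectral theorem -/

section Spectral

variable {V : Type*} [NormedAddCommGroup V] [InnerProductSpace ℝ V] [EuclideanJordanAlgebra V]

/-- In `mulOp_linear`, exchanging x and y leaves the right side unchanged, and the triple products
on the left keep the same total trace by cyclicity. The outcome is associativity of the form Tr
L(xy), which `trace_mulOp` needs. -/
theorem trace_mulOp_mul_mul (x w y : V) :
    LinearMap.trace ℝ V (mulOp ((x * w) * y)) = LinearMap.trace ℝ V (mulOp ((y * w) * x)) := by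
  have h1 := congrArg (LinearMap.trace ℝ V) (mulOp_linear x w y)
  have h2 := congrArg (LinearMap.trace ℝ V) (mulOp_linear y w x)
  have e1 := LinearMap.trace_mul_cycle ℝ (mulOp x) (mulOp y) (mulOp w)
  have e2 := LinearMap.trace_mul_cycle ℝ (mulOp w) (mulOp y) (mulOp x)
  have e3 := LinearMap.trace_mul_cycle ℝ (mulOp x) (mulOp w) (mulOp y)
  simp only [map_add, mul_comm y x, mul_comm w x, mul_comm w y] at h1 h2 e1 e2 e3 ⊢
  linarith

theorem inner_sum_smul_mul_self {ι : Type*} [Fintype ι] {c : ι → V} (a : ι → ℝ) (y : V) :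
    inner ℝ ((∑ i, a i • c i) * y) y = ∑ i, a i * inner ℝ (c i * y) y := by
  simp [sum_jmul, smul_jmul, sum_inner, inner_smul_left]

/-- A complete system of nonzero orthogonal idempotents. -/
structure IsFrame {ι : Type*} [Fintype ι] [DecidableEq ι] (c : ι → V) : Prop where
  mul_eq : ∀ i j, c i * c j = if i = j then c i else 0
  ne_zero : ∀ i, c i ≠ 0
  sum_eq : ∑ i, c i = 1

namespace IsFrame

variable {ι : Type*} [Fintype ι] [DecidableEq ι] {c : ι → V}

theorem mul_sum_smul (hc : IsFrame c) (a : ι → ℝ) (j : ι) :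
    c j * ∑ i, a i • c i = a j • c j := by
  simp [jmul_sum, jmul_smul, hc.mul_eq]

theorem sum_smul_mul_sum_smul (hc : IsFrame c) (a b : ι → ℝ) :
    (∑ i, a i • c i) * ∑ i, b i • c i = ∑ i, (a i * b i) • c i := by
  simp [sum_jmul, smul_jmul, hc.mul_sum_smul, smul_smul]

theorem polyVal_sum_smul (hc : IsFrame c) (a : ι → ℝ) (p : ℝ[X]) :
    polyVal (∑ i, a i • c i) p = ∑ i, p.eval (a i) • c i := by
  induction p using Polynomial.induction_on' with
  | add p q hp hq => simp [polyVal_add, hp, hq, add_smul, Finset.sum_add_distrib]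
  | monomial m t =>
    rw [← smul_X_eq_monomial, polyVal_smul]
    simp only [eval_smul, smul_eq_mul, ← smul_smul, ← Finset.smul_sum]
    congr 1
    induction m with
    | zero => simp [polyVal_one, hc.sum_eq]
    | succ m ih => rw [polyVal_X_pow_succ, ih, hc.sum_smul_mul_sum_smul]; simp [pow_succ']

theorem inner_eq (hc : IsFrame c) (i j : ι) :
    inner ℝ (c i) (c j) = if i = j then inner ℝ (c i) (1 : V) else 0 := by
  have h : inner ℝ (c i) (c j) = inner ℝ (1 : V) (c i * c j) := by
    rw [← inner_jmul, jmul_one]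
  rw [h, hc.mul_eq]
  split_ifs <;> simp [real_inner_comm]

theorem sum_smul_eq_zero_iff (hc : IsFrame c) (a : ι → ℝ) : ∑ i, a i • c i = 0 ↔ ∀ i, a i = 0 := by
  refine ⟨fun h i => ?_, fun h => by simp [h]⟩
  have h1 := hc.mul_sum_smul a i
  rw [h, jmul_zero] at h1
  exact (smul_eq_zero.1 h1.symm).resolve_right (hc.ne_zero i)

theorem linearIndependent (hc : IsFrame c) : LinearIndependent ℝ c :=
  Fintype.linearIndependent_iff.2 fun a h => (hc.sum_smul_eq_zero_iff a).1 h

theorem inner_mul_self_nonneg (hc : IsFrame c) (i : ι) (y : V) : 0 ≤ inner ℝ (c i * y) y :=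
  inner_idempotent_nonneg (by simp [hc.mul_eq]) y

theorem sum_inner_mul_self (hc : IsFrame c) (y : V) : ∑ i, inner ℝ (c i * y) y = ‖y‖ ^ 2 := by
  have := inner_sum_smul_mul_self (c := c) (fun _ => 1) y
  simp only [one_smul, hc.sum_eq, one_jmul, one_mul] at this
  rw [← this, real_inner_self_eq_norm_sq]

end IsFrame

variable [FiniteDimensional ℝ V]

theorem minPoly_monic (x : V) : (minPoly x).Monic :=
  (WellFounded.min_mem degree_lt_wf {p : ℝ[X] | p.Monic ∧ aeval (mulOp x) p (1 : V) = 0}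
    (exists_monic_annihilating x)).1

theorem polyVal_minPoly (x : V) : polyVal x (minPoly x) = 0 :=
  (WellFounded.min_mem degree_lt_wf {p : ℝ[X] | p.Monic ∧ aeval (mulOp x) p (1 : V) = 0}
    (exists_monic_annihilating x)).2

theorem degree_minPoly_le {x : V} {p : ℝ[X]} (hp : p.Monic) (h : polyVal x p = 0) :
    (minPoly x).degree ≤ p.degree :=
  not_lt.1 (WellFounded.not_lt_min degree_lt_wf
    {p : ℝ[X] | p.Monic ∧ aeval (mulOp x) p (1 : V) = 0} (x := p) ⟨hp, h⟩)

theorem minPoly_dvd {x : V} {p : ℝ[X]} (h : polyVal x p = 0) : minPoly x ∣ p := by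
  have hm := minPoly_monic x
  rw [← modByMonic_eq_zero_iff_dvd hm]
  by_contra h0
  have h1 : polyVal x (p %ₘ minPoly x) = 0 := by
    have := congrArg (polyVal x) (modByMonic_add_div p (minPoly x))
    rwa [polyVal_add, polyVal_mul, polyVal_minPoly, zero_jmul, add_zero, h] at this
  set q := p %ₘ minPoly x with hq
  have h2 : polyVal x (C q.leadingCoeff⁻¹ * q) = 0 := by
    rw [← smul_eq_C_mul, polyVal_smul, h1, smul_zero]
  have h3 : (C q.leadingCoeff⁻¹ * q).Monic := by
    rw [mul_comm]; exact monic_mul_leadingCoeff_inv h0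
  have h4 := degree_minPoly_le h3 h2
  rw [mul_comm, degree_mul_leadingCoeff_inv q h0] at h4
  exact absurd (degree_modByMonic_lt p hm) (not_lt.2 h4)

/-- A polynomial acts on Σ a i • c i coefficientwise, so it annihilates this element exactly when
every a i is a root. -/
theorem IsFrame.minPoly_eq {ι : Type*} [Fintype ι] [DecidableEq ι] {c : ι → V} (hc : IsFrame c)
    {a : ι → ℝ} (ha : Function.Injective a) :
    minPoly (∑ i, a i • c i) = ∏ i, (X - C (a i)) := by
  have h1 : (∏ i, (X - C (a i))) ∣ minPoly (∑ i, a i • c i) := by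
    refine Fintype.prod_dvd_of_coprime (fun i j hij => ?_) fun i => ?_
    · exact isCoprime_X_sub_C_of_isUnit_sub (sub_ne_zero.2 (ha.ne hij)).isUnit
    · rw [dvd_iff_isRoot]
      have := polyVal_minPoly (∑ i, a i • c i)
      rw [hc.polyVal_sum_smul, hc.sum_smul_eq_zero_iff] at this
      exact this i
  have h2 : minPoly (∑ i, a i • c i) ∣ ∏ i, (X - C (a i)) := by
    refine minPoly_dvd ?_
    rw [hc.polyVal_sum_smul, hc.sum_smul_eq_zero_iff]
    intro i
    rw [eval_prod]
    exact Finset.prod_eq_zero (Finset.mem_univ i) (by simp)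
  exact eq_of_monic_of_associated (minPoly_monic _)
    (monic_prod_of_monic _ _ fun i _ => monic_X_sub_C _) (associated_of_dvd_dvd h2 h1)

theorem aeval_mulOp_eq_zero {x : V} {p : ℝ[X]}
    (h : ∀ t, Module.End.HasEigenvalue (mulOp x) t → p.eval t = 0) : aeval (mulOp x) p = 0 := by
  have hs := isSymmetric_mulOp x
  refine (hs.eigenvectorBasis rfl).toBasis.ext fun i => ?_
  have := Module.End.aeval_apply_of_hasEigenvector (p := p) (hs.hasEigenvector_eigenvectorBasis rfl i)
  rw [OrthonormalBasis.coe_toBasis, this, h _ (hs.hasEigenvalue_eigenvalues rfl i)]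
  simp

/-- The spectral theorem. -/
theorem exists_frame (x : V) : ∃ (m : ℕ) (c : Fin m → V) (a : Fin m → ℝ),
    IsFrame c ∧ Function.Injective a ∧ (∀ i, Module.End.HasEigenvalue (mulOp x) (a i)) ∧
      x = ∑ i, a i • c i := by
  classical
  have hfin : {t | Module.End.HasEigenvalue (mulOp x) t}.Finite :=
    Module.End.finite_hasEigenvalue (mulOp x)
  set S := hfin.toFinset with hS
  have hmem : ∀ t, t ∈ S ↔ Module.End.HasEigenvalue (mulOp x) t := fun t => by simp [hS]
  -- The idempotents are the Lagrange polynomials at the eigenvalues of L(x), evaluated at x. Since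
  -- L(x) is diagonalizable, p(x) depends only on the values of p on S.
  set q : ℝ → ℝ[X] := fun t => Lagrange.basis S id t with hq
  set d : ℝ → V := fun t => polyVal x (q t) with hd
  have hext : ∀ p₁ p₂ : ℝ[X], (∀ t ∈ S, p₁.eval t = p₂.eval t) → polyVal x p₁ = polyVal x p₂ := by
    intro p₁ p₂ h
    have : aeval (mulOp x) (p₁ - p₂) = 0 :=
      aeval_mulOp_eq_zero fun t ht => by rw [eval_sub, h t ((hmem t).2 ht), sub_self]
    rw [map_sub, sub_eq_zero] at this
    simp [polyVal, this]
  have heval : ∀ s ∈ S, ∀ t ∈ S, (q s).eval t = if s = t then 1 else 0 := by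
    intro s hs t ht
    split_ifs with h
    · subst h; exact Lagrange.eval_basis_self (v := id) Function.injective_id.injOn hs
    · exact Lagrange.eval_basis_of_ne (v := id) h ht
  have hmul : ∀ s ∈ S, ∀ t ∈ S, d s * d t = if s = t then d s else 0 := by
    intro s hs t ht
    rw [hd]
    simp only [← polyVal_mul]
    split_ifs with h
    · refine hext _ _ fun u hu => ?_
      rw [eval_mul, heval s hs u hu, ← h, heval s hs u hu]; split_ifs <;> simp
    · rw [← polyVal_zero x]
      refine hext _ _ fun u hu => ?_
      rw [eval_mul, heval s hs u hu, heval t ht u hu]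
      split_ifs with h1 h2 <;> simp_all
  have hsum : ∑ t ∈ S, d t = 1 := by
    rw [hd, ← polyVal_sum, ← polyVal_one x]
    refine hext _ _ fun u hu => ?_
    rw [eval_finsetSum, Finset.sum_congr rfl fun s hs => heval s hs u hu]
    simp [hu]
  have hx : ∑ t ∈ S, t • d t = x := by
    rw [hd]
    simp only [← polyVal_smul]
    conv_rhs => rw [← polyVal_X x]
    rw [← polyVal_sum]
    refine hext _ _ fun u hu => ?_
    rw [eval_finsetSum]
    simp only [eval_smul, eval_X]
    rw [Finset.sum_congr rfl fun s hs => by rw [heval s hs u hu]]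
    simp [hu]
  -- L(x) may have eigenvalues that are not spectral values of x, such as half-sums of two of them;
  -- their idempotents vanish and are dropped.
  set S' := S.filter fun t => d t ≠ 0 with hS'
  let e := S'.equivFin.symm
  have hin : ∀ i, (e i : ℝ) ∈ S := fun i => (Finset.mem_filter.1 (e i).2).1
  have htr : ∀ f : ℝ → ℝ, ∑ i, f (e i) • d (e i) = ∑ t ∈ S, f t • d t := by
    intro f
    rw [e.sum_comp (fun t : S' => f t • d t), Finset.sum_coe_sort S' (fun t => f t • d t), hS',
      Finset.sum_filter]
    refine Finset.sum_congr rfl fun t _ => ?_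
    split_ifs with h
    · rfl
    · rw [not_not.1 h, smul_zero]
  refine ⟨S'.card, fun i => d (e i), fun i => e i, ⟨?_, ?_, ?_⟩, ?_, ?_, ?_⟩
  · intro i j
    rw [hmul _ (hin i) _ (hin j)]
    simp
  · exact fun i => (Finset.mem_filter.1 (e i).2).2
  · have := htr fun _ => 1
    simpa [hsum] using this
  · exact Subtype.val_injective.comp e.injective
  · exact fun i => (hmem _).1 (hin i)
  · rw [htr fun t => t, hx]

end Spectral
end EuclideanJordan

namespace EuclideanJordan

/-! ### Exponentials of multiplication operators -/

section OperatorExponential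

variable {V : Type*} [NormedAddCommGroup V] [InnerProductSpace ℝ V] [FiniteDimensional ℝ V]

theorem exp_mul_exp_neg (T : V →L[ℝ] V) : NormedSpace.exp T * NormedSpace.exp (-T) = 1 := by
  let _ : NormedAlgebra ℚ (V →L[ℝ] V) := NormedAlgebra.restrictScalars ℚ ℝ _
  rw [← NormedSpace.exp_add_of_commute (Commute.refl T).neg_right, add_neg_cancel,
    NormedSpace.exp_zero]

theorem exp_apply_of_apply_eq_smul {T : V →L[ℝ] V} {t : ℝ} {v : V} (h : T v = t • v) :
    NormedSpace.exp T v = Real.exp t • v := by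
  have h1 := NormedSpace.exp_series_hasSum_exp' (𝕂 := ℝ) T
  have h2 := h1.mapL (ContinuousLinearMap.apply ℝ V v)
  have hpow : ∀ n : ℕ, (T ^ n) v = t ^ n • v := by
    intro n
    induction n with
    | zero => simp
    | succ n ih => rw [pow_succ, ContinuousLinearMap.mul_def, ContinuousLinearMap.comp_apply, h, map_smul, ih, smul_smul, pow_succ']
  have h3 := (NormedSpace.exp_series_hasSum_exp' (𝕂 := ℝ) t).smul_const v
  rw [← Real.exp_eq_exp_ℝ] at h3
  refine h2.unique ?_
  convert h3 using 2 with n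
  simp [hpow, smul_smul]

theorem det_exp_of_isSymmetric {T : V →L[ℝ] V} (hT : (T : V →ₗ[ℝ] V).IsSymmetric) :
    LinearMap.det (NormedSpace.exp T : V →L[ℝ] V).toLinearMap =
      Real.exp (LinearMap.trace ℝ V T) := by
  rw [hT.trace_eq_sum_eigenvalues rfl, ← LinearMap.det_toMatrix (hT.eigenvectorBasis rfl).toBasis]
  have h : LinearMap.toMatrix (hT.eigenvectorBasis rfl).toBasis (hT.eigenvectorBasis rfl).toBasis
      (NormedSpace.exp T : V →L[ℝ] V).toLinearMap =
      Matrix.diagonal fun i => Real.exp (hT.eigenvalues rfl i) := by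
    ext i j
    have h1 : NormedSpace.exp T (hT.eigenvectorBasis rfl j) =
        Real.exp (hT.eigenvalues rfl j) • hT.eigenvectorBasis rfl j :=
      exp_apply_of_apply_eq_smul (hT.apply_eigenvectorBasis rfl j)
    rw [LinearMap.toMatrix_apply]
    simp only [OrthonormalBasis.coe_toBasis, ContinuousLinearMap.coe_coe, h1, map_smul]
    rw [← OrthonormalBasis.coe_toBasis]
    simp [Matrix.diagonal_apply]
    grind
  rw [h, Matrix.det_diagonal]
  simp [Real.exp_sum]

end OperatorExponential

section Exponential

variable {V : Type*} [NormedAddCommGroup V] [InnerProductSpace ℝ V] [EuclideanJordanAlgebra V]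
  [FiniteDimensional ℝ V]

variable (V) in
/-- The multiplication operators as bounded operators. -/
noncomputable def mulCLM : V →L[ℝ] V →L[ℝ] V :=
  LinearMap.toContinuousLinearMap
    ((LinearMap.toContinuousLinearMap : (V →ₗ[ℝ] V) ≃ₗ[ℝ] (V →L[ℝ] V)).toLinearMap ∘ₗ mulOpLinear V)

@[simp]
theorem mulCLM_apply (x y : V) : mulCLM V x y = x * y := rfl

/-- The operator `exp L(a)`. -/
noncomputable def expMul (a : V) : V →L[ℝ] V := NormedSpace.exp (mulCLM V a)

theorem isSelfAdjoint_mulCLM (a : V) : IsSelfAdjoint (mulCLM V a) := by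
  rw [ContinuousLinearMap.isSelfAdjoint_iff_isSymmetric]
  exact isSymmetric_mulOp a

theorem inner_expMul (a x y : V) : inner ℝ (expMul a x) y = inner ℝ x (expMul a y) := by
  have h : IsSelfAdjoint (expMul a) := (isSelfAdjoint_mulCLM a).exp
  exact (ContinuousLinearMap.isSelfAdjoint_iff_isSymmetric.1 h) x y

theorem expMul_neg_apply (a x : V) : expMul a (expMul (-a) x) = x := by
  have := exp_mul_exp_neg (mulCLM V a)
  rw [← map_neg] at this
  exact congrArg (fun T : V →L[ℝ] V => T x) this

theorem expMul_apply_neg (a x : V) : expMul (-a) (expMul a x) = x := by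
  have := expMul_neg_apply (-a) x
  rwa [neg_neg] at this

/-- `exp L(a)` as an invertible operator. -/
noncomputable def expMulEquiv (a : V) : V ≃L[ℝ] V :=
  ContinuousLinearEquiv.equivOfInverse (expMul a) (expMul (-a)) (expMul_apply_neg a)
    (expMul_neg_apply a)

@[simp]
theorem expMulEquiv_apply (a x : V) : expMulEquiv a x = expMul a x := rfl

theorem IsFrame.expMul_one {ι : Type*} [Fintype ι] [DecidableEq ι] {c : ι → V} (hc : IsFrame c)
    (a : ι → ℝ) : expMul (∑ i, a i • c i) 1 = ∑ i, Real.exp (a i) • c i := by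
  rw [← hc.sum_eq, map_sum]
  refine Finset.sum_congr rfl fun j _ => exp_apply_of_apply_eq_smul ?_
  rw [mulCLM_apply, mul_comm, hc.mul_sum_smul]

theorem det_expMul (a : V) :
    LinearMap.det (expMul a).toLinearMap = Real.exp (LinearMap.trace ℝ V (mulOp a)) :=
  det_exp_of_isSymmetric (T := mulCLM V a) (isSymmetric_mulOp a)

theorem hasDerivAt_expMul_smul (a y : V) (t : ℝ) :
    HasDerivAt (fun t : ℝ => expMul (t • a) y) (a * expMul (t • a) y) t := by
  have h := hasDerivAt_exp_smul_const' (𝕂 := ℝ) (mulCLM V a) t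
  have h2 := ((ContinuousLinearMap.apply ℝ V y).hasFDerivAt).comp_hasDerivAt t h
  simp only [expMul, map_smul]
  exact h2

end Exponential

/-! ### The symmetric cone -/

section Cone

variable {V : Type*} [NormedAddCommGroup V] [InnerProductSpace ℝ V] [FiniteDimensional ℝ V]
  [SimpleEuclideanJordanAlgebra V]

theorem one_ne_zero' : (1 : V) ≠ 0 := by
  intro h
  obtain ⟨x, hx⟩ := exists_ne (0 : V)
  exact hx (by rw [← one_jmul x, h, zero_jmul])

/-- Idempotents act positively, which gives one direction; testing on the members of a frame of x
shows that its spectral values are nonnegative, so a square root can be taken spectrally. -/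
theorem mem_range_sq_iff (x : V) :
    x ∈ Set.range (fun y : V => y * y) ↔ ∀ y, 0 ≤ inner ℝ (x * y) y := by
  constructor
  · rintro ⟨z, rfl⟩ y
    obtain ⟨m, c, a, hc, -, -, rfl⟩ := exists_frame z
    simp only [hc.sum_smul_mul_sum_smul, inner_sum_smul_mul_self]
    exact Finset.sum_nonneg fun i _ =>
      mul_nonneg (mul_self_nonneg _) (hc.inner_mul_self_nonneg i y)
  · intro h
    obtain ⟨m, c, a, hc, -, -, rfl⟩ := exists_frame x
    have ha : ∀ i, 0 ≤ a i := by
      intro i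
      have h1 := h (c i)
      rw [mul_comm, hc.mul_sum_smul, inner_smul_left] at h1
      have h2 := real_inner_self_pos.2 (hc.ne_zero i)
      exact nonneg_of_mul_nonneg_left (by simpa using h1) h2
    exact ⟨∑ i, Real.sqrt (a i) • c i, by
      simp only [hc.sum_smul_mul_sum_smul, Real.mul_self_sqrt (ha _)]⟩

theorem norm_jmul_le (x y : V) : ‖x * y‖ ≤ ‖mulCLM V‖ * ‖x‖ * ‖y‖ :=
  (mulCLM V).le_opNorm₂ x y

theorem abs_inner_mul_self_le (x y : V) : |inner ℝ (x * y) y| ≤ ‖mulCLM V‖ * ‖x‖ * ‖y‖ ^ 2 := by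
  calc |inner ℝ (x * y) y| ≤ ‖x * y‖ * ‖y‖ := abs_real_inner_le_norm _ _
    _ ≤ (‖mulCLM V‖ * ‖x‖ * ‖y‖) * ‖y‖ := by gcongr; exact norm_jmul_le x y
    _ = _ := by ring

/-- The cone consists of the elements with positive definite multiplication operator. -/
theorem mem_cone_iff (x : V) :
    x ∈ cone V ↔ ∃ ε > 0, ∀ y, ε * ‖y‖ ^ 2 ≤ inner ℝ (x * y) y := by
  constructor
  · intro hx
    have hcont : Filter.Tendsto (fun ε : ℝ => x - ε • (1 : V)) (nhdsWithin 0 (Set.Ioi 0)) (nhds x) := by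
      have : Continuous fun ε : ℝ => x - ε • (1 : V) := by fun_prop
      have h := (this.tendsto 0).mono_left (nhdsWithin_le_nhds (s := Set.Ioi 0))
      simpa using h
    -- For an interior point, x - ε e is still a square for small ε > 0; this ε is the lower bound.
    have h1 := hcont.eventually (mem_interior_iff_mem_nhds.1 hx)
    obtain ⟨ε, hε, hpos⟩ := (h1.and self_mem_nhdsWithin).exists
    refine ⟨ε, hpos, fun y => ?_⟩
    have := (mem_range_sq_iff _).1 hε y
    rw [sub_jmul, smul_jmul, one_jmul, inner_sub_left, inner_smul_left,
      real_inner_self_eq_norm_sq] at this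
    simpa using this
  · rintro ⟨ε, hε, h⟩
    refine mem_interior_iff_mem_nhds.2 (Metric.mem_nhds_iff.2 ⟨ε / (‖mulCLM V‖ + 1), by positivity, ?_⟩)
    intro z hz
    rw [mem_range_sq_iff]
    intro y
    have h1 := abs_inner_mul_self_le (z - x) y
    rw [sub_jmul, inner_sub_left] at h1
    have h2 := h y
    have h3 : ‖mulCLM V‖ * ‖z - x‖ ≤ ε := by
      rw [mem_ball_iff_norm, lt_div_iff₀ (by positivity)] at hz
      nlinarith [norm_nonneg (z - x)]
    have h4 : ‖mulCLM V‖ * ‖z - x‖ * ‖y‖ ^ 2 ≤ ε * ‖y‖ ^ 2 := by gcongr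
    have h5 := (abs_le.1 h1).1
    linarith

theorem isOpen_cone : IsOpen (cone V) := isOpen_interior

theorem one_mem_cone : (1 : V) ∈ cone V :=
  (mem_cone_iff _).2 ⟨1, one_pos, fun y => by rw [one_jmul, real_inner_self_eq_norm_sq, one_mul]⟩

theorem nonneg_of_mem_cone {x : V} (hx : x ∈ cone V) (y : V) : 0 ≤ inner ℝ (x * y) y :=
  (mem_range_sq_iff x).1 (interior_subset hx) y

theorem add_mem_cone' {x z : V} (hx : x ∈ cone V) (hz : ∀ y, 0 ≤ inner ℝ (z * y) y) :
    x + z ∈ cone V := by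
  rw [mem_cone_iff] at *
  obtain ⟨ε, hε, h⟩ := hx
  refine ⟨ε, hε, fun y => ?_⟩
  rw [add_jmul, inner_add_left]
  linarith [h y, hz y]

theorem add_mem_cone {x z : V} (hx : x ∈ cone V) (hz : z ∈ cone V) : x + z ∈ cone V :=
  add_mem_cone' hx (nonneg_of_mem_cone hz)

theorem smul_mem_cone {x : V} (hx : x ∈ cone V) {t : ℝ} (ht : 0 < t) : t • x ∈ cone V := by
  rw [mem_cone_iff] at *
  obtain ⟨ε, hε, h⟩ := hx
  refine ⟨t * ε, by positivity, fun y => ?_⟩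
  rw [smul_jmul, inner_smul_left, mul_assoc]
  exact mul_le_mul_of_nonneg_left (h y) ht.le

theorem smul_mem_cone_iff {x : V} {t : ℝ} (ht : 0 < t) : t • x ∈ cone V ↔ x ∈ cone V := by
  refine ⟨fun h => ?_, fun h => smul_mem_cone h ht⟩
  have := smul_mem_cone h (inv_pos.2 ht)
  rwa [inv_smul_smul₀ ht.ne'] at this

/-- The cone is self-dual (easy half). -/
theorem inner_nonneg_of_nonneg {x z : V} (hx : ∀ y, 0 ≤ inner ℝ (x * y) y)
    (hz : ∀ y, 0 ≤ inner ℝ (z * y) y) : 0 ≤ inner ℝ x z := by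
  obtain ⟨w, rfl⟩ := (mem_range_sq_iff z).2 hz
  have := hx w
  rwa [mul_comm, inner_jmul] at this

/-- Self-duality gives 0 ≤ (x - z, x + z) = ‖x‖² - ‖z‖². This bounds order intervals and, later,
operators that preserve the cone. -/
theorem norm_le_of_le {x z : V} (h1 : ∀ y, 0 ≤ inner ℝ ((x - z) * y) y)
    (h2 : ∀ y, 0 ≤ inner ℝ ((x + z) * y) y) : ‖z‖ ≤ ‖x‖ := by
  have h := inner_nonneg_of_nonneg h1 h2
  rw [inner_sub_left, inner_add_right, inner_add_right, real_inner_self_eq_norm_sq,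
    real_inner_self_eq_norm_sq, real_inner_comm z x] at h
  exact le_of_sq_le_sq (by linarith) (norm_nonneg _)

theorem norm_le_of_mem_cone {x z : V} (h1 : x - z ∈ cone V) (h2 : x + z ∈ cone V) : ‖z‖ ≤ ‖x‖ :=
  norm_le_of_le (nonneg_of_mem_cone h1) (nonneg_of_mem_cone h2)

variable (V) in
theorem exists_ball_subset_cone : ∃ ρ > 0, ∀ u : V, ‖u‖ ≤ ρ → 1 + u ∈ cone V := by
  obtain ⟨δ, hδ, h⟩ := Metric.isOpen_iff.1 (isOpen_cone (V := V)) 1 one_mem_cone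
  refine ⟨δ / 2, by positivity, fun u hu => h ?_⟩
  rw [mem_ball_iff_norm, add_sub_cancel_left]
  linarith

-- Pair x with e - (ρ/‖x‖) x, which lies in the cone. The estimate provides the decay of e^(-tr x)
-- on Ω.
variable (V) in
theorem exists_norm_le_inner_one : ∃ ρ > 0, ∀ x ∈ cone V, ρ * ‖x‖ ≤ inner ℝ x (1 : V) := by
  obtain ⟨ρ, hρ, h⟩ := exists_ball_subset_cone V
  refine ⟨ρ, hρ, fun x hx => ?_⟩
  rcases eq_or_ne x 0 with rfl | h0
  · simp
  have hn : 0 < ‖x‖ := norm_pos_iff.2 h0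
  have h1 := h (-(ρ / ‖x‖) • x) (by
    rw [norm_smul, norm_neg, Real.norm_of_nonneg (by positivity), div_mul_cancel₀ _ hn.ne'])
  have h2 := inner_nonneg_of_nonneg (nonneg_of_mem_cone hx) (nonneg_of_mem_cone h1)
  rw [inner_add_right, inner_smul_right, real_inner_self_eq_norm_sq] at h2
  have h3 : ρ / ‖x‖ * ‖x‖ ^ 2 = ρ * ‖x‖ := by field_simp
  linarith

/-- Take logarithms of the spectral values. This transitivity is what reduces statements on Ω to the
unit. -/
theorem exists_expMul_one_eq {x : V} (hx : x ∈ cone V) : ∃ a : V, expMul a 1 = x := by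
  obtain ⟨m, c, a, hc, -, -, rfl⟩ := exists_frame x
  obtain ⟨ε, hε, h⟩ := (mem_cone_iff _).1 hx
  have ha : ∀ i, 0 < a i := by
    intro i
    have h1 := h (c i)
    rw [mul_comm _ (c i), hc.mul_sum_smul, inner_smul_left, real_inner_self_eq_norm_sq] at h1
    have h2 : 0 < ‖c i‖ ^ 2 := by have := norm_pos_iff.2 (hc.ne_zero i); positivity
    have h3 := le_of_mul_le_mul_right (by simpa using h1) h2
    linarith
  refine ⟨∑ i, Real.log (a i) • c i, ?_⟩
  rw [hc.expMul_one]
  simp only [Real.exp_log (ha _)]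

theorem expMul_one_mem_cone (a : V) : expMul a 1 ∈ cone V := by
  obtain ⟨m, c, a, hc, -, -, rfl⟩ := exists_frame a
  rw [hc.expMul_one, mem_cone_iff]
  have hm : (Finset.univ : Finset (Fin m)).Nonempty := by
    rw [Finset.nonempty_iff_ne_empty]
    intro h
    have := hc.sum_eq
    rw [h, Finset.sum_empty] at this
    exact one_ne_zero' this.symm
  obtain ⟨j, -, hj⟩ := Finset.exists_min_image Finset.univ a hm
  refine ⟨Real.exp (a j), Real.exp_pos _, fun y => ?_⟩
  rw [inner_sum_smul_mul_self, ← hc.sum_inner_mul_self, Finset.mul_sum]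
  exact Finset.sum_le_sum fun i hi =>
    mul_le_mul_of_nonneg_right (Real.exp_le_exp.2 (hj i hi)) (hc.inner_mul_self_nonneg i y)

end Cone
end EuclideanJordan

namespace EuclideanJordan

/-! ### Rank and density of regular elements -/

section Rank

variable {V : Type*} [NormedAddCommGroup V] [InnerProductSpace ℝ V] [EuclideanJordanAlgebra V]
  [FiniteDimensional ℝ V]

theorem natDegree_minPoly_le_finrank (x : V) : (minPoly x).natDegree ≤ Module.finrank ℝ V := by
  obtain ⟨m, c, a, hc, ha, -, rfl⟩ := exists_frame x
  rw [hc.minPoly_eq ha, natDegree_prod_of_monic _ _ fun i _ => monic_X_sub_C _]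
  simpa using hc.linearIndependent.fintype_card_le_finrank

theorem bddAbove_natDegree : BddAbove (Set.range fun x : V => (minPoly x).natDegree) :=
  ⟨Module.finrank ℝ V, by rintro _ ⟨x, rfl⟩; exact natDegree_minPoly_le_finrank x⟩

theorem natDegree_minPoly_le_rank (x : V) : (minPoly x).natDegree ≤ rank V :=
  le_ciSup bddAbove_natDegree x

variable (V) in
theorem regular_nonempty : (regular V).Nonempty := by
  obtain ⟨x, hx⟩ := Nat.sSup_mem (Set.range_nonempty fun x : V => (minPoly x).natDegree)
    bddAbove_natDegree
  exact ⟨x, hx⟩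

variable (V) in
theorem rank_le_finrank : rank V ≤ Module.finrank ℝ V := by
  obtain ⟨x, hx⟩ := regular_nonempty V
  rw [← show (minPoly x).natDegree = rank V from hx]
  exact natDegree_minPoly_le_finrank x

theorem exists_frame_of_mem_regular {x : V} (hx : x ∈ regular V) :
    ∃ (c : Fin (rank V) → V) (a : Fin (rank V) → ℝ),
      IsFrame c ∧ Function.Injective a ∧ x = ∑ i, a i • c i := by
  obtain ⟨m, c, a, hc, ha, -, rfl⟩ := exists_frame x
  have h : (minPoly (∑ i, a i • c i)).natDegree = m := by
    rw [hc.minPoly_eq ha, natDegree_prod_of_monic _ _ fun i _ => monic_X_sub_C _]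
    simp
  have hm : m = rank V := h.symm.trans hx
  subst hm
  exact ⟨c, a, hc, ha, rfl⟩

theorem IsFrame.mem_regular {c : Fin (rank V) → V} (hc : IsFrame c) {a : Fin (rank V) → ℝ}
    (ha : Function.Injective a) : ∑ i, a i • c i ∈ regular V := by
  change (minPoly _).natDegree = _
  rw [hc.minPoly_eq ha, natDegree_prod_of_monic _ _ fun i _ => monic_X_sub_C _]
  simp

theorem mem_regular_iff (x : V) :
    x ∈ regular V ↔ LinearIndependent ℝ fun i : Fin (rank V) => polyVal x (X ^ (i : ℕ)) := by
  constructor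
  · intro hx
    rw [Fintype.linearIndependent_iff]
    intro g hg
    set p : ℝ[X] := ∑ i : Fin (rank V), g i • X ^ (i : ℕ) with hp
    have h1 : polyVal x p = 0 := by rw [hp, polyVal_sum]; simpa [polyVal_smul] using hg
    have h2 : p.degree < (minPoly x).degree := by
      rw [degree_eq_natDegree (minPoly_monic x).ne_zero, show (minPoly x).natDegree = rank V from hx]
      refine lt_of_le_of_lt (degree_sum_le _ _) ?_
      rw [Finset.sup_lt_iff (WithBot.bot_lt_coe _)]
      intro i _
      refine lt_of_le_of_lt (degree_smul_le _ _) ?_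
      rw [degree_X_pow]
      exact_mod_cast i.2
    have h3 : p = 0 := eq_zero_of_dvd_of_degree_lt (minPoly_dvd h1) h2
    intro i
    have h4 := congrArg (fun q : ℝ[X] => q.coeff i) h3
    simpa [hp, finsetSum_coeff, coeff_X_pow, Fin.val_inj] using h4
  · intro h
    refine le_antisymm (natDegree_minPoly_le_rank x) ?_
    by_contra hlt
    push Not at hlt
    have h1 := polyVal_minPoly x
    rw [(minPoly x).as_sum_range' _ hlt, polyVal_sum, Finset.sum_range] at h1
    simp only [← smul_X_eq_monomial, polyVal_smul] at h1
    have h2 := Fintype.linearIndependent_iff.1 h _ h1 ⟨_, hlt⟩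
    exact one_ne_zero ((minPoly_monic x).coeff_natDegree.symm.trans h2)

/-- The Gram determinant of the powers `1, x, …, x ^ (r - 1)`. -/
noncomputable def gramMatrix (x : V) : Matrix (Fin (rank V)) (Fin (rank V)) ℝ :=
  Matrix.gram ℝ fun i : Fin (rank V) => polyVal x (X ^ (i : ℕ))

theorem mem_regular_iff_det_ne_zero (x : V) : x ∈ regular V ↔ (gramMatrix x).det ≠ 0 := by
  rw [mem_regular_iff, gramMatrix, Matrix.det_gram_ne_zero_iff_linearIndependent]

theorem contDiff_polyVal_X_pow (m : ℕ) {n : WithTop ℕ∞} :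
    ContDiff ℝ n fun x : V => polyVal x (X ^ m) := by
  induction m with
  | zero => simpa [polyVal_one] using contDiff_const
  | succ m ih =>
    simp only [polyVal_X_pow_succ, ← mulCLM_apply]
    exact ((mulCLM V).contDiff).clm_apply ih

theorem contDiff_gramMatrix (i j : Fin (rank V)) {n : WithTop ℕ∞} :
    ContDiff ℝ n fun x : V => gramMatrix x i j :=
  (contDiff_polyVal_X_pow _).inner ℝ (contDiff_polyVal_X_pow _)

theorem contDiff_det_gramMatrix {n : WithTop ℕ∞} : ContDiff ℝ n fun x : V => (gramMatrix x).det := by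
  simp only [Matrix.det_apply, Units.smul_def, zsmul_eq_mul]
  exact ContDiff.sum fun σ _ => contDiff_const.mul
    (contDiff_prod fun i _ => contDiff_gramMatrix _ _)

-- The Gram determinant is analytic and nonzero somewhere, so by the identity theorem it vanishes on
-- no open set.
variable (V) in
theorem dense_regular : Dense (regular V) := by
  have hana : AnalyticOnNhd ℝ (fun x : V => (gramMatrix x).det) Set.univ := by
    exact fun x _ => (contDiff_det_gramMatrix (V := V) (n := ω)).contDiffAt.analyticAt
  intro x
  by_contra hx
  have h1 : (regular V)ᶜ ∈ nhds x := by
    rw [mem_closure_iff_frequently, Filter.not_frequently] at hx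
    exact hx
  have h2 : (fun x : V => (gramMatrix x).det) =ᶠ[nhds x] 0 := by
    filter_upwards [h1] with y hy
    by_contra h
    exact hy ((mem_regular_iff_det_ne_zero y).2 h)
  obtain ⟨y, hy⟩ := regular_nonempty V
  exact (mem_regular_iff_det_ne_zero y).1 hy
    (hana.eqOn_zero_of_preconnected_of_eventuallyEq_zero isPreconnected_univ (Set.mem_univ x) h2
      (Set.mem_univ y))

/-- Pairing p(x) = 0 with 1, x, …, x^(r-1) gives a linear system for the lower coefficients, solved
by Cramer's rule. The formula makes their continuity on the regular set visible. -/
theorem coeff_minPoly_eq {x : V} (hx : x ∈ regular V) (i : Fin (rank V)) :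
    (minPoly x).coeff i = ((gramMatrix x).det⁻¹ • ((gramMatrix x).adjugate.mulVec fun j : Fin (rank V) =>
      -inner ℝ (polyVal x (X ^ (j : ℕ))) (polyVal x (X ^ rank V)))) i := by
  have hdet := (mem_regular_iff_det_ne_zero x).1 hx
  have h1 := polyVal_minPoly x
  have hd : (minPoly x).natDegree = rank V := hx
  have hl : (minPoly x).coeff (rank V) = 1 := by rw [← hd]; exact (minPoly_monic x).coeff_natDegree
  rw [(minPoly x).as_sum_range_C_mul_X_pow, hd, Finset.sum_range_succ, hl, polyVal_add, polyVal_sum,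
    Finset.sum_range] at h1
  simp only [← smul_eq_C_mul, polyVal_smul, one_smul] at h1
  have h2 : (gramMatrix x).mulVec (fun i => (minPoly x).coeff i) = fun j : Fin (rank V) =>
      -inner ℝ (polyVal x (X ^ (j : ℕ))) (polyVal x (X ^ rank V)) := by
    ext j
    have h3 := congrArg (fun v => inner ℝ (polyVal x (X ^ (j : ℕ))) v) h1
    simp only [inner_add_right, inner_sum, inner_smul_right, inner_zero_right] at h3
    rw [← eq_neg_iff_add_eq_zero] at h3
    rw [← h3]
    simp [Matrix.mulVec, dotProduct, gramMatrix, Matrix.gram_apply, mul_comm]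
  rw [← h2, Matrix.mulVec_mulVec, Matrix.adjugate_mul, Matrix.smul_mulVec, Matrix.one_mulVec,
    smul_smul, inv_mul_cancel₀ hdet, one_smul]

theorem continuousOn_coeff_minPoly (i : Fin (rank V)) :
    ContinuousOn (fun x : V => (minPoly x).coeff i) (regular V) := by
  refine ContinuousOn.congr ?_ fun x hx => coeff_minPoly_eq hx i
  have hg : Continuous fun x : V => gramMatrix x :=
    continuous_matrix fun i j => (contDiff_gramMatrix (n := 0) i j).continuous
  have hv : Continuous fun x : V => fun j : Fin (rank V) =>
      -inner ℝ (polyVal x (X ^ (j : ℕ))) (polyVal x (X ^ rank V)) :=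
    continuous_pi fun j => (((contDiff_polyVal_X_pow (n := 0) _).continuous).inner
      (contDiff_polyVal_X_pow (n := 0) _).continuous).neg
  have h1 : Continuous fun x : V => (gramMatrix x).adjugate.mulVec fun j : Fin (rank V) =>
      -inner ℝ (polyVal x (X ^ (j : ℕ))) (polyVal x (X ^ rank V)) :=
    hg.matrix_adjugate.matrix_mulVec hv
  simp only [Pi.smul_apply, smul_eq_mul]
  exact (hg.matrix_det.continuousOn.inv₀ fun x hx => (mem_regular_iff_det_ne_zero x).1 hx).mul
    ((continuous_apply i).comp h1).continuousOn

end Rank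

/-! ### Trace and determinant as polynomial functions -/

section Determinant

variable {V : Type*} [NormedAddCommGroup V] [InnerProductSpace ℝ V] [FiniteDimensional ℝ V]
  [SimpleEuclideanJordanAlgebra V]

variable (V) in
theorem rank_pos : 0 < rank V := by
  obtain ⟨x, hx⟩ := regular_nonempty V
  obtain ⟨c, a, hc, -, -⟩ := exists_frame_of_mem_regular hx
  by_contra h
  have h0 : rank V = 0 := by omega
  have : IsEmpty (Fin (rank V)) := by rw [h0]; infer_instance
  have := hc.sum_eq
  rw [Finset.univ_eq_empty, Finset.sum_empty] at this
  exact one_ne_zero' this.symm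

theorem inner_one_eq_of_mem_regular {x : V} (hx : x ∈ regular V) :
    inner ℝ x (1 : V) = -(minPoly x).coeff (rank V - 1) := by
  rw [SimpleEuclideanJordanAlgebra.inner_eq_tr, jmul_one, tr]
  refine extendFrom_eq (dense_regular V x) ?_
  have hr := rank_pos V
  have := (continuousOn_coeff_minPoly (V := V) ⟨rank V - 1, by omega⟩) x hx
  exact this.neg

theorem IsFrame.sum_mul_inner_one {c : Fin (rank V) → V} (hc : IsFrame c) {a : Fin (rank V) → ℝ}
    (ha : Function.Injective a) : ∑ i, a i * inner ℝ (c i) (1 : V) = ∑ i, a i := by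
  have h := inner_one_eq_of_mem_regular (hc.mem_regular ha)
  have h2 := prod_X_sub_C_coeff_card_pred Finset.univ a (by simpa using rank_pos V)
  rw [Finset.card_univ, Fintype.card_fin] at h2
  rw [hc.minPoly_eq ha, h2, neg_neg, sum_inner] at h
  simpa [inner_smul_left] using h

/-- The members of a frame of maximal length have trace one. -/
theorem IsFrame.inner_one_eq_one {c : Fin (rank V) → V} (hc : IsFrame c) (i : Fin (rank V)) :
    inner ℝ (c i) (1 : V) = 1 := by
  have h1 := hc.sum_mul_inner_one (a := fun j => (j : ℝ)) fun j k h => by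
    simpa [Fin.val_inj] using h
  -- Raising the i-th of the coefficients 0, …, r - 1 by r keeps them distinct; subtracting the two
  -- trace formulas leaves r · tr(c i) = r.
  have h2 := hc.sum_mul_inner_one (a := fun j => (j : ℝ) + if j = i then (rank V : ℝ) else 0) <| by
    intro j k h
    simp only at h
    have hj := j.2
    have hk := k.2
    split_ifs at h with h3 h4 h4
    · rw [h3, h4]
    · have : (j : ℕ) + rank V = k := by exact_mod_cast (by linarith : (j : ℝ) + rank V = k)
      omega
    · have : (j : ℕ) = k + rank V := by exact_mod_cast (by linarith : (j : ℝ) = k + rank V)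
      omega
    · simpa [Fin.val_inj] using h
  simp only [add_mul, Finset.sum_add_distrib, h1, add_right_inj, ite_mul, zero_mul,
    Finset.sum_ite_eq', Finset.mem_univ, if_true] at h2
  have hr : (rank V : ℝ) ≠ 0 := by exact_mod_cast (rank_pos V).ne'
  exact mul_left_cancel₀ hr (by rw [h2, mul_one])

/-- The power sums `tr (x ^ k)`. -/
noncomputable def powerSum (k : ℕ) (x : V) : ℝ := inner ℝ (polyVal x (X ^ k)) (1 : V)

/-- The elementary symmetric functions of the spectral values, defined by Newton's identities. -/
noncomputable def elemSymm (x : V) : ℕ → ℝ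
  | 0 => 1
  | k + 1 => ((k : ℝ) + 1)⁻¹ * ((-1) ^ k *
      ∑ i : Fin (k + 1), (-1) ^ (i : ℕ) * elemSymm x i * powerSum (k + 1 - i) x)

theorem IsFrame.powerSum_eq {c : Fin (rank V) → V} (hc : IsFrame c) (a : Fin (rank V) → ℝ) (k : ℕ) :
    powerSum k (∑ i, a i • c i) = ∑ i, a i ^ k := by
  simp [powerSum, hc.polyVal_sum_smul, sum_inner, inner_smul_left, hc.inner_one_eq_one]

/-- The members of a maximal frame have trace one, so `powerSum` gives the usual power sums of the
spectral values and the recursion is Newton's identity. -/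
theorem IsFrame.elemSymm_eq {c : Fin (rank V) → V} (hc : IsFrame c) (a : Fin (rank V) → ℝ) (k : ℕ) :
    elemSymm (∑ i, a i • c i) k = (Finset.univ.val.map a).esymm k := by
  rw [← MvPolynomial.aeval_esymm_eq_multiset_esymm (Fin (rank V)) ℝ k a]
  induction k using Nat.strong_induction_on with
  | _ k ih =>
    match k with
    | 0 => simp [elemSymm]
    | k + 1 =>
      have h := congrArg (MvPolynomial.aeval a)
        (MvPolynomial.mul_esymm_eq_sum (Fin (rank V)) ℝ (k + 1))
      rw [elemSymm, inv_mul_eq_iff_eq_mul₀ (by positivity)]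
      simp only [map_mul, map_natCast, map_pow, map_neg, map_one, map_sum] at h
      push_cast at h
      rw [h, Finset.sum_filter, Finset.Nat.sum_antidiagonal_eq_sum_range_succ_mk,
        Finset.sum_range_succ, if_neg (lt_irrefl _), add_zero, Finset.sum_range]
      rw [pow_add _ k 2, pow_two, neg_mul_neg, one_mul, mul_one]
      congr 1
      refine Finset.sum_congr rfl fun i _ => ?_
      rw [if_pos i.2, ih i i.2, hc.powerSum_eq]
      simp [MvPolynomial.psum]

theorem contDiff_powerSum (k : ℕ) {n : WithTop ℕ∞} : ContDiff ℝ n fun x : V => powerSum k x :=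
  (contDiff_polyVal_X_pow k).inner ℝ contDiff_const

/-- The benefit of defining these functions by Newton's recursion: smoothness holds on all of V,
including where spectral values collide. -/
theorem contDiff_elemSymm (k : ℕ) {n : WithTop ℕ∞} : ContDiff ℝ n fun x : V => elemSymm x k := by
  induction k using Nat.strong_induction_on with
  | _ k ih =>
    match k with
    | 0 => simpa [elemSymm] using contDiff_const
    | k + 1 =>
      simp only [elemSymm]
      exact contDiff_const.mul (contDiff_const.mul (ContDiff.sum fun i _ =>
        (contDiff_const.mul (ih i i.2)).mul (contDiff_powerSum _)))

theorem elemSymm_rank_eq_prod {c : Fin (rank V) → V} (hc : IsFrame c) (a : Fin (rank V) → ℝ) :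
    elemSymm (∑ i, a i • c i) (rank V) = ∏ i, a i := by
  have h1 := Multiset.prod_X_sub_C_coeff (Finset.univ.val.map a) (Nat.zero_le _)
  simp only [Multiset.card_map, Finset.card_val, Finset.card_univ, Fintype.card_fin, tsub_zero,
    Multiset.map_map, coeff_zero_eq_eval_zero] at h1
  rw [hc.elemSymm_eq]
  have h2 : ((-1 : ℝ) ^ rank V) * ((-1) ^ rank V * (Finset.univ.val.map a).esymm (rank V)) =
      ∏ i, a i := by
    rw [← h1]
    change _ * eval 0 (∏ i, (X - C (a i))) = _
    rw [eval_prod]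
    simp [Finset.prod_neg, ← mul_assoc, ← mul_pow]
  rw [← h2, ← mul_assoc, ← mul_pow]
  simp

/-- The determinant is the polynomial function `elemSymm · r`. -/
theorem det_eq_elemSymm (x : V) : det x = elemSymm x (rank V) := by
  refine extendFrom_eq (dense_regular V x) ?_
  have h : Filter.Tendsto (fun y : V => elemSymm y (rank V)) (nhdsWithin x (regular V))
      (nhds (elemSymm x (rank V))) :=
    ((contDiff_elemSymm (n := 0) (rank V)).continuous.tendsto x).mono_left nhdsWithin_le_nhds
  refine h.congr' ?_
  filter_upwards [self_mem_nhdsWithin] with y hy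
  obtain ⟨c, a, hc, ha, rfl⟩ := exists_frame_of_mem_regular hy
  rw [elemSymm_rank_eq_prod hc, hc.minPoly_eq ha, coeff_zero_eq_eval_zero, eval_prod]
  simp [Finset.prod_neg, ← mul_assoc, ← mul_pow]

theorem IsFrame.det_eq {c : Fin (rank V) → V} (hc : IsFrame c) (a : Fin (rank V) → ℝ) :
    det (∑ i, a i • c i) = ∏ i, a i := by
  rw [det_eq_elemSymm, elemSymm_rank_eq_prod hc]

theorem contDiff_det {n : WithTop ℕ∞} : ContDiff ℝ n (det : V → ℝ) := by
  rw [show (det : V → ℝ) = fun x => elemSymm x (rank V) from funext det_eq_elemSymm]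
  exact contDiff_elemSymm _

theorem continuous_det : Continuous (det : V → ℝ) := (contDiff_det (n := 0)).continuous

theorem polyVal_smul_left (t : ℝ) (x : V) (k : ℕ) :
    polyVal (t • x) (X ^ k) = t ^ k • polyVal x (X ^ k) := by
  induction k with
  | zero => simp [polyVal_one]
  | succ k ih => rw [polyVal_X_pow_succ, polyVal_X_pow_succ, ih, smul_jmul, jmul_smul, smul_smul, pow_succ']

theorem elemSymm_smul (t : ℝ) (x : V) (k : ℕ) : elemSymm (t • x) k = t ^ k * elemSymm x k := by
  induction k using Nat.strong_induction_on with
  | _ k ih =>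
    match k with
    | 0 => simp [elemSymm]
    | k + 1 =>
      simp only [elemSymm]
      rw [mul_left_comm (t ^ (k + 1)), mul_left_comm (t ^ (k + 1)), Finset.mul_sum (a := t ^ (k + 1))]
      congr 2
      refine Finset.sum_congr rfl fun i _ => ?_
      have hi := i.2
      have hk : t ^ (k + 1) = t ^ (i : ℕ) * t ^ (k + 1 - i) := by rw [← pow_add]; congr 1; omega
      rw [ih i i.2, powerSum, powerSum, polyVal_smul_left, inner_smul_left, hk]
      simp only [conj_trivial]
      ring

theorem det_smul (t : ℝ) (x : V) : det (t • x) = t ^ rank V * det x := by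
  rw [det_eq_elemSymm, det_eq_elemSymm, elemSymm_smul]

variable (V) in
theorem det_one : det (1 : V) = 1 := by
  obtain ⟨x, hx⟩ := regular_nonempty V
  obtain ⟨c, a, hc, -, -⟩ := exists_frame_of_mem_regular hx
  have := hc.det_eq fun _ => 1
  simpa [hc.sum_eq] using this

variable (V) in
theorem inner_one_one : inner ℝ (1 : V) 1 = (rank V : ℝ) := by
  obtain ⟨x, hx⟩ := regular_nonempty V
  obtain ⟨c, a, hc, -, -⟩ := exists_frame_of_mem_regular hx
  nth_rewrite 1 [← hc.sum_eq]
  simp [sum_inner, hc.inner_one_eq_one]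

/-- The Cayley–Hamilton identity for the generic minimal polynomial. -/
theorem sum_elemSymm_eq_zero (x : V) :
    ∑ k ∈ Finset.range (rank V + 1), ((-1) ^ k * elemSymm x k) • polyVal x (X ^ (rank V - k)) = 0 := by
  have hcont : Continuous fun x : V => ∑ k ∈ Finset.range (rank V + 1),
      ((-1) ^ k * elemSymm x k) • polyVal x (X ^ (rank V - k)) :=
    continuous_finsetSum _ fun k _ =>
      (continuous_const.mul (contDiff_elemSymm (n := 0) k).continuous).smul
        (contDiff_polyVal_X_pow (n := 0) _).continuous
  -- On regular elements the sum is the minimal polynomial evaluated at the element; density does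
  -- the rest.
  refine congrFun (Continuous.ext_on (dense_regular V) hcont
    (continuous_const (y := (0 : V))) fun y hy => ?_) x
  obtain ⟨c, a, hc, ha, rfl⟩ := exists_frame_of_mem_regular hy
  have h := Multiset.prod_X_sub_X_eq_sum_esymm (Finset.univ.val.map a)
  rw [Multiset.map_map] at h
  have h2 := polyVal_minPoly (∑ i, a i • c i)
  rw [hc.minPoly_eq ha, show ∏ i, (X - C (a i)) = (Multiset.map ((fun t => X - C t) ∘ a)
    Finset.univ.val).prod from rfl, h, polyVal_sum] at h2
  rw [← h2]
  simp only [Multiset.card_map, Finset.card_val, Finset.card_univ, Fintype.card_fin]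
  refine Finset.sum_congr rfl fun k _ => ?_
  rw [hc.elemSymm_eq, ← polyVal_smul]
  congr 1
  rw [smul_eq_C_mul, map_mul]
  simp [mul_assoc]

/-- The frame need not be maximal, so the product formula is not available. Multiplying the
Cayley–Hamilton identity by c j leaves only the constant term, which is ± det. -/
theorem IsFrame.det_eq_zero {m : ℕ} {c : Fin m → V} (hc : IsFrame c) {a : Fin m → ℝ} {j : Fin m}
    (hj : a j = 0) : det (∑ i, a i • c i) = 0 := by
  have h := congrArg (fun v => c j * v) (sum_elemSymm_eq_zero (∑ i, a i • c i))
  simp only [jmul_sum, jmul_smul, hc.polyVal_sum_smul, jmul_zero] at h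
  simp only [← jmul_smul, ← jmul_sum, hc.mul_sum_smul] at h
  simp only [smul_smul, ← Finset.sum_smul] at h
  have h1 := (smul_eq_zero.1 h).resolve_right (hc.ne_zero j)
  rw [Finset.sum_range_succ, Finset.sum_eq_zero] at h1
  · simp only [tsub_self, pow_zero, eval_one, mul_one, zero_add] at h1
    rw [det_eq_elemSymm]
    exact (mul_eq_zero.1 h1).resolve_left (by simp)
  · intro k hk
    have hk' := Finset.mem_range.1 hk
    rw [eval_pow, eval_X, hj, zero_pow (by omega), mul_zero]

end Determinant
end EuclideanJordan

namespace EuclideanJordan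

/-! ### Relative invariance of det, the action on the cone, and Tr L(x) -/

section Invariance

variable {V : Type*} [NormedAddCommGroup V] [InnerProductSpace ℝ V] [FiniteDimensional ℝ V]
  [SimpleEuclideanJordanAlgebra V]

theorem hasFDerivAt_polyVal_succ (x : V) (k : ℕ) :
    HasFDerivAt (fun y : V => polyVal y (X ^ (k + 1)))
      ((mulCLM V x).comp (fderiv ℝ (fun y : V => polyVal y (X ^ k)) x) +
        (mulCLM V).flip (polyVal x (X ^ k))) x := by
  have h : HasFDerivAt (fun y : V => polyVal y (X ^ k))
      (fderiv ℝ (fun y : V => polyVal y (X ^ k)) x) x :=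
    ((contDiff_polyVal_X_pow (n := 1) k).differentiable one_ne_zero x).hasFDerivAt
  have h2 := ((mulCLM V).hasFDerivAt (x := x)).clm_apply h
  simp only [polyVal_X_pow_succ, ← mulCLM_apply]
  exact h2

/-- Differentiate x · x^k; the symmetry of L(x) shifts a factor x to the other side of the inner
product, raising m while k drops. -/
theorem inner_fderiv_polyVal (x u : V) (m k : ℕ) :
    inner ℝ (polyVal x (X ^ m)) (fderiv ℝ (fun y : V => polyVal y (X ^ (k + 1))) x u) =
      ((k : ℝ) + 1) * inner ℝ (polyVal x (X ^ (m + k))) u := by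
  induction k generalizing m with
  | zero =>
    have h : (fun y : V => polyVal y (X ^ (0 + 1))) = id := by
      funext y; rw [zero_add, pow_one, polyVal_X]; rfl
    rw [h]; simp
  | succ k ih =>
    rw [(hasFDerivAt_polyVal_succ x (k + 1)).fderiv]
    simp only [add_apply, ContinuousLinearMap.comp_apply, mulCLM_apply,
      ContinuousLinearMap.flip_apply, inner_add_right]
    rw [← inner_jmul, ← polyVal_X_pow_succ, ih, mul_comm u, ← inner_jmul, ← polyVal_mul, ← pow_add]
    rw [show k + 1 + m = m + (k + 1) by ring, show m + 1 + k = m + (k + 1) by ring]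
    push_cast
    ring

theorem fderiv_powerSum_succ (x u : V) (k : ℕ) :
    fderiv ℝ (powerSum (V := V) (k + 1)) x u = ((k : ℝ) + 1) * inner ℝ (polyVal x (X ^ k)) u := by
  have h := inner_fderiv_polyVal x u 0 k
  rw [zero_add] at h
  rw [← h, pow_zero, polyVal_one]
  have hd : HasFDerivAt (fun y : V => polyVal y (X ^ (k + 1)))
      (fderiv ℝ (fun y : V => polyVal y (X ^ (k + 1))) x) x :=
    ((contDiff_polyVal_X_pow (n := 1) _).differentiable one_ne_zero x).hasFDerivAt
  have h2 := (hd.inner ℝ (hasFDerivAt_const (1 : V) x)).fderiv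
  have h3 := congrArg (fun T => T u) h2
  change fderiv ℝ (fun y : V => inner ℝ (polyVal y (X ^ (k + 1))) 1) x u = _
  rw [h3]
  simp [real_inner_comm]

/-- These functions are polynomials in the power sums, and the differential of each power sum at x
is a multiple of the pairing with a power of x. -/
theorem fderiv_elemSymm_eq_zero {x u : V} (h : ∀ j : ℕ, inner ℝ (polyVal x (X ^ j)) u = 0) (k : ℕ) :
    fderiv ℝ (fun y : V => elemSymm y k) x u = 0 := by
  induction k using Nat.strong_induction_on with
  | _ k ih =>
    match k with
    | 0 => simp [elemSymm]
    | k + 1 =>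
      have hE : ∀ j, HasFDerivAt (fun y : V => elemSymm y j)
          (fderiv ℝ (fun y : V => elemSymm y j) x) x := fun j =>
        ((contDiff_elemSymm (n := 1) j).differentiable one_ne_zero x).hasFDerivAt
      have hP : ∀ j, HasFDerivAt (powerSum (V := V) j) (fderiv ℝ (powerSum (V := V) j) x) x := fun j =>
        ((contDiff_powerSum (n := 1) j).differentiable one_ne_zero x).hasFDerivAt
      have hs := HasFDerivAt.fun_sum (u := Finset.univ) fun (i : Fin (k + 1)) _ =>
        ((hE i).const_mul ((-1 : ℝ) ^ (i : ℕ))).mul (hP (k + 1 - i))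
      have ht := (hs.const_mul ((-1 : ℝ) ^ k)).const_mul (((k : ℝ) + 1)⁻¹)
      have hf : (fun y : V => elemSymm y (k + 1)) = fun y => ((k : ℝ) + 1)⁻¹ * ((-1) ^ k *
          ∑ i : Fin (k + 1), (-1) ^ (i : ℕ) * elemSymm y i * powerSum (k + 1 - i) y) := by
        funext y; rw [elemSymm]
      rw [hf]
      refine (congrArg (fun T : V →L[ℝ] ℝ => T u) ht.fderiv).trans ?_
      simp only [smul_apply, sum_apply,
        add_apply]
      rw [Finset.sum_eq_zero]
      · simp
      · intro i _
        have hi : k + 1 - (i : ℕ) = (k - i) + 1 := by have := i.2; omega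
        rw [ih i i.2, hi, fderiv_powerSum_succ, h]
        simp

/-- Let w be the orthogonal projection of a y to the span of a frame of y. The difference a y - w is
orthogonal to the powers of y, so it does not change det to first order; along w the determinant is
an explicit product. -/
theorem fderiv_det_mul_of_mem_regular (a : V) {y : V} (hy : y ∈ regular V) :
    fderiv ℝ (det : V → ℝ) y (a * y) = inner ℝ a (1 : V) * det y := by
  obtain ⟨c, l, hc, -, rfl⟩ := exists_frame_of_mem_regular hy
  set y := ∑ i, l i • c i with hy'
  set α : Fin (rank V) → ℝ := fun i => inner ℝ (c i) a with hα
  set w : V := ∑ i, (l i * α i) • c i with hw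
  have hcc : ∀ i, inner ℝ (c i) (c i) = (1 : ℝ) := fun i => by
    rw [hc.inner_eq, if_pos rfl, hc.inner_one_eq_one]
  have h1 : ∀ j : ℕ, inner ℝ (polyVal y (X ^ j)) (a * y - w) = 0 := by
    intro j
    rw [hy', hc.polyVal_sum_smul, sum_inner]
    refine Finset.sum_eq_zero fun i _ => ?_
    rw [inner_smul_left, inner_sub_right, mul_comm a, ← inner_jmul, mul_comm _ (c i),
      hc.mul_sum_smul, inner_smul_left, hw, inner_sum, Finset.sum_eq_single i]
    · rw [inner_smul_right, hcc]; simp [hα]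
    · intro k _ hk
      rw [inner_smul_right, hc.inner_eq, if_neg hk.symm, mul_zero]
    · simp
  have hdet : (det : V → ℝ) = fun y => elemSymm y (rank V) := funext det_eq_elemSymm
  have h2 : fderiv ℝ (det : V → ℝ) y (a * y - w) = 0 := by
    rw [hdet]; exact fderiv_elemSymm_eq_zero h1 _
  rw [map_sub, sub_eq_zero] at h2
  have h3 : HasDerivAt (fun t : ℝ => det (y + t • w)) (fderiv ℝ (det : V → ℝ) y w) 0 := by
    have hl : HasDerivAt (fun t : ℝ => y + t • w) w 0 := by
      simpa using ((hasDerivAt_id (0 : ℝ)).smul_const w).const_add y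
    have hd : HasFDerivAt (det : V → ℝ) (fderiv ℝ (det : V → ℝ) y) (y + (0 : ℝ) • w) := by
      rw [zero_smul, add_zero]
      exact ((contDiff_det (n := 1)).differentiable one_ne_zero y).hasFDerivAt
    exact hd.comp_hasDerivAt 0 hl
  have h4 : (fun t : ℝ => det (y + t • w)) = fun t => det y * ∏ i, (1 + t * α i) := by
    funext t
    have : y + t • w = ∑ i, (l i * (1 + t * α i)) • c i := by
      rw [hy', hw, Finset.smul_sum, ← Finset.sum_add_distrib]
      refine Finset.sum_congr rfl fun i _ => ?_
      rw [smul_smul, ← add_smul]; ring_nf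
    rw [this, hc.det_eq, hy', hc.det_eq, Finset.prod_mul_distrib]
  have h5 : HasDerivAt (fun t : ℝ => det y * ∏ i, (1 + t * α i)) (det y * ∑ i, α i) 0 := by
    have := HasDerivAt.fun_finsetProd (u := Finset.univ) (x := (0 : ℝ))
      (f := fun (i : Fin (rank V)) t => 1 + t * α i) (f' := fun i => α i) fun i _ => by
        simpa using ((hasDerivAt_id (0 : ℝ)).mul_const (α i)).const_add 1
    simpa using this.const_mul (det y)
  rw [h4] at h3
  rw [h2, h3.unique h5, mul_comm, hα, ← sum_inner, hc.sum_eq, real_inner_comm]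

/-- Infinitesimal relative invariance of the determinant. -/
theorem fderiv_det_mul (a y : V) :
    fderiv ℝ (det : V → ℝ) y (a * y) = inner ℝ a (1 : V) * det y := by
  have h1 : Continuous fun y : V => fderiv ℝ (det : V → ℝ) y (a * y) := by
    have := (contDiff_det (V := V) (n := 1)).continuous_fderiv one_ne_zero
    have h2 : Continuous fun y : V => a * y := (mulCLM V a).continuous
    exact this.clm_apply h2
  have h2 : Continuous fun y : V => inner ℝ a (1 : V) * det y := continuous_const.mul continuous_det
  exact congrFun (Continuous.ext_on (dense_regular V) h1 h2 fun y hy =>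
    fderiv_det_mul_of_mem_regular a hy) y

/-- By `fderiv_det_mul`, e^(-t tr a) det(exp(t L(a)) y) has zero derivative in t. -/
theorem det_expMul_apply (a y : V) : det (expMul a y) = Real.exp (inner ℝ a (1 : V)) * det y := by
  have h1 : ∀ t : ℝ, HasDerivAt (fun t : ℝ => Real.exp (-(t * inner ℝ a (1 : V))) *
      det (expMul (t • a) y)) 0 t := by
    intro t
    have hd : HasFDerivAt (det : V → ℝ) (fderiv ℝ (det : V → ℝ) (expMul (t • a) y))
        (expMul (t • a) y) :=
      ((contDiff_det (n := 1)).differentiable one_ne_zero _).hasFDerivAt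
    have h2 := hd.comp_hasDerivAt t (hasDerivAt_expMul_smul a y t)
    have h3 : HasDerivAt (fun t : ℝ => Real.exp (-(t * inner ℝ a (1 : V))))
        (Real.exp (-(t * inner ℝ a (1 : V))) * (-inner ℝ a (1 : V))) t := by
      simpa using (((hasDerivAt_id t).mul_const (inner ℝ a (1 : V))).neg).exp
    have h4 := h3.mul h2
    convert! h4 using 1
    rw [fderiv_det_mul]
    simp only [Function.comp]
    ring
  have h2 := is_const_of_deriv_eq_zero (fun t => (h1 t).differentiableAt) (fun t => (h1 t).deriv) 1 0
  simp only [one_mul, one_smul, zero_mul, neg_zero, Real.exp_zero, zero_smul] at h2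
  have h0 : expMul (0 : V) y = y := by simp [expMul, NormedSpace.exp_zero]
  rw [h0, Real.exp_neg, inv_mul_eq_iff_eq_mul₀ (Real.exp_pos _).ne'] at h2
  exact h2

theorem det_expMul_one (a : V) : det (expMul a (1 : V)) = Real.exp (inner ℝ a (1 : V)) := by
  rw [det_expMul_apply, det_one, mul_one]

theorem det_pos {x : V} (hx : x ∈ cone V) : 0 < det x := by
  obtain ⟨a, rfl⟩ := exists_expMul_one_eq hx
  rw [det_expMul_one]
  exact Real.exp_pos _

theorem inner_mul_self_nonneg_of_mem_closure {x : V} (hx : x ∈ closure (cone V)) (y : V) :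
    0 ≤ inner ℝ (x * y) y := by
  have hc : IsClosed {x : V | 0 ≤ inner ℝ (x * y) y} := by
    refine isClosed_le continuous_const ?_
    have : Continuous fun x : V => x * y := ((mulCLM V).flip y).continuous
    exact this.inner continuous_const
  exact closure_minimal (fun x hx => nonneg_of_mem_cone hx y) hc hx

/-- Spectral values in the closure are nonnegative; if none vanished, x would be the exponential of
its logarithm and so lie in the cone. -/
theorem det_eq_zero_of_mem_closure {x : V} (hx : x ∈ closure (cone V)) (hx' : x ∉ cone V) :
    det x = 0 := by
  have h := inner_mul_self_nonneg_of_mem_closure hx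
  obtain ⟨m, c, a, hc, -, -, rfl⟩ := exists_frame x
  have ha : ∀ i, 0 ≤ a i := by
    intro i
    have h1 := h (c i)
    rw [mul_comm, hc.mul_sum_smul, inner_smul_left] at h1
    have h2 := real_inner_self_pos.2 (hc.ne_zero i)
    exact nonneg_of_mul_nonneg_left (by simpa using h1) h2
  by_cases h0 : ∃ j, a j = 0
  · obtain ⟨j, hj⟩ := h0
    exact hc.det_eq_zero hj
  · push Not at h0
    refine absurd ?_ hx'
    have h1 : ∑ i, a i • c i = expMul (∑ i, Real.log (a i) • c i) 1 := by
      rw [hc.expMul_one]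
      simp only [Real.exp_log (lt_of_le_of_ne (ha _) (h0 _).symm)]
    rw [h1]
    exact expMul_one_mem_cone _

/-- The curve t ↦ exp(t L(a)) y cannot cross the boundary: det vanishes there, but not on the curve.
-/
theorem expMul_mem_cone (a : V) {y : V} (hy : y ∈ cone V) : expMul a y ∈ cone V := by
  have hcont : Continuous fun t : ℝ => expMul (t • a) y :=
    continuous_iff_continuousAt.2 fun t => (hasDerivAt_expMul_smul a y t).continuousAt
  have hpre : IsPreconnected (Set.range fun t : ℝ => expMul (t • a) y) := isPreconnected_range hcont
  have h0 : expMul ((0 : ℝ) • a) y = y := by simp [expMul, NormedSpace.exp_zero]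
  have hsub := hpre.subset_of_closure_inter_subset isOpen_cone
    ⟨y, ⟨0, h0⟩, hy⟩ (by
      rintro _ ⟨hz, t, rfl⟩
      by_contra hnot
      have h1 := det_eq_zero_of_mem_closure hz hnot
      simp only at h1
      rw [det_expMul_apply] at h1
      exact (mul_pos (Real.exp_pos _) (det_pos hy)).ne' h1)
  have := hsub ⟨1, rfl⟩
  simpa using this

theorem expMul_mem_cone_iff (a y : V) : expMul a y ∈ cone V ↔ y ∈ cone V := by
  refine ⟨fun h => ?_, expMul_mem_cone a⟩
  have := expMul_mem_cone (-a) h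
  rwa [expMul_apply_neg] at this

/-- In a simple algebra the trace of `L(x)` is proportional to the trace of `x`. -/
theorem trace_mulOp (x : V) : LinearMap.trace ℝ V (mulOp x) = ratio V * inner ℝ x (1 : V) := by
  set τ : V →L[ℝ] ℝ := LinearMap.toContinuousLinearMap (LinearMap.trace ℝ V ∘ₗ mulOpLinear V) with hτ
  set b : V := (InnerProductSpace.toDual ℝ V).symm τ with hb
  have hτb : ∀ x, LinearMap.trace ℝ V (mulOp x) = inner ℝ b x := by
    intro x
    rw [hb, InnerProductSpace.toDual_symm_apply]
    rfl
  -- With b representing the trace form, its associativity says that L(b) commutes with every L(w).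
  -- Eigenspaces of L(b) are therefore ideals, and simplicity makes b a scalar multiple of e.
  have hcomm : ∀ w x : V, b * (x * w) = w * (b * x) := by
    intro w x
    refine ext_inner_right ℝ fun y => ?_
    have h := trace_mulOp_mul_mul x w y
    rw [hτb, hτb, mul_comm (y * w), ← inner_jmul, ← inner_jmul, mul_comm y w, ← inner_jmul,
      mul_comm x b, mul_comm _ b] at h
    exact h
  have hs := isSymmetric_mulOp b
  obtain ⟨t, ht⟩ : ∃ t, Module.End.HasEigenvalue (mulOp b) t :=
    ⟨_, hs.hasEigenvalue_iSup_of_finiteDimensional⟩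
  have htop : Module.End.eigenspace (mulOp b) t = ⊤ := by
    refine (SimpleEuclideanJordanAlgebra.simple _ fun w x hx => ?_).resolve_left ht
    rw [Module.End.mem_eigenspace_iff, mulOp_apply] at hx ⊢
    rw [mul_comm w x, hcomm, hx, jmul_smul, mul_comm w]
  have hbt : b = t • (1 : V) := by
    have : (1 : V) ∈ Module.End.eigenspace (mulOp b) t := by rw [htop]; trivial
    rwa [Module.End.mem_eigenspace_iff, mulOp_apply, jmul_one] at this
  have ht' : t = ratio V := by
    have h := hτb 1
    rw [mulOp_one, LinearMap.trace_one, hbt, inner_smul_left, inner_one_one] at h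
    rw [ratio, h, conj_trivial, mul_div_assoc, div_self, mul_one]
    exact_mod_cast (rank_pos V).ne'
  rw [hτb, hbt, ht', inner_smul_left, conj_trivial, real_inner_comm]

theorem linearMap_det_expMul (a : V) :
    LinearMap.det (expMul a).toLinearMap = Real.exp (inner ℝ a (1 : V)) ^ ratio V := by
  rw [det_expMul, trace_mulOp, mul_comm, Real.exp_mul]

-- For r > 1 the right side is 1 + 2(n - r)/r while n/r = 1 + (n - r)/r. For r = 1 the formula for d
-- is a division by zero, so n = 1 is proved directly from the spectral theorem.
variable (V) in
theorem ratio_le : ratio V ≤ 1 + charNumber V * ((rank V : ℝ) - 1) := by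
  have hr := rank_pos V
  have hle := rank_le_finrank V
  have hr' : (0 : ℝ) < rank V := by exact_mod_cast hr
  rcases Nat.lt_or_ge 1 (rank V) with h1 | h1
  · have h1' : (0 : ℝ) < rank V - 1 := by
      have : (1 : ℝ) < rank V := by exact_mod_cast h1
      linarith
    have hle' : (rank V : ℝ) ≤ dim V := by exact_mod_cast hle
    rw [ratio, charNumber]
    have : 2 * ((dim V : ℝ) - rank V) / (rank V * (rank V - 1)) * (rank V - 1) =
        2 * ((dim V : ℝ) - rank V) / rank V := by
      field_simp
    rw [this, div_le_iff₀ hr', add_mul, div_mul_cancel₀ _ hr'.ne']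
    linarith
  · have h1 : rank V = 1 := by omega
    have hdim : dim V = 1 := by
      refine finrank_eq_one (1 : V) one_ne_zero' fun x => ?_
      obtain ⟨m, c, a, hc, ha, -, rfl⟩ := exists_frame x
      have hm : m ≤ 1 := by
        have := natDegree_minPoly_le_rank (∑ i, a i • c i)
        rw [hc.minPoly_eq ha, natDegree_prod_of_monic _ _ fun i _ => monic_X_sub_C _, h1] at this
        simpa using this
      have hm' : m = 1 := by
        refine le_antisymm hm (Nat.one_le_iff_ne_zero.2 ?_)
        rintro rfl
        exact one_ne_zero' (by simpa using hc.sum_eq.symm)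
      subst hm'
      refine ⟨a 0, ?_⟩
      rw [← hc.sum_eq]
      simp
    rw [ratio, hdim, h1]
    simp

end Invariance
end EuclideanJordan

namespace EuclideanJordan

/-! ### Separable functions and skeleton decompositions -/

section Separable

variable {α β : Type*}

/-- A function of two variables which is a finite sum of products of functions of one variable. -/
def IsSeparable (f : α → β → ℝ) : Prop :=
  ∃ (ι : Type) (_ : Fintype ι) (a : ι → α → ℝ) (b : ι → β → ℝ), ∀ x y, f x y = ∑ i, a i x * b i y

namespace IsSeparable

theorem of_left (a : α → ℝ) : IsSeparable fun x (_ : β) => a x :=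
  ⟨Unit, inferInstance, fun _ => a, fun _ _ => 1, by simp⟩

theorem of_right (b : β → ℝ) : IsSeparable fun (_ : α) y => b y :=
  ⟨Unit, inferInstance, fun _ _ => 1, fun _ => b, by simp⟩

theorem add {f g : α → β → ℝ} (hf : IsSeparable f) (hg : IsSeparable g) :
    IsSeparable fun x y => f x y + g x y := by
  obtain ⟨ι, _, a, b, h⟩ := hf
  obtain ⟨κ, _, c, d, h'⟩ := hg
  exact ⟨ι ⊕ κ, inferInstance, Sum.elim a c, Sum.elim b d, fun x y => by
    simp [Fintype.sum_sum_type, h, h']⟩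

theorem mul {f g : α → β → ℝ} (hf : IsSeparable f) (hg : IsSeparable g) :
    IsSeparable fun x y => f x y * g x y := by
  obtain ⟨ι, _, a, b, h⟩ := hf
  obtain ⟨κ, _, c, d, h'⟩ := hg
  refine ⟨ι × κ, inferInstance, fun i x => a i.1 x * c i.2 x, fun i y => b i.1 y * d i.2 y,
    fun x y => ?_⟩
  simp only [h, h']
  rw [Fintype.sum_mul_sum, Fintype.sum_prod_type]
  exact Finset.sum_congr rfl fun i _ => Finset.sum_congr rfl fun j _ => by ring

theorem sum {ι : Type*} (s : Finset ι) {f : ι → α → β → ℝ} (hf : ∀ i ∈ s, IsSeparable (f i)) :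
    IsSeparable fun x y => ∑ i ∈ s, f i x y := by
  classical
  induction s using Finset.induction_on with
  | empty => simpa using of_left (fun _ : α => (0 : ℝ))
  | insert i s hi ih =>
    simp only [Finset.sum_insert hi]
    exact (hf i (Finset.mem_insert_self _ _)).add (ih fun j hj => hf j (Finset.mem_insert_of_mem hj))

/-- Skeleton decomposition of a separable function. -/
theorem exists_skeleton {f : α → β → ℝ} (hf : IsSeparable f) :
    ∃ (N : ℕ) (ξ : Fin N → α) (η : Fin N → β) (m : Fin N → Fin N → ℝ),
      ∀ x y, f x y = ∑ i, ∑ j, m i j * (f x (η i) * f (ξ j) y) := by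
  classical
  obtain ⟨ι, _, a, b, h⟩ := hf
  -- Sizes of nonsingular matrices of values of f; they are bounded by the number of terms, so a
  -- maximal one exists.
  let P : ℕ → Prop := fun N => ∃ (ξ : Fin N → α) (η : Fin N → β),
    (Matrix.of fun i j => f (ξ i) (η j)).det ≠ 0
  have hP0 : P 0 := ⟨Fin.elim0, Fin.elim0, by simp⟩
  have hbound : ∀ N, P N → N ≤ Fintype.card ι := by
    rintro N ⟨ξ, η, hdet⟩
    have h1 : (Matrix.of fun i j => f (ξ i) (η j)) =
        (Matrix.of fun (i : Fin N) (k : ι) => a k (ξ i)) * Matrix.of fun (k : ι) j => b k (η j) := by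
      ext i j; simp [Matrix.mul_apply, h]
    have h2 := Matrix.rank_of_isUnit _ ((Matrix.isUnit_iff_isUnit_det _).2 hdet.isUnit)
    rw [Fintype.card_fin] at h2
    rw [← h2, h1]
    exact (Matrix.rank_mul_le_left _ _).trans (Matrix.rank_le_card_width _)
  set N := Nat.findGreatest P (Fintype.card ι) with hN
  obtain ⟨ξ, η, hdet⟩ : P N := Nat.findGreatest_spec (Nat.zero_le _) hP0
  set M : Matrix (Fin N) (Fin N) ℝ := Matrix.of fun i j => f (ξ i) (η j) with hM
  refine ⟨N, ξ, η, fun i j => M⁻¹ i j, fun x y => ?_⟩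
  let _ : Invertible M := M.invertibleOfIsUnitDet hdet.isUnit
  -- Bordering a maximal nonsingular matrix by x and y gives determinant zero, hence a zero Schur
  -- complement, which is the decomposition.
  have hS := Matrix.det_fromBlocks₁₁ M (Matrix.of fun i (_ : Fin 1) => f (ξ i) y)
    (Matrix.of fun (_ : Fin 1) j => f x (η j)) (Matrix.of fun _ _ => f x y)
  have hzero : (Matrix.fromBlocks M (Matrix.of fun i (_ : Fin 1) => f (ξ i) y)
      (Matrix.of fun (_ : Fin 1) j => f x (η j)) (Matrix.of fun _ _ => f x y)).det = 0 := by
    by_contra hne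
    have hP : P (N + 1) := by
      refine ⟨fun i => Sum.elim ξ (fun _ => x) (finSumFinEquiv.symm i),
        fun i => Sum.elim η (fun _ => y) (finSumFinEquiv.symm i), ?_⟩
      convert! hne using 1
      rw [← Matrix.det_submatrix_equiv_self finSumFinEquiv.symm]
      congr 1
      ext i j
      simp only [Matrix.of_apply, Matrix.submatrix_apply]
      rcases finSumFinEquiv.symm i with i | i <;> rcases finSumFinEquiv.symm j with j | j <;>
        simp [hM]
    have := Nat.le_findGreatest (hbound _ hP) hP
    omega
  rw [hzero] at hS
  have h3 := (mul_eq_zero.1 hS.symm).resolve_left hdet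
  rw [Matrix.det_fin_one, Matrix.sub_apply, sub_eq_zero, Matrix.invOf_eq_nonsing_inv] at h3
  rw [Matrix.of_apply] at h3
  rw [h3]
  simp only [Matrix.mul_apply, Matrix.of_apply, Finset.sum_mul]
  rw [Finset.sum_comm]
  exact Finset.sum_congr rfl fun i _ => Finset.sum_congr rfl fun j _ => by ring

end IsSeparable

variable {V : Type*} [NormedAddCommGroup V] [InnerProductSpace ℝ V] [FiniteDimensional ℝ V]
  [SimpleEuclideanJordanAlgebra V]

theorem isSeparable_inner_pow_sub (k : ℕ) (u : V) :
    IsSeparable fun x y : V => inner ℝ (polyVal (x - y) (X ^ k)) u := by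
  induction k generalizing u with
  | zero => simpa [polyVal_one] using IsSeparable.of_left fun _ : V => inner ℝ (1 : V) u
  | succ k ih =>
    have h : (fun x y : V => inner ℝ (polyVal (x - y) (X ^ (k + 1))) u) = fun x y : V =>
        ∑ i, (inner ℝ (stdOrthonormalBasis ℝ V i) (x * u) +
          -inner ℝ (stdOrthonormalBasis ℝ V i) (y * u)) *
            inner ℝ (polyVal (x - y) (X ^ k)) (stdOrthonormalBasis ℝ V i) := by
      funext x y
      rw [polyVal_X_pow_succ, inner_jmul, ← (stdOrthonormalBasis ℝ V).sum_inner_mul_inner]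
      refine Finset.sum_congr rfl fun i _ => ?_
      rw [sub_jmul, inner_sub_right, mul_comm]
      ring
    rw [h]
    exact IsSeparable.sum _ fun i _ => ((IsSeparable.of_left _).add (IsSeparable.of_right _)).mul (ih _)

theorem isSeparable_elemSymm_sub (k : ℕ) : IsSeparable fun x y : V => elemSymm (x - y) k := by
  induction k using Nat.strong_induction_on with
  | _ k ih =>
    match k with
    | 0 => simpa [elemSymm] using IsSeparable.of_left fun _ : V => (1 : ℝ)
    | k + 1 =>
      simp only [elemSymm]
      exact (IsSeparable.of_left _).mul ((IsSeparable.of_left _).mul (IsSeparable.sum _ fun i _ =>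
        ((IsSeparable.of_left _).mul (ih i i.2)).mul (isSeparable_inner_pow_sub _ _)))

-- Newton's recursion and the expansion of powers of x - y in an orthonormal basis preserve
-- separability. The skeleton of this function consists of translates of det in each variable, which
-- `exists_continuous_coeff` exploits.
variable (V) in
theorem isSeparable_det_sub : IsSeparable fun x y : V => det (x - y) := by
  simp only [det_eq_elemSymm]
  exact isSeparable_elemSymm_sub _

end Separable

/-! ### Iterated derivatives and constant coefficient operators -/

section IteratedDerivatives

theorem iteratedFDeriv_comp_equiv {E G F : Type*} [NormedAddCommGroup E] [NormedSpace ℝ E]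
    [NormedAddCommGroup G] [NormedSpace ℝ G] [NormedAddCommGroup F] [NormedSpace ℝ F]
    (g : G ≃L[ℝ] E) (f : E → F) (x : G) (n : ℕ) (m : Fin n → G) :
    iteratedFDeriv ℝ n (fun z => f (g z)) x m = iteratedFDeriv ℝ n f (g x) fun j => g (m j) := by
  have := g.iteratedFDerivWithin_comp_right f (s := Set.univ) uniqueDiffOn_univ (Set.mem_univ (g x)) n
  rw [Set.preimage_univ, iteratedFDerivWithin_univ, iteratedFDerivWithin_univ] at this
  exact congrArg (fun T => T m) this

theorem iteratedFDeriv_comp_affine {E G F : Type*} [NormedAddCommGroup E] [NormedSpace ℝ E]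
    [NormedAddCommGroup G] [NormedSpace ℝ G] [NormedAddCommGroup F] [NormedSpace ℝ F]
    (g : G →L[ℝ] E) (c : E) {f : E → F} {U : Set E} (hU : IsOpen U) {n : ℕ}
    (hf : ContDiffOn ℝ n f U) {x : G} (hx : g x + c ∈ U) (m : Fin n → G) :
    iteratedFDeriv ℝ n (fun z => f (g z + c)) x m =
      iteratedFDeriv ℝ n f (g x + c) fun j => g (m j) := by
  have hW : IsOpen ((fun y => y + c) ⁻¹' U) := hU.preimage (by fun_prop)
  have hW' : IsOpen (g ⁻¹' ((fun y => y + c) ⁻¹' U)) := hW.preimage g.continuous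
  have hf' : ContDiffOn ℝ n (fun y => f (y + c)) ((fun y => y + c) ⁻¹' U) :=
    hf.comp (contDiff_id.add contDiff_const).contDiffOn fun y hy => hy
  have h := g.iteratedFDerivWithin_comp_right hf' hW.uniqueDiffOn hW'.uniqueDiffOn (x := x) hx le_rfl
  rw [iteratedFDerivWithin_of_isOpen n hW' hx, iteratedFDerivWithin_of_isOpen n hW hx,
    iteratedFDeriv_comp_add_right'] at h
  exact congrArg (fun T => T m) h

/-- Contracting two multilinear forms against a matrix. -/
theorem sum_contract {E G : Type*} [NormedAddCommGroup E] [NormedSpace ℝ E]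
    [NormedAddCommGroup G] [NormedSpace ℝ G] {ι κ : Type*} [Fintype ι] [Fintype κ] {n : ℕ}
    (T : ContinuousMultilinearMap ℝ (fun _ : Fin n => G) ℝ)
    (S : ContinuousMultilinearMap ℝ (fun _ : Fin n => E) ℝ) (a : ι → κ → ℝ) (b : ι → G) (B : κ → E) :
    ∑ i : Fin n → ι, T (fun j => b (i j)) * S (fun j => ∑ l, a (i j) l • B l) =
      ∑ σ : Fin n → κ, T (fun j => ∑ l, a l (σ j) • b l) * S fun j => B (σ j) := by
  classical
  simp only [ContinuousMultilinearMap.map_sum, ContinuousMultilinearMap.map_smul_univ,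
    Finset.mul_sum, Finset.sum_mul, smul_eq_mul]
  rw [Finset.sum_comm]
  exact Finset.sum_congr rfl fun i _ => Finset.sum_congr rfl fun j _ => by ring

end IteratedDerivatives

section CoordinateOperator

variable {E : Type*} [NormedAddCommGroup E] [NormedSpace ℝ E] {κ : Type*} [Fintype κ] {n : ℕ}

/-- The homogeneous constant coefficient operator of order `n` with coefficients `A` in the
directions `B`. -/
noncomputable def coordOp (B : κ → E) (A : (Fin n → κ) → ℝ) (F : E → ℝ) (p : E) : ℝ :=
  ∑ σ : Fin n → κ, A σ * iteratedFDeriv ℝ n F p fun j => B (σ j)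

variable (B : κ → E) {U : Set E}

theorem contDiffOn_iteratedFDeriv_apply (hU : IsOpen U) {F : E → ℝ} (hF : ContDiffOn ℝ ω F U)
    (m : Fin n → E) : ContDiffOn ℝ ω (fun p => iteratedFDeriv ℝ n F p m) U := by
  intro p hp
  have h1 : ContDiffAt ℝ ω (iteratedFDeriv ℝ n F) p :=
    ((hF p hp).contDiffAt (hU.mem_nhds hp)).iteratedFDeriv_right le_top
  exact (((ContinuousMultilinearMap.apply ℝ (fun _ : Fin n => E) ℝ m).contDiff.contDiffAt).comp p
    h1).contDiffWithinAt

theorem contDiffOn_coordOp (hU : IsOpen U) (A : (Fin n → κ) → ℝ) {F : E → ℝ}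
    (hF : ContDiffOn ℝ ω F U) : ContDiffOn ℝ ω (coordOp B A F) U :=
  ContDiffOn.sum fun _ _ => contDiffOn_const.mul (contDiffOn_iteratedFDeriv_apply hU hF _)

theorem contDiffOn_iterate_coordOp (hU : IsOpen U) (A : (Fin n → κ) → ℝ) (k : ℕ) {F : E → ℝ}
    (hF : ContDiffOn ℝ ω F U) : ContDiffOn ℝ ω ((coordOp B A)^[k] F) U := by
  induction k with
  | zero => exact hF
  | succ k ih => rw [Function.iterate_succ_apply']; exact contDiffOn_coordOp B hU A ih

theorem eqOn_coordOp (hU : IsOpen U) (A : (Fin n → κ) → ℝ) {F G : E → ℝ} (h : Set.EqOn F G U) :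
    Set.EqOn (coordOp B A F) (coordOp B A G) U := by
  intro p hp
  have h1 : F =ᶠ[nhds p] G := Filter.eventuallyEq_of_mem (hU.mem_nhds hp) h
  simp only [coordOp, (h1.iteratedFDeriv (𝕜 := ℝ) n).eq_of_nhds]

theorem eqOn_iterate_coordOp (hU : IsOpen U) (A : (Fin n → κ) → ℝ) (k : ℕ) {F G : E → ℝ}
    (h : Set.EqOn F G U) : Set.EqOn ((coordOp B A)^[k] F) ((coordOp B A)^[k] G) U := by
  induction k with
  | zero => exact h
  | succ k ih => simp only [Function.iterate_succ_apply']; exact eqOn_coordOp B hU A ih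

theorem eqOn_coordOp_sum (hU : IsOpen U) (A : (Fin n → κ) → ℝ) {ι : Type*} (s : Finset ι)
    (c : ι → ℝ) {F : ι → E → ℝ} (hF : ∀ i ∈ s, ContDiffOn ℝ ω (F i) U) :
    Set.EqOn (coordOp B A fun p => ∑ i ∈ s, c i * F i p)
      (fun p => ∑ i ∈ s, c i * coordOp B A (F i) p) U := by
  intro p hp
  have h1 : ∀ i ∈ s, ContDiffAt ℝ n (F i) p := fun i hi =>
    ((hF i hi p hp).contDiffAt (hU.mem_nhds hp)).of_le le_top
  have h2 : iteratedFDeriv ℝ n (fun p => ∑ i ∈ s, c i * F i p) p =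
      ∑ i ∈ s, c i • iteratedFDeriv ℝ n (F i) p := by
    rw [iteratedFDeriv_fun_sum_apply fun i hi => contDiffAt_const.mul (h1 i hi)]
    exact Finset.sum_congr rfl fun i hi => iteratedFDeriv_const_smul_apply' (a := c i) (h1 i hi)
  simp only [coordOp, h2, sum_apply, smul_apply,
    Finset.mul_sum, smul_eq_mul]
  rw [Finset.sum_comm]
  exact Finset.sum_congr rfl fun i _ => Finset.sum_congr rfl fun j _ => by ring

theorem eqOn_iterate_coordOp_sum (hU : IsOpen U) (A : (Fin n → κ) → ℝ) (k : ℕ) {ι : Type*}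
    (s : Finset ι) (c : ι → ℝ) {F : ι → E → ℝ} (hF : ∀ i ∈ s, ContDiffOn ℝ ω (F i) U) :
    Set.EqOn ((coordOp B A)^[k] fun p => ∑ i ∈ s, c i * F i p)
      (fun p => ∑ i ∈ s, c i * (coordOp B A)^[k] (F i) p) U := by
  induction k with
  | zero => exact fun _ _ => rfl
  | succ k ih =>
    simp only [Function.iterate_succ_apply']
    exact (eqOn_coordOp B hU A ih).trans (eqOn_coordOp_sum B hU A s c fun i hi =>
      contDiffOn_iterate_coordOp B hU A k (hF i hi))

theorem iterate_coordOp_const_mul (hU : IsOpen U) (A : (Fin n → κ) → ℝ) (k : ℕ) (c : ℝ) {F : E → ℝ}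
    (hF : ContDiffOn ℝ ω F U) {p : E} (hp : p ∈ U) :
    (coordOp B A)^[k] (fun p => c * F p) p = c * (coordOp B A)^[k] F p := by
  have := eqOn_iterate_coordOp_sum B hU A k (Finset.univ : Finset Unit) (fun _ => c)
    (F := fun _ => F) (fun _ _ => hF) hp
  simpa using this

theorem iterate_coordOp_smul (hU : IsOpen U) (A : (Fin n → κ) → ℝ) (k : ℕ) (c : ℝ) {F : E → ℝ}
    (hF : ContDiffOn ℝ ω F U) {p : E} (hp : p ∈ U) :
    (coordOp B (c • A))^[k] F p = c ^ k * (coordOp B A)^[k] F p := by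
  induction k generalizing p with
  | zero => simp
  | succ k ih =>
    have h1 : ∀ G : E → ℝ, ∀ p, coordOp B (c • A) G p = c * coordOp B A G p := by
      intro G p
      simp [coordOp, Finset.mul_sum, mul_assoc]
    rw [Function.iterate_succ_apply', Function.iterate_succ_apply', h1,
      eqOn_coordOp B hU A (fun p hp => ih hp) hp]
    have := iterate_coordOp_const_mul B hU A 1 (c ^ k) (contDiffOn_iterate_coordOp B hU A k hF) hp
    simp only [Function.iterate_one] at this
    rw [this, pow_succ', mul_assoc]

/-- Peel off the innermost operator: by linearity the value is a combination, with weights A σ, of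
(k - 1)-fold iterates on derivatives of F. Continuity in the coefficients permits passing to
degenerate operators. -/
theorem continuous_iterate_coordOp (hU : IsOpen U) (k : ℕ) {F : E → ℝ} (hF : ContDiffOn ℝ ω F U)
    {p : E} (hp : p ∈ U) : Continuous fun A : (Fin n → κ) → ℝ => (coordOp B A)^[k] F p := by
  induction k generalizing F with
  | zero => exact continuous_const
  | succ k ih =>
    have h : ∀ A : (Fin n → κ) → ℝ, (coordOp B A)^[k + 1] F p = ∑ σ, A σ *
        (coordOp B A)^[k] (fun q => iteratedFDeriv ℝ n F q fun j => B (σ j)) p := fun A =>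
      eqOn_iterate_coordOp_sum B hU A k Finset.univ A
        (fun σ _ => contDiffOn_iteratedFDeriv_apply hU hF _) hp
    simp only [h]
    exact continuous_finsetSum _ fun σ _ => (continuous_apply σ).mul
      (ih (contDiffOn_iteratedFDeriv_apply hU hF _))

end CoordinateOperator
end EuclideanJordan

/-! ### Covariance and local boundedness of c -/

namespace EuclideanJordan

theorem inner_one_apply {V : Type*} [NormedAddCommGroup V] [InnerProductSpace ℝ V]
    (x y : V) : inner ℝ ((1 : V →L[ℝ] V) x) y = inner ℝ x ((1 : V →L[ℝ] V) y) :=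
  rfl

theorem inner_neg_one_apply {V : Type*} [NormedAddCommGroup V] [InnerProductSpace ℝ V]
    (x y : V) :
    inner ℝ ((-1 : V →L[ℝ] V) x) y = inner ℝ x ((-1 : V →L[ℝ] V) y) := by
  simp [inner_neg_left, inner_neg_right]

section PolarOperator

variable {V : Type*} [NormedAddCommGroup V] [InnerProductSpace ℝ V] [FiniteDimensional ℝ V]
  [SimpleEuclideanJordanAlgebra V]

/-- The operator `det (u ∂/∂x + w ∂/∂y)`. -/
noncomputable def polarOp (u w : V →L[ℝ] V) (F : V × V → ℝ) (p : V × V) : ℝ :=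
  ((rank V).factorial : ℝ)⁻¹ * ∑ i : Fin (rank V) → Fin (dim V),
    iteratedFDeriv ℝ (rank V) (det : V → ℝ) 0 (fun j => stdOrthonormalBasis ℝ V (i j)) *
    iteratedFDeriv ℝ (rank V) F p
      (fun j => (u (stdOrthonormalBasis ℝ V (i j)), w (stdOrthonormalBasis ℝ V (i j))))

theorem detDiff_eq_polarOp : (detDiff : (V × V → ℝ) → V × V → ℝ) = polarOp 1 (-1) := by
  funext F p
  simp [detDiff, polarOp]

variable (V) in
/-- The basis of `V × V` given by the two copies of the standard basis of `V`. -/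
noncomputable def pairBasis : Fin (dim V) ⊕ Fin (dim V) → V × V :=
  Sum.elim (fun i => (stdOrthonormalBasis ℝ V i, 0)) fun i => (0, stdOrthonormalBasis ℝ V i)

/-- The coefficients of `det (u ∂/∂x + w ∂/∂y)` in the basis `pairBasis`. -/
noncomputable def polarCoeff (u w : V →L[ℝ] V)
    (σ : Fin (rank V) → Fin (dim V) ⊕ Fin (dim V)) : ℝ :=
  ((rank V).factorial : ℝ)⁻¹ * iteratedFDeriv ℝ (rank V) (det : V → ℝ) 0 fun j =>
    u (pairBasis V (σ j)).1 + w (pairBasis V (σ j)).2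

/-- Expanding the directions in a fixed basis moves all dependence on u and w into the coefficients.
The transposes that appear are u and w themselves, by symmetry. -/
theorem polarOp_eq_coordOp {u w : V →L[ℝ] V} (hu : ∀ x y, inner ℝ (u x) y = inner ℝ x (u y))
    (hw : ∀ x y, inner ℝ (w x) y = inner ℝ x (w y)) :
    polarOp u w = coordOp (pairBasis V) (polarCoeff u w) := by
  funext F p
  set b := stdOrthonormalBasis ℝ V with hb
  set a : Fin (dim V) → Fin (dim V) ⊕ Fin (dim V) → ℝ := fun i =>
    Sum.elim (fun k => inner ℝ (b k) (u (b i))) fun k => inner ℝ (b k) (w (b i)) with ha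
  have h := sum_contract (iteratedFDeriv ℝ (rank V) (det : V → ℝ) 0)
    (iteratedFDeriv ℝ (rank V) F p) a b (pairBasis V)
  have h1 : ∀ i, ∑ l, a i l • pairBasis V l = (u (b i), w (b i)) := by
    intro i
    rw [Fintype.sum_sum_type]
    refine Prod.ext ?_ ?_
    · simp only [ha, pairBasis, Sum.elim_inl, Sum.elim_inr, Prod.fst_add, Prod.fst_sum,
        Prod.smul_fst, smul_zero, Finset.sum_const_zero, add_zero, ← hb]
      exact b.sum_repr' _
    · simp only [ha, pairBasis, Sum.elim_inl, Sum.elim_inr, Prod.snd_add, Prod.snd_sum,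
        Prod.smul_snd, smul_zero, Finset.sum_const_zero, zero_add, ← hb]
      exact b.sum_repr' _
  have h2 : ∀ l, ∑ i, a i l • b i = u (pairBasis V l).1 + w (pairBasis V l).2 := by
    rintro (k | k)
    · simp only [ha, pairBasis, Sum.elim_inl, map_zero, add_zero, ← hb]
      conv_rhs => rw [← b.sum_repr' (u (b k))]
      exact Finset.sum_congr rfl fun i _ => by rw [← hu, real_inner_comm]
    · simp only [ha, pairBasis, Sum.elim_inr, map_zero, zero_add, ← hb]
      conv_rhs => rw [← b.sum_repr' (w (b k))]
      exact Finset.sum_congr rfl fun i _ => by rw [← hw, real_inner_comm]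
  simp only [h1, h2] at h
  rw [polarOp, coordOp, ← hb, h, Finset.mul_sum]
  refine Finset.sum_congr rfl fun σ _ => ?_
  rw [polarCoeff, mul_assoc]

theorem polarOp_comp (u w : V →L[ℝ] V) (g₁ g₂ : V ≃L[ℝ] V) (F : V × V → ℝ) :
    polarOp u w (fun p => F (g₁ p.1, g₂ p.2)) = fun p =>
      polarOp ((g₁ : V →L[ℝ] V).comp u) ((g₂ : V →L[ℝ] V).comp w) F (g₁ p.1, g₂ p.2) := by
  funext p
  have h := fun m => iteratedFDeriv_comp_equiv (g₁.prodCongr g₂) F p (rank V) m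
  simp only [ContinuousLinearEquiv.prodCongr_apply] at h
  simp only [polarOp, h]
  rfl

theorem iterate_polarOp_comp (u w : V →L[ℝ] V) (g₁ g₂ : V ≃L[ℝ] V) (F : V × V → ℝ) (k : ℕ) :
    (polarOp u w)^[k] (fun p => F (g₁ p.1, g₂ p.2)) = fun p =>
      (polarOp ((g₁ : V →L[ℝ] V).comp u) ((g₂ : V →L[ℝ] V).comp w))^[k] F (g₁ p.1, g₂ p.2) := by
  induction k with
  | zero => rfl
  | succ k ih =>
    simp only [Function.iterate_succ_apply', ih]
    rw [polarOp_comp]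

/-- The function `(det x)^a (det y)^c`. -/
noncomputable def powFun (a c : ℝ) (p : V × V) : ℝ := det p.1 ^ a * det p.2 ^ c

theorem isOpen_cone_prod : IsOpen (cone V ×ˢ cone V) := isOpen_cone.prod isOpen_cone

theorem contDiffOn_powFun (a c : ℝ) {n : WithTop ℕ∞} :
    ContDiffOn ℝ n (powFun (V := V) a c) (cone V ×ˢ cone V) := by
  intro p hp
  have h1 : ContDiffAt ℝ n (fun p : V × V => det p.1) p := (contDiff_det.comp contDiff_fst).contDiffAt
  have h2 : ContDiffAt ℝ n (fun p : V × V => det p.2) p := (contDiff_det.comp contDiff_snd).contDiffAt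
  exact ((h1.rpow contDiffAt_const (det_pos hp.1).ne').mul
    (h2.rpow contDiffAt_const (det_pos hp.2).ne')).contDiffWithinAt

/-- The character `exp tr a` by which `exp L(a)` acts on the determinant. -/
noncomputable def expTr (a : V) : ℝ := Real.exp (inner ℝ a (1 : V))

theorem expTr_pos (a : V) : 0 < expTr a := Real.exp_pos _

theorem expTr_neg (a : V) : expTr (-a) = (expTr a)⁻¹ := by
  rw [expTr, inner_neg_left, Real.exp_neg, expTr]

theorem det_expMul' (a y : V) : det (expMul a y) = expTr a * det y := det_expMul_apply a y

theorem powFun_expMul (a c : ℝ) (a₁ a₂ : V) {p : V × V} (hp : p ∈ cone V ×ˢ cone V) :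
    powFun a c (expMul a₁ p.1, expMul a₂ p.2) = (expTr a₁ ^ a * expTr a₂ ^ c) * powFun a c p := by
  simp only [powFun, det_expMul']
  rw [Real.mul_rpow (expTr_pos _).le (det_pos hp.1).le,
    Real.mul_rpow (expTr_pos _).le (det_pos hp.2).le]
  ring

theorem one_mem_cone_prod : ((1 : V), (1 : V)) ∈ cone V ×ˢ cone V := ⟨one_mem_cone, one_mem_cone⟩

/-- Transformation of `det (u ∂/∂x + w ∂/∂y)^k ((det x)^a (det y)^c)` under `exp L(a₁) × exp L(a₂)`. -/
theorem iterate_polarOp_powFun_expMul {u w u' w' : V →L[ℝ] V}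
    (hu : ∀ x y, inner ℝ (u x) y = inner ℝ x (u y)) (hw : ∀ x y, inner ℝ (w x) y = inner ℝ x (w y))
    (a c : ℝ) (k : ℕ) (a₁ a₂ : V) (hu' : ∀ x, expMul a₁ (u x) = u' x)
    (hw' : ∀ x, expMul a₂ (w x) = w' x) {p : V × V} (hp : p ∈ cone V ×ˢ cone V) :
    (polarOp u' w')^[k] (powFun a c) (expMul a₁ p.1, expMul a₂ p.2) =
      (expTr a₁ ^ a * expTr a₂ ^ c) *
        (coordOp (pairBasis V) (polarCoeff u w))^[k] (powFun a c) p := by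
  have h := congrFun (iterate_polarOp_comp u w (expMulEquiv a₁) (expMulEquiv a₂) (powFun a c) k) p
  have h1 : ((expMulEquiv a₁ : V ≃L[ℝ] V) : V →L[ℝ] V).comp u = u' :=
    ContinuousLinearMap.ext hu'
  have h2 : ((expMulEquiv a₂ : V ≃L[ℝ] V) : V →L[ℝ] V).comp w = w' :=
    ContinuousLinearMap.ext hw'
  rw [h1, h2] at h
  simp only [expMulEquiv_apply] at h
  rw [← h, polarOp_eq_coordOp hu hw, ← iterate_coordOp_const_mul (pairBasis V) isOpen_cone_prod _ _ _
    (contDiffOn_powFun a c) hp]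
  exact eqOn_iterate_coordOp (pairBasis V) isOpen_cone_prod _ _
    (fun q hq => powFun_expMul a c a₁ a₂ hq) hp

theorem iteratedFDeriv_det_expMul (a : V) (m : Fin (rank V) → V) :
    iteratedFDeriv ℝ (rank V) (det : V → ℝ) 0 (fun j => expMul a (m j)) =
      expTr a * iteratedFDeriv ℝ (rank V) (det : V → ℝ) 0 m := by
  have h := iteratedFDeriv_comp_equiv (expMulEquiv a) (det : V → ℝ) 0 (rank V) m
  rw [map_zero] at h
  simp only [expMulEquiv_apply, det_expMul'] at h
  rw [← h]
  have := iteratedFDeriv_const_smul_apply' (i := rank V) (a := expTr a) (f := (det : V → ℝ)) (x := 0)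
    contDiff_det.contDiffAt
  simp only [smul_eq_mul] at this
  rw [this]
  rfl

theorem polarCoeff_expMul_comp {u w u' w' : V →L[ℝ] V} (a : V) (hu : ∀ x, u' x = expMul a (u x))
    (hw : ∀ x, w' x = expMul a (w x)) : polarCoeff u' w' = expTr a • polarCoeff u w := by
  funext σ
  simp only [polarCoeff, Pi.smul_apply, smul_eq_mul, hu, hw, ← map_add]
  rw [iteratedFDeriv_det_expMul]
  ring

theorem inner_neg_expMul (a x y : V) :
    inner ℝ ((-expMul a) x) y = inner ℝ x ((-expMul a) y) := by
  simp [inner_neg_left, inner_neg_right, inner_expMul]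

theorem cPoly_eq (s t : ℝ) (k : ℕ) (x y : V) : cPoly s t k x y =
    det x ^ (-s) * det y ^ (-t) * (polarOp 1 (-1))^[k] (powFun (s + k) (t + k)) (x, y) := by
  rw [cPoly, detDiff_eq_polarOp]
  rfl

theorem polarOp_one_neg_one : polarOp (1 : V →L[ℝ] V) (-1) =
    coordOp (pairBasis V) (polarCoeff (1 : V →L[ℝ] V) (-1)) :=
  polarOp_eq_coordOp inner_one_apply inner_neg_one_apply

/-- Covariance of `c_{s,t}^{(k)}`. -/
theorem cPoly_expMul (s t : ℝ) (k : ℕ) (a : V) {x y : V} (hx : x ∈ cone V) (hy : y ∈ cone V) :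
    cPoly s t k (expMul a x) (expMul a y) = expTr a ^ k * cPoly s t k x y := by
  have hχ := expTr_pos a
  have hp : (x, y) ∈ cone V ×ˢ cone V := ⟨hx, hy⟩
  have h := iterate_polarOp_powFun_expMul (u := expMul (-a)) (w := -expMul (-a)) (u' := 1) (w' := -1)
    (inner_expMul _) (inner_neg_expMul _) (s + k) (t + k) k a a
    (fun x => by simp [expMul_neg_apply]) (fun x => by simp [expMul_neg_apply]) hp
  -- Pulled back by g, the symbol becomes det(g⁻¹(ξ - ζ)) = χ⁻¹ det(ξ - ζ). The k operators give
  -- χ^(-k), the powers give χ^(s+t+2k) and the prefactors χ^(-s-t): χ^k in total.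
  have hc : polarCoeff (expMul (-a)) (-expMul (-a)) = (expTr a)⁻¹ • polarCoeff (1 : V →L[ℝ] V) (-1) := by
    rw [← expTr_neg]
    exact polarCoeff_expMul_comp (-a) (fun x => rfl) (fun x => by simp)
  rw [hc, iterate_coordOp_smul (pairBasis V) isOpen_cone_prod _ _ _ (contDiffOn_powFun _ _) hp,
    ← polarOp_one_neg_one] at h
  rw [cPoly_eq, cPoly_eq, h, det_expMul', det_expMul', Real.mul_rpow hχ.le (det_pos hx).le,
    Real.mul_rpow hχ.le (det_pos hy).le, Real.rpow_add hχ, Real.rpow_add hχ, Real.rpow_natCast,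
    Real.rpow_neg hχ.le, Real.rpow_neg hχ.le, inv_pow]
  have h3 : expTr a ^ k ≠ 0 := pow_ne_zero _ hχ.ne'
  have h1 : expTr a ^ s ≠ 0 := (Real.rpow_pos_of_pos hχ _).ne'
  have h2 : expTr a ^ t ≠ 0 := (Real.rpow_pos_of_pos hχ _).ne'
  field_simp

variable (V) in
/-- The coefficients of `det (g₁⁻¹ ∂/∂x - g₂⁻¹ ∂/∂y)`, multiplied by the characters of `g₁` and `g₂`,
extend continuously to all operators `g₁`, `g₂`. -/
theorem exists_continuous_coeff :
    ∃ A : (V →L[ℝ] V) × (V →L[ℝ] V) → (Fin (rank V) → Fin (dim V) ⊕ Fin (dim V)) → ℝ,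
      Continuous A ∧ ∀ a₁ a₂ : V, A (expMul a₁, expMul a₂) =
        (expTr a₁ * expTr a₂) • polarCoeff (expMul (-a₁)) (-expMul (-a₂)) := by
  -- After the skeleton decomposition each variable occurs alone, and χ₁ det(g₁⁻¹x - η) = det(x - g₁
  -- η), likewise for g₂. Inverses and characters disappear, leaving `Ψ`, which is smooth in all
  -- operators.
  obtain ⟨N, ξ, η, m, hm⟩ := (isSeparable_det_sub V).exists_skeleton
  set Ψ : ((V →L[ℝ] V) × (V →L[ℝ] V)) × (V × V) → ℝ := fun q =>
    ∑ i, ∑ j, m i j * (det (q.2.1 - q.1.1 (η i)) * det (q.1.2 (ξ j) - q.2.2)) with hΨ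
  have hsm : ContDiff ℝ ω Ψ := by
    refine ContDiff.sum fun i _ => ContDiff.sum fun j _ => contDiff_const.mul (ContDiff.mul ?_ ?_)
    · exact contDiff_det.comp (by fun_prop)
    · exact contDiff_det.comp (by fun_prop)
  refine ⟨fun q σ => ((rank V).factorial : ℝ)⁻¹ * iteratedFDeriv ℝ (rank V) Ψ (q, 0)
    fun j => (0, pairBasis V (σ j)), ?_, ?_⟩
  · refine continuous_pi fun σ => continuous_const.mul ?_
    have h1 : Continuous (iteratedFDeriv ℝ (rank V) Ψ) := hsm.continuous_iteratedFDeriv le_top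
    have h2 : Continuous fun q : (V →L[ℝ] V) × (V →L[ℝ] V) =>
        iteratedFDeriv ℝ (rank V) Ψ (q, 0) := h1.comp (by fun_prop)
    exact (ContinuousMultilinearMap.apply ℝ (fun _ : Fin (rank V) =>
      ((V →L[ℝ] V) × (V →L[ℝ] V)) × (V × V)) ℝ fun j => (0, pairBasis V (σ j))).continuous.comp h2
  · intro a₁ a₂
    funext σ
    set M : V × V →L[ℝ] V := (expMul (-a₁)).comp (ContinuousLinearMap.fst ℝ V V) -
      (expMul (-a₂)).comp (ContinuousLinearMap.snd ℝ V V) with hM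
    have h1 : ∀ z : V × V, Ψ ((expMul a₁, expMul a₂), z) = (expTr a₁ * expTr a₂) * det (M z) := by
      intro z
      have e1 : ∀ i, det (z.1 - expMul a₁ (η i)) = expTr a₁ * det (expMul (-a₁) z.1 - η i) := by
        intro i
        rw [← det_expMul', map_sub, expMul_neg_apply]
      have e2 : ∀ j, det (expMul a₂ (ξ j) - z.2) = expTr a₂ * det (ξ j - expMul (-a₂) z.2) := by
        intro j
        rw [← det_expMul', map_sub, expMul_neg_apply]
      have e3 : M z = expMul (-a₁) z.1 - expMul (-a₂) z.2 := rfl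
      rw [e3, hm, Finset.mul_sum]
      simp only [hΨ, e1, e2, Finset.mul_sum]
      exact Finset.sum_congr rfl fun i _ => Finset.sum_congr rfl fun j _ => by ring
    have h2 := iteratedFDeriv_comp_affine (n := rank V)
      (ContinuousLinearMap.inr ℝ ((V →L[ℝ] V) × (V →L[ℝ] V)) (V × V))
      ((expMul a₁, expMul a₂), (0 : V × V)) isOpen_univ (hsm.of_le le_top).contDiffOn
      (x := (0 : V × V)) (Set.mem_univ _) (fun j => pairBasis V (σ j))
    simp only [ContinuousLinearMap.inr_apply, Prod.mk_add_mk, zero_add, add_zero] at h2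
    have h3 := iteratedFDeriv_comp_affine (n := rank V) M (0 : V) isOpen_univ
      (f := (det : V → ℝ)) contDiff_det.contDiffOn
      (x := (0 : V × V)) (Set.mem_univ _) (fun j => pairBasis V (σ j))
    simp only [add_zero, map_zero] at h3
    simp only [h1] at h2
    have h4 := iteratedFDeriv_const_smul_apply' (i := rank V) (a := expTr a₁ * expTr a₂)
      (f := fun z => det (M z)) (x := (0 : V × V)) (contDiff_det.comp M.contDiff).contDiffAt
    simp only [smul_eq_mul] at h4
    rw [h4, smul_apply, h3] at h2
    simp only [← h2, Pi.smul_apply, smul_eq_mul, polarCoeff]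
    have h5 : ∀ z : V × V, M z = expMul (-a₁) z.1 + (-expMul (-a₂)) z.2 := by
      intro z; simp [hM, sub_eq_add_neg]
    simp only [h5]
    ring

/-- If ‖v‖ = ρ then e ± v lie in the cone, hence so do g e ± g v, and ‖g v‖ ≤ ‖g e‖. -/
theorem norm_expMul_le : ∃ C : ℝ, ∀ a : V, ‖expMul a‖ ≤ C * ‖expMul a (1 : V)‖ := by
  obtain ⟨ρ, hρ, h⟩ := exists_ball_subset_cone V
  refine ⟨ρ⁻¹, fun a => ?_⟩
  refine ContinuousLinearMap.opNorm_le_bound _ (by positivity) fun u => ?_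
  rcases eq_or_ne u 0 with rfl | hu
  · simp
  have hn : 0 < ‖u‖ := norm_pos_iff.2 hu
  set v := (ρ / ‖u‖) • u with hv
  have hvn : ‖v‖ = ρ := by
    rw [hv, norm_smul, Real.norm_of_nonneg (by positivity), div_mul_cancel₀ _ hn.ne']
  have h1 := expMul_mem_cone a (h v hvn.le)
  have h2 := expMul_mem_cone a (h (-v) (by rw [norm_neg, hvn]))
  rw [map_add] at h1 h2
  rw [map_neg, ← sub_eq_add_neg] at h2
  have h3 := norm_le_of_mem_cone h2 h1
  rw [hv, map_smul, norm_smul, Real.norm_of_nonneg (by positivity)] at h3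
  rw [div_mul_eq_mul_div, div_le_iff₀ hn] at h3
  rw [inv_mul_eq_div, div_mul_eq_mul_div, le_div_iff₀ hρ, mul_comm]
  exact h3

/-- Transport to (e, e): the powers χ₁^s and χ₂^t cancel, and the remaining (χ₁ χ₂)^k is absorbed
into the coefficients, which then extend continuously to all operators. The function `H` is thus
continuous even where det would degenerate. -/
theorem exists_cPoly_eq_of_coeff (s t : ℝ) (k : ℕ) :
    ∃ H : (V →L[ℝ] V) × (V →L[ℝ] V) → ℝ, Continuous H ∧ ∀ a₁ a₂ : V,
      cPoly s t k (expMul a₁ (1 : V)) (expMul a₂ 1) = H (expMul a₁, expMul a₂) := by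
  obtain ⟨A, hA, hA'⟩ := exists_continuous_coeff V
  refine ⟨fun q => (coordOp (pairBasis V) (A q))^[k] (powFun (s + k) (t + k)) (1, 1),
    (continuous_iterate_coordOp (pairBasis V) isOpen_cone_prod k (contDiffOn_powFun _ _)
      one_mem_cone_prod).comp hA, fun a₁ a₂ => ?_⟩
  have h := iterate_polarOp_powFun_expMul (u := expMul (-a₁)) (w := -expMul (-a₂)) (u' := 1)
    (w' := -1) (inner_expMul _) (inner_neg_expMul _) (s + k) (t + k) k a₁ a₂
    (fun x => by simp [expMul_neg_apply]) (fun x => by simp [expMul_neg_apply])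
    (one_mem_cone_prod (V := V))
  have h1 := expTr_pos a₁
  have h2 := expTr_pos a₂
  simp only at h
  change _ = (coordOp (pairBasis V) (A (expMul a₁, expMul a₂)))^[k] (powFun (s + k) (t + k)) (1, 1)
  rw [hA', iterate_coordOp_smul (pairBasis V) isOpen_cone_prod _ _ _ (contDiffOn_powFun _ _)
    one_mem_cone_prod, cPoly_eq, h, det_expMul', det_expMul', det_one, mul_one, mul_one,
    Real.rpow_add h1, Real.rpow_add h2, Real.rpow_natCast, Real.rpow_natCast,
    Real.rpow_neg h1.le, Real.rpow_neg h2.le, mul_pow]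
  have h3 : expTr a₁ ^ s ≠ 0 := (Real.rpow_pos_of_pos h1 _).ne'
  have h4 : expTr a₂ ^ t ≠ 0 := (Real.rpow_pos_of_pos h2 _).ne'
  field_simp

/-- The function `c_{s,t}^{(k)}` is bounded on bounded subsets of `Ω × Ω`. -/
theorem exists_cPoly_le (s t : ℝ) (k : ℕ) (R : ℝ) : ∃ C : ℝ, ∀ x ∈ cone V, ∀ y ∈ cone V,
    ‖x‖ ≤ R → ‖y‖ ≤ R → |cPoly s t k x y| ≤ C := by
  obtain ⟨H, hH, hH'⟩ := exists_cPoly_eq_of_coeff (V := V) s t k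
  obtain ⟨C, hC⟩ := norm_expMul_le (V := V)
  obtain ⟨B, hB⟩ := (isCompact_closedBall (0 : (V →L[ℝ] V) × (V →L[ℝ] V)) (|C| * R)).exists_bound_of_continuousOn
    hH.continuousOn
  refine ⟨B, fun x hx y hy hxR hyR => ?_⟩
  obtain ⟨a₁, rfl⟩ := exists_expMul_one_eq hx
  obtain ⟨a₂, rfl⟩ := exists_expMul_one_eq hy
  rw [hH', ← Real.norm_eq_abs]
  refine hB _ ?_
  have hle : ∀ a : V, ‖expMul a (1 : V)‖ ≤ R → ‖expMul a‖ ≤ |C| * R := fun a ha =>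
    calc ‖expMul a‖ ≤ C * ‖expMul a (1 : V)‖ := hC a
      _ ≤ |C| * ‖expMul a (1 : V)‖ := by gcongr; exact le_abs_self C
      _ ≤ |C| * R := by gcongr
  rw [mem_closedBall_zero_iff, Prod.norm_def]
  exact max_le (hle _ hxR) (hle _ hyR)

theorem continuousOn_cPoly (s t : ℝ) (k : ℕ) :
    ContinuousOn (fun p : V × V => cPoly s t k p.1 p.2) (cone V ×ˢ cone V) := by
  have h1 : (fun p : V × V => cPoly s t k p.1 p.2) = fun p => powFun (-s) (-t) p *
      (coordOp (pairBasis V) (polarCoeff (1 : V →L[ℝ] V) (-1)))^[k] (powFun (s + k) (t + k)) p := by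
    funext p
    rw [cPoly_eq, polarOp_one_neg_one]
    rfl
  rw [h1]
  exact (contDiffOn_powFun (n := ω) _ _).continuousOn.mul
    (contDiffOn_iterate_coordOp (pairBasis V) isOpen_cone_prod _ k
      (contDiffOn_powFun (n := ω) _ _)).continuousOn

end PolarOperator
end EuclideanJordan

namespace EuclideanJordan

/-! ### Integration by parts against e^(-tr x) -/

section Growth

theorem hasTemperateGrowth_fderiv_apply {E : Type*} [NormedAddCommGroup E] [NormedSpace ℝ E]
    {q : E → ℝ} (hq : q.HasTemperateGrowth) (v : E) :
    (fun x => fderiv ℝ q x v).HasTemperateGrowth := by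
  have h : (fderiv ℝ q).HasTemperateGrowth := by
    refine ⟨hq.1.fderiv_right (by simp), fun n => ?_⟩
    obtain ⟨k, C, h⟩ := hq.2 (n + 1)
    refine ⟨k, C, fun x => ?_⟩
    rw [norm_iteratedFDeriv_fderiv]
    exact h x
  exact (ContinuousLinearMap.hasTemperateGrowth (ContinuousLinearMap.apply ℝ ℝ v)).comp h

theorem exists_abs_le_one_add_norm_pow {E : Type*} [NormedAddCommGroup E] [NormedSpace ℝ E]
    {q : E → ℝ} (hq : q.HasTemperateGrowth) :
    ∃ (k : ℕ) (C : ℝ), 0 ≤ C ∧ ∀ x, |q x| ≤ C * (1 + ‖x‖) ^ k := by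
  obtain ⟨k, C, h⟩ := hq.2 0
  refine ⟨k, C, ?_, fun x => ?_⟩
  · have := (norm_nonneg _).trans (h 0)
    simpa using this
  · simpa using h x

variable {V : Type*} [NormedAddCommGroup V] [InnerProductSpace ℝ V] [FiniteDimensional ℝ V]
  [SimpleEuclideanJordanAlgebra V]

/-- Euler's formula for the determinant, a homogeneous function of degree `r`. -/
theorem iteratedFDeriv_det_self (x : V) :
    iteratedFDeriv ℝ (rank V) (det : V → ℝ) 0 (fun _ => x) = (rank V).factorial * det x := by
  have h := iteratedFDeriv_comp_affine (n := rank V)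
    ((1 : ℝ →L[ℝ] ℝ).smulRight x) (0 : V) isOpen_univ
    (f := (det : V → ℝ)) contDiff_det.contDiffOn (x := (0 : ℝ)) (Set.mem_univ _) (fun _ => 1)
  simp only [ContinuousLinearMap.smulRight_apply, one_apply_eq_self, add_zero, one_smul,
    zero_smul, det_smul] at h
  rw [← h, ← iteratedDeriv_eq_iteratedFDeriv]
  have h2 : (fun z : ℝ => z ^ rank V * det x) = fun z => det x * z ^ rank V := by
    funext z; ring
  rw [h2, iteratedDeriv_const_mul_field]
  rw [iteratedDeriv_pow]
  simp [Nat.descFactorial_self, mul_comm]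

theorem det_eq_sum (x : V) : det x = ((rank V).factorial : ℝ)⁻¹ *
    ∑ i : Fin (rank V) → Fin (dim V),
      iteratedFDeriv ℝ (rank V) (det : V → ℝ) 0 (fun j => stdOrthonormalBasis ℝ V (i j)) *
        ∏ j, inner ℝ (stdOrthonormalBasis ℝ V (i j)) x := by
  have h := iteratedFDeriv_det_self x
  have h1 : ∀ T : ContinuousMultilinearMap ℝ (fun _ : Fin (rank V) => V) ℝ, T (fun _ => x) =
      ∑ i : Fin (rank V) → Fin (dim V), T (fun j => stdOrthonormalBasis ℝ V (i j)) *
        ∏ j, inner ℝ (stdOrthonormalBasis ℝ V (i j)) x := by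
    classical
    intro T
    conv_lhs => rw [← (stdOrthonormalBasis ℝ V).sum_repr' x]
    rw [ContinuousMultilinearMap.map_sum]
    exact Finset.sum_congr rfl fun i _ => by
      rw [ContinuousMultilinearMap.map_smul_univ, smul_eq_mul, mul_comm]
  rw [← h1, h, inv_mul_cancel_left₀ (Nat.cast_ne_zero.2 (Nat.factorial_ne_zero _))]

theorem hasTemperateGrowth_det : (det : V → ℝ).HasTemperateGrowth := by
  have h1 : ∀ (ι : Type) (s : Finset ι) (f : ι → V → ℝ), (∀ i, (f i).HasTemperateGrowth) →
      (fun x => ∏ i ∈ s, f i x).HasTemperateGrowth := by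
    classical
    intro ι s f hf
    induction s using Finset.induction_on with
    | empty => simpa only [Finset.prod_empty] using Function.HasTemperateGrowth.const (1 : ℝ)
    | insert i s hi ih =>
      simp only [Finset.prod_insert hi]
      exact (hf i).mul ih
  have h2 : (det : V → ℝ) = fun x => ((rank V).factorial : ℝ)⁻¹ *
      ∑ i : Fin (rank V) → Fin (dim V),
        iteratedFDeriv ℝ (rank V) (det : V → ℝ) 0 (fun j => stdOrthonormalBasis ℝ V (i j)) *
          ∏ j, inner ℝ (stdOrthonormalBasis ℝ V (i j)) x := funext det_eq_sum
  rw [h2]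
  refine (Function.HasTemperateGrowth.const _).mul (Function.HasTemperateGrowth.sum fun i _ => ?_)
  exact (Function.HasTemperateGrowth.const _).mul (h1 _ _ _ fun j =>
    Function.hasTemperateGrowth_inner_right _)

variable (V) in
theorem exists_det_le : ∃ (k : ℕ) (C : ℝ), 0 ≤ C ∧ ∀ x : V, |det x| ≤ C * (1 + ‖x‖) ^ k :=
  exists_abs_le_one_add_norm_pow hasTemperateGrowth_det

theorem continuousOn_det_rpow (s : ℝ) : ContinuousOn (fun x : V => det x ^ s) (cone V) :=
  fun _ hx => (continuous_det.continuousAt.rpow_const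
    (Or.inl (det_pos hx).ne')).continuousWithinAt

/-- The derivative of `(det x)^s q(x)` in the direction `v` is `(det x)^(s - 1)` times this
function. -/
noncomputable def shiftFun (s : ℝ) (v : V) (q : V → ℝ) (x : V) : ℝ :=
  s * fderiv ℝ det x v * q x + det x * fderiv ℝ q x v

theorem hasTemperateGrowth_shiftFun (s : ℝ) (v : V) {q : V → ℝ} (hq : q.HasTemperateGrowth) :
    (shiftFun s v q).HasTemperateGrowth :=
  (((Function.HasTemperateGrowth.const s).mul
    (hasTemperateGrowth_fderiv_apply hasTemperateGrowth_det v)).mul hq).add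
    (hasTemperateGrowth_det.mul (hasTemperateGrowth_fderiv_apply hq v))

theorem fderiv_det_rpow_mul (s : ℝ) (v : V) {q : V → ℝ} (hq : Differentiable ℝ q) {x : V}
    (hx : x ∈ cone V) : DifferentiableAt ℝ (fun x => det x ^ s * q x) x ∧
      fderiv ℝ (fun x => det x ^ s * q x) x v = det x ^ (s - 1) * shiftFun s v q x := by
  have hd : HasFDerivAt det (fderiv ℝ det x) x :=
    ((contDiff_det (n := 1)).differentiable one_ne_zero x).hasFDerivAt
  have h1 := (hd.rpow_const (p := s) (Or.inl (det_pos hx).ne')).mul (hq x).hasFDerivAt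
  refine ⟨h1.differentiableAt, ?_⟩
  change fderiv ℝ ((fun x => det x ^ s) * q) x v = _
  rw [h1.fderiv]
  have h2 : det x ^ s = det x ^ (s - 1) * det x := by
    rw [Real.rpow_sub_one (det_pos hx).ne', div_mul_cancel₀ _ (det_pos hx).ne']
  simp only [add_apply, smul_apply, smul_eq_mul, shiftFun, h2]
  ring

/-- The function `e^{-tr x} (det x)^s q(x)` on `Ω`, extended by zero. -/
noncomputable def gammaFun (s : ℝ) (q : V → ℝ) : V → ℝ :=
  (cone V).indicator fun x => Real.exp (-inner ℝ x (1 : V)) * (det x ^ s * q x)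

/-- At a boundary point det y = O(‖y - x‖), so (det y)^s = o(‖y - x‖) for s > 1. The extension by
zero is therefore differentiable everywhere and integration by parts has no boundary term. -/
theorem hasFDerivAt_gammaFun_of_notMem {s : ℝ} (hs : 1 < s) {q : V → ℝ} (hq : Continuous q) {x : V}
    (hx : x ∉ cone V) : HasFDerivAt (gammaFun s q) (0 : V →L[ℝ] ℝ) x := by
  by_cases hc : x ∈ closure (cone V)
  · have h0 := det_eq_zero_of_mem_closure hc hx
    have hd : DifferentiableAt ℝ (det : V → ℝ) x :=
      (contDiff_det (n := 1)).differentiable one_ne_zero x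
    have hO := hd.isBigO_sub
    simp only [h0, sub_zero] at hO
    have hO' := hO.norm_norm.rpow (zero_le_one.trans hs.le) (Filter.Eventually.of_forall fun y =>
      norm_nonneg (y - x))
    have hlim : Filter.Tendsto (fun y => ‖y - x‖ ^ (s - 1)) (nhds x) (nhds 0) := by
      have h1 : Continuous fun y : V => ‖y - x‖ ^ (s - 1) :=
        (continuous_id.sub continuous_const).norm.rpow_const fun _ => Or.inr (by linarith)
      have h2 := h1.tendsto x
      simp only [sub_self, norm_zero] at h2
      rwa [Real.zero_rpow (by linarith)] at h2
    have ho : (fun y => ‖y - x‖ ^ s) =o[nhds x] fun y => y - x := by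
      have h1 := (Asymptotics.isLittleO_one_iff ℝ).2 hlim
      have h2 := h1.mul_isBigO (Asymptotics.isBigO_refl (fun y => ‖y - x‖) (nhds x))
      simp only [one_mul] at h2
      refine (h2.congr_left fun y => ?_).of_norm_right
      rcases eq_or_ne (‖y - x‖) 0 with h3 | h3
      · rw [h3, mul_zero, Real.zero_rpow (by linarith)]
      · rw [Real.rpow_sub_one h3, div_mul_cancel₀ _ h3]
    have hb : (fun y => Real.exp (-inner ℝ y (1 : V)) * q y) =O[nhds x] fun _ => (1 : ℝ) := by
      have : Continuous fun y : V => Real.exp (-inner ℝ y (1 : V)) * q y := by fun_prop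
      exact this.continuousAt.isBigO_one ℝ
    have h3 : gammaFun s q =O[nhds x] fun y => (Real.exp (-inner ℝ y (1 : V)) * q y) * ‖det y‖ ^ s := by
      refine Asymptotics.IsBigO.of_bound 1 (Filter.Eventually.of_forall fun y => ?_)
      by_cases hy : y ∈ cone V
      · rw [gammaFun, Set.indicator_of_mem hy, Real.norm_of_nonneg (det_pos hy).le, one_mul,
          mul_assoc, mul_comm (q y)]
      · rw [gammaFun, Set.indicator_of_notMem hy, norm_zero]
        positivity
    have h4 := h3.trans_isLittleO ((hb.mul hO').trans_isLittleO (by simpa using ho))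
    rw [hasFDerivAt_iff_isLittleO]
    simpa [gammaFun, hx] using h4
  · have h1 : gammaFun s q =ᶠ[nhds x] fun _ => 0 := by
      filter_upwards [isClosed_closure.isOpen_compl.mem_nhds hc] with y hy
      exact Set.indicator_of_notMem (fun h => hy (subset_closure h)) _
    exact (hasFDerivAt_const (0 : ℝ) x).congr_of_eventuallyEq h1

theorem hasFDerivAt_gammaFun_of_mem (s : ℝ) {q : V → ℝ} (hq : Differentiable ℝ q) {x : V}
    (hx : x ∈ cone V) : DifferentiableAt ℝ (gammaFun s q) x ∧ ∀ v, fderiv ℝ (gammaFun s q) x v =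
      gammaFun (s - 1) (shiftFun s v q) x - inner ℝ v (1 : V) * gammaFun s q x := by
  have h1 : gammaFun s q =ᶠ[nhds x] fun x => Real.exp (-inner ℝ x (1 : V)) * (det x ^ s * q x) := by
    filter_upwards [isOpen_cone.mem_nhds hx] with y hy using Set.indicator_of_mem hy _
  have h2 : HasFDerivAt (fun x : V => Real.exp (-inner ℝ x (1 : V)))
      (Real.exp (-inner ℝ x (1 : V)) • -(innerSL ℝ (1 : V))) x := by
    have : HasFDerivAt (fun x : V => -inner ℝ x (1 : V)) (-(innerSL ℝ (1 : V))) x := by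
      have := (-(innerSL ℝ (1 : V))).hasFDerivAt (x := x)
      refine this.congr_of_eventuallyEq (Filter.Eventually.of_forall fun y => ?_)
      simp [real_inner_comm]
    exact this.exp
  have h3 := h2.mul (fderiv_det_rpow_mul s 0 hq hx).1.hasFDerivAt
  refine ⟨(h3.congr_of_eventuallyEq h1).differentiableAt, fun v => ?_⟩
  rw [(h3.congr_of_eventuallyEq h1).fderiv]
  simp only [add_apply, smul_apply, neg_apply, smul_eq_mul, (fderiv_det_rpow_mul s v hq hx).2,
    gammaFun, Set.indicator_of_mem hx, innerSL_apply_apply, real_inner_comm]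
  ring

variable [MeasurableSpace V] [BorelSpace V]

theorem measurableSet_cone : MeasurableSet (cone V) := isOpen_cone.measurableSet

theorem integrable_gammaFun {s : ℝ} (hs : 0 ≤ s) {q : V → ℝ} (hq : q.HasTemperateGrowth) :
    Integrable (gammaFun s q) := by
  obtain ⟨ρ, hρ, hρ'⟩ := exists_norm_le_inner_one V
  obtain ⟨k, C, hC, h⟩ := exists_det_le V
  obtain ⟨l, D, hD, h'⟩ := exists_abs_le_one_add_norm_pow hq
  -- Large enough that a decay of order N absorbs the growth of (det x)^s and q and still leaves the
  -- integrable weight of order dim V + 1.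
  obtain ⟨N, hN⟩ := exists_nat_ge (k * s + l + (dim V + 1))
  have hint : Integrable (fun x : V => (1 + ‖x‖) ^ (-((dim V : ℝ) + 1))) :=
    integrable_one_add_norm (by simp)
  set B : ℝ := C ^ s * D * (N.factorial / ρ ^ N * Real.exp ρ) with hB
  refine (hint.const_mul B).mono' ?_ (Filter.Eventually.of_forall fun x => ?_)
  · refine (aestronglyMeasurable_indicator_iff measurableSet_cone).2
      (ContinuousOn.aestronglyMeasurable ?_ measurableSet_cone)
    have : Continuous fun x : V => Real.exp (-inner ℝ x (1 : V)) := by fun_prop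
    exact this.continuousOn.mul ((continuousOn_det_rpow s).mul hq.1.continuous.continuousOn)
  · have h1 : (0 : ℝ) < 1 + ‖x‖ := by positivity
    have hB0 : 0 ≤ B := by positivity
    by_cases hx : x ∈ cone V
    · rw [gammaFun, Set.indicator_of_mem hx, norm_mul, norm_mul, Real.norm_of_nonneg (Real.exp_pos _).le,
        Real.norm_of_nonneg (Real.rpow_nonneg (det_pos hx).le _), Real.norm_eq_abs]
      have e1 : Real.exp (-inner ℝ x (1 : V)) ≤ N.factorial / ρ ^ N * Real.exp ρ * (1 + ‖x‖) ^ (-(N : ℝ)) := by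
        have e2 : Real.exp (-inner ℝ x (1 : V)) ≤ Real.exp ρ / Real.exp (ρ * (1 + ‖x‖)) := by
          rw [← Real.exp_sub]
          exact Real.exp_le_exp.2 (by linarith [hρ' x hx])
        have e3 := Real.pow_div_factorial_le_exp (x := ρ * (1 + ‖x‖)) (by positivity) N
        refine e2.trans ?_
        rw [Real.rpow_neg h1.le, Real.rpow_natCast, div_le_iff₀ (Real.exp_pos _)]
        calc Real.exp ρ = N.factorial / ρ ^ N * Real.exp ρ * ((1 + ‖x‖) ^ N)⁻¹ *
              ((ρ * (1 + ‖x‖)) ^ N / N.factorial) := by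
                rw [mul_pow]; field_simp
          _ ≤ _ := by gcongr
      have e4 : det x ^ s ≤ C ^ s * (1 + ‖x‖) ^ (k * s) := by
        rw [Real.rpow_mul h1.le, Real.rpow_natCast, ← Real.mul_rpow hC (by positivity)]
        exact Real.rpow_le_rpow (det_pos hx).le ((le_abs_self _).trans (h x)) hs
      calc _ ≤ (N.factorial / ρ ^ N * Real.exp ρ * (1 + ‖x‖) ^ (-(N : ℝ))) *
            ((C ^ s * (1 + ‖x‖) ^ (k * s)) * (D * (1 + ‖x‖) ^ (l : ℝ))) := by
              rw [Real.rpow_natCast]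
              have := h' x
              have := Real.rpow_nonneg (det_pos hx).le s
              gcongr
        _ = B * (1 + ‖x‖) ^ (-(N : ℝ) + k * s + l) := by
              rw [Real.rpow_add h1, Real.rpow_add h1, hB]; ring
        _ ≤ _ := by
              gcongr
              · linarith [norm_nonneg x]
              · linarith
    · rw [gammaFun, Set.indicator_of_notMem hx, norm_zero]
      positivity

/-- Integration by parts against `e^{-tr x}`. -/
theorem integral_gammaFun_shiftFun {s : ℝ} (hs : 1 < s) (v : V) {q : V → ℝ}
    (hq : q.HasTemperateGrowth) :
    ∫ x, gammaFun (s - 1) (shiftFun s v q) x = inner ℝ v (1 : V) * ∫ x, gammaFun s q x := by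
  have hqd : Differentiable ℝ q := hq.1.differentiable (by simp)
  have hi1 := integrable_gammaFun (by linarith : 0 ≤ s) hq
  have hi2 := integrable_gammaFun (by linarith : 0 ≤ s - 1) (hasTemperateGrowth_shiftFun s v hq)
  have hf : ∀ x, fderiv ℝ (gammaFun s q) x v =
      gammaFun (s - 1) (shiftFun s v q) x - inner ℝ v (1 : V) * gammaFun s q x := by
    intro x
    by_cases hx : x ∈ cone V
    · exact (hasFDerivAt_gammaFun_of_mem s hqd hx).2 v
    · rw [(hasFDerivAt_gammaFun_of_notMem hs hq.1.continuous hx).fderiv]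
      simp [gammaFun, hx]
  have hdiff : Differentiable ℝ (gammaFun s q) := by
    intro x
    by_cases hx : x ∈ cone V
    · exact (hasFDerivAt_gammaFun_of_mem s hqd hx).1
    · exact (hasFDerivAt_gammaFun_of_notMem hs hq.1.continuous hx).differentiableAt
  -- With the constant 1 as partner this says that the integral of a directional derivative
  -- vanishes.
  have h := integral_mul_fderiv_eq_neg_fderiv_mul_of_integrable (μ := (volume : Measure V))
    (f := fun _ => (1 : ℝ)) (g := gammaFun s q) (v := v) (by simp)
    (by simp only [hf, one_mul]; exact hi2.sub (hi1.const_mul _)) (by simpa using hi1)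
    (fun x _ => differentiableAt_const _) (fun x _ => hdiff x)
  simp only [hf, one_mul, fderiv_fun_const, Pi.zero_apply, zero_apply, zero_mul, integral_zero, neg_zero] at h
  rw [integral_sub hi2 (hi1.const_mul _), integral_const_mul] at h
  linarith

/-- Functions (det x)^s q with q of temperate growth are stable under differentiation at the cost of
one power of det each time, whence the condition m < s; each derivative contributes a factor tr(v
j). -/
theorem setIntegral_exp_mul_iteratedFDeriv (m : ℕ) {s : ℝ} (hs : (m : ℝ) < s) {q : V → ℝ}
    (hq : q.HasTemperateGrowth) (v : Fin m → V) :
    IntegrableOn (fun x => Real.exp (-inner ℝ x (1 : V)) *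
      iteratedFDeriv ℝ m (fun x => det x ^ s * q x) x v) (cone V) ∧
    ∫ x in cone V, Real.exp (-inner ℝ x (1 : V)) *
      iteratedFDeriv ℝ m (fun x => det x ^ s * q x) x v =
        (∏ j, inner ℝ (v j) (1 : V)) * ∫ x, gammaFun s q x := by
  induction m generalizing s q with
  | zero =>
    have hs' : 0 ≤ s := by simpa using hs.le
    simp only [iteratedFDeriv_zero_apply, Finset.univ_eq_empty, Finset.prod_empty, one_mul]
    refine ⟨(integrable_indicator_iff measurableSet_cone).1 (integrable_gammaFun hs' hq), ?_⟩
    rw [← integral_indicator measurableSet_cone]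
    rfl
  | succ m ih =>
    push_cast at hs
    have hm : (0 : ℝ) ≤ m := Nat.cast_nonneg m
    have hqd : Differentiable ℝ q := hq.1.differentiable (by simp)
    obtain ⟨ih1, ih2⟩ := ih (s := s - 1) (by linarith)
      (hasTemperateGrowth_shiftFun s (v (Fin.last m)) hq) (Fin.init v)
    have h : ∀ x ∈ cone V, iteratedFDeriv ℝ (m + 1) (fun x => det x ^ s * q x) x v =
        iteratedFDeriv ℝ m (fun x => det x ^ (s - 1) * shiftFun s (v (Fin.last m)) q x) x
          (Fin.init v) := by
      intro x hx
      have hg : ContDiffAt ℝ (m + 1 : ℕ) (fun x => det x ^ s * q x) x :=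
        ((contDiff_det.contDiffAt).rpow contDiffAt_const (det_pos hx).ne').mul
          ((hq.1.of_le (by exact_mod_cast le_top)).contDiffAt)
      have e1 := (ContinuousLinearMap.apply ℝ ℝ (v (Fin.last m))).iteratedFDeriv_comp_left
        (hg.fderiv_right (m := m) (by norm_cast)) (i := m) le_rfl
      rw [iteratedFDeriv_succ_apply_right]
      have e2 := congrArg (fun T => T (Fin.init v)) e1
      refine e2.symm.trans ?_
      have e3 : (ContinuousLinearMap.apply ℝ ℝ (v (Fin.last m))) ∘
          (fderiv ℝ fun x => det x ^ s * q x) =ᶠ[nhds x]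
          fun x => det x ^ (s - 1) * shiftFun s (v (Fin.last m)) q x := by
        filter_upwards [isOpen_cone.mem_nhds hx] with y hy
        exact (fderiv_det_rpow_mul s _ hqd hy).2
      rw [(e3.iteratedFDeriv (𝕜 := ℝ) m).eq_of_nhds]
    have h' : Set.EqOn (fun x => Real.exp (-inner ℝ x (1 : V)) *
        iteratedFDeriv ℝ (m + 1) (fun x => det x ^ s * q x) x v) (fun x =>
        Real.exp (-inner ℝ x (1 : V)) * iteratedFDeriv ℝ m
          (fun x => det x ^ (s - 1) * shiftFun s (v (Fin.last m)) q x) x (Fin.init v)) (cone V) :=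
      fun x hx => by simp only [h x hx]
    refine ⟨(integrableOn_congr_fun h' measurableSet_cone).2 ih1, ?_⟩
    rw [setIntegral_congr_fun measurableSet_cone h', ih2, integral_gammaFun_shiftFun (by linarith) _ hq,
      Fin.prod_univ_castSucc, ← mul_assoc]
    rfl

end Growth
end EuclideanJordan

namespace EuclideanJordan

/-! ### The Bernstein function and its nonvanishing -/

section Bernstein

variable {V : Type*} [NormedAddCommGroup V] [InnerProductSpace ℝ V] [FiniteDimensional ℝ V]
  [SimpleEuclideanJordanAlgebra V]

/-- The operator `det (∂/∂x)`. -/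
noncomputable def detOp : (V → ℝ) → V → ℝ :=
  coordOp (stdOrthonormalBasis ℝ V) fun i : Fin (rank V) → Fin (dim V) =>
    ((rank V).factorial : ℝ)⁻¹ *
      iteratedFDeriv ℝ (rank V) (det : V → ℝ) 0 fun j => stdOrthonormalBasis ℝ V (i j)

variable (V) in
/-- The Bernstein function: `det (∂/∂x) (det x)^(s + 1) = b(s) (det x)^s`. -/
noncomputable def bernstein (s : ℝ) : ℝ := detOp (fun x : V => det x ^ (s + 1)) 1

theorem contDiffOn_det_rpow (a : ℝ) {n : WithTop ℕ∞} :
    ContDiffOn ℝ n (fun x : V => det x ^ a) (cone V) := fun _ hx =>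
  (contDiff_det.contDiffAt.rpow contDiffAt_const (det_pos hx).ne').contDiffWithinAt

theorem polarOp_one_zero_powFun (a c : ℝ) {p : V × V} (hp : p ∈ cone V ×ˢ cone V) :
    polarOp 1 0 (powFun a c) p = det p.2 ^ c * detOp (fun x => det x ^ a) p.1 := by
  obtain ⟨x, y⟩ := p
  have h : ∀ m : Fin (rank V) → V, iteratedFDeriv ℝ (rank V) (powFun (V := V) a c) (x, y)
      (fun j => (m j, 0)) = det y ^ c * iteratedFDeriv ℝ (rank V) (fun x : V => det x ^ a) x m := by
    intro m
    have h1 := iteratedFDeriv_comp_affine (n := rank V) (ContinuousLinearMap.inl ℝ V V)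
      ((0 : V), y) isOpen_cone_prod (contDiffOn_powFun a c) (x := x) (by simpa using hp) m
    simp only [ContinuousLinearMap.inl_apply, Prod.mk_add_mk, zero_add, add_zero] at h1
    rw [← h1]
    have h2 : (fun z : V => powFun a c (z, y)) = fun z => det y ^ c • (det z ^ a) := by
      funext z; simp only [powFun, smul_eq_mul]; ring
    have h3 := iteratedFDeriv_const_smul_apply' (i := rank V) (a := det y ^ c)
      (f := fun z : V => det z ^ a) (x := x)
      ((contDiffOn_det_rpow a x hp.1).contDiffAt (isOpen_cone.mem_nhds hp.1))
    rw [h2, h3]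
    rfl
  simp only [polarOp, detOp, coordOp, one_apply_eq_self, zero_apply, h, Finset.mul_sum]
  exact Finset.sum_congr rfl fun i _ => by ring

theorem polarOp_one_zero : polarOp (1 : V →L[ℝ] V) 0 =
    coordOp (pairBasis V) (polarCoeff (1 : V →L[ℝ] V) 0) :=
  polarOp_eq_coordOp inner_one_apply fun x y => by simp

/-- The Bernstein identity. -/
theorem polarOp_one_zero_powFun_add_one (a c : ℝ) {p : V × V} (hp : p ∈ cone V ×ˢ cone V) :
    polarOp 1 0 (powFun (a + 1) c) p = bernstein V a * powFun a c p := by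
  obtain ⟨x, y⟩ := p
  obtain ⟨a₁, rfl⟩ := exists_expMul_one_eq hp.1
  obtain ⟨a₂, rfl⟩ := exists_expMul_one_eq hp.2
  have hχ := expTr_pos a₁
  have h := iterate_polarOp_powFun_expMul (u := expMul (-a₁)) (w := 0) (u' := 1) (w' := 0)
    (inner_expMul _) (fun x y => by simp) (a + 1) c 1 a₁ a₂
    (fun x => by simp [expMul_neg_apply]) (fun x => by simp) (one_mem_cone_prod (V := V))
  have hc : polarCoeff (expMul (-a₁)) 0 = (expTr a₁)⁻¹ • polarCoeff (1 : V →L[ℝ] V) 0 := by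
    rw [← expTr_neg]
    exact polarCoeff_expMul_comp (-a₁) (fun x => rfl) (fun x => by simp)
  rw [hc, iterate_coordOp_smul (pairBasis V) isOpen_cone_prod _ _ _ (contDiffOn_powFun _ _)
    one_mem_cone_prod, ← polarOp_one_zero] at h
  simp only [Function.iterate_one, pow_one] at h
  rw [h, polarOp_one_zero_powFun _ _ one_mem_cone_prod, powFun, det_expMul', det_expMul']
  simp only [det_one, mul_one, Real.one_rpow, one_mul]
  rw [Real.rpow_add hχ, Real.rpow_one, bernstein]
  field_simp

theorem detOp_det_rpow (a : ℝ) {x : V} (hx : x ∈ cone V) :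
    detOp (fun x : V => det x ^ (a + 1)) x = bernstein V a * det x ^ a := by
  have h1 := polarOp_one_zero_powFun_add_one a 0 (p := (x, 1)) ⟨hx, one_mem_cone⟩
  rw [polarOp_one_zero_powFun _ _ ⟨hx, one_mem_cone⟩] at h1
  simpa [powFun] using h1

theorem iterate_polarOp_one_zero (s c : ℝ) (k : ℕ) :
    Set.EqOn ((polarOp 1 0)^[k] (powFun (s + k) c))
      (fun p => (∏ j ∈ Finset.range k, bernstein V (s + j)) * powFun s c p) (cone V ×ˢ cone V) := by
  induction k with
  | zero => intro p hp; simp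
  | succ k ih =>
    have h : Set.EqOn (polarOp 1 0 (powFun (s + (k + 1 : ℕ)) c))
        (fun p => bernstein V (s + k) * powFun (s + k) c p) (cone V ×ˢ cone V) := by
      intro p hp
      rw [Nat.cast_succ, ← add_assoc]
      exact polarOp_one_zero_powFun_add_one _ _ hp
    rw [polarOp_one_zero] at h ih ⊢
    intro p hp
    rw [Function.iterate_succ_apply, eqOn_iterate_coordOp (pairBasis V) isOpen_cone_prod _ k h hp,
      iterate_coordOp_const_mul (pairBasis V) isOpen_cone_prod _ _ _ (contDiffOn_powFun _ _) hp,
      ih hp, Finset.prod_range_succ]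
    ring

/-- (s, x) ↦ (det x)^(s+1) is jointly analytic, and the derivatives in x at e are derivatives of
this joint function. -/
theorem analyticOnNhd_bernstein : AnalyticOnNhd ℝ (bernstein V) Set.univ := by
  have hG : ContDiffOn ℝ ω (fun q : ℝ × V => det q.2 ^ (q.1 + 1)) (Set.univ ×ˢ cone V) := by
    intro q hq
    exact ((contDiff_det.comp contDiff_snd).contDiffAt.rpow
      (contDiff_fst.add contDiff_const).contDiffAt (det_pos hq.2).ne').contDiffWithinAt
  have hU : IsOpen ((Set.univ : Set ℝ) ×ˢ cone V) := isOpen_univ.prod isOpen_cone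
  have h : ∀ (s : ℝ) (m : Fin (rank V) → V),
      iteratedFDeriv ℝ (rank V) (fun x : V => det x ^ (s + 1)) 1 m =
      iteratedFDeriv ℝ (rank V) (fun q : ℝ × V => det q.2 ^ (q.1 + 1)) (s, 1) fun j => (0, m j) := by
    intro s m
    have h1 := iteratedFDeriv_comp_affine (n := rank V) (ContinuousLinearMap.inr ℝ ℝ V)
      (s, (0 : V)) hU (hG.of_le le_top) (x := (1 : V))
      (by simpa using one_mem_cone) m
    simpa using h1
  have h2 : ContDiff ℝ ω (bernstein V) := by
    have h3 : bernstein V = fun s => ∑ i : Fin (rank V) → Fin (dim V),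
        (((rank V).factorial : ℝ)⁻¹ *
          iteratedFDeriv ℝ (rank V) (det : V → ℝ) 0 fun j => stdOrthonormalBasis ℝ V (i j)) *
        iteratedFDeriv ℝ (rank V) (fun q : ℝ × V => det q.2 ^ (q.1 + 1)) (s, 1)
          fun j => (0, stdOrthonormalBasis ℝ V (i j)) := by
      funext s
      simp only [bernstein, detOp, coordOp, h]
    rw [h3]
    refine ContDiff.sum fun i _ => contDiff_const.mul ?_
    rw [← contDiffOn_univ]
    exact (contDiffOn_iteratedFDeriv_apply hU hG _).comp
      (contDiff_id.prodMk contDiff_const).contDiffOn fun s _ => ⟨trivial, one_mem_cone⟩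
  intro s _
  exact h2.contDiffAt.analyticAt

variable [MeasurableSpace V] [BorelSpace V]

variable (V) in
/-- The integral of `e^{-tr x} (det x)^s` over `Ω`. -/
noncomputable def gammaInt (s : ℝ) : ℝ := ∫ x : V, gammaFun s (fun _ => 1) x

theorem gammaInt_pos {s : ℝ} (hs : 0 ≤ s) : 0 < gammaInt V s := by
  have hi := integrable_gammaFun (V := V) hs (Function.HasTemperateGrowth.const 1)
  have hpos : ∀ x ∈ cone V, 0 < gammaFun s (fun _ => 1) x := fun x hx => by
    rw [gammaFun, Set.indicator_of_mem hx, mul_one]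
    exact mul_pos (Real.exp_pos _) (Real.rpow_pos_of_pos (det_pos hx) _)
  rw [gammaInt, integral_pos_iff_support_of_nonneg (fun x => ?_) hi]
  · refine (isOpen_cone.measure_pos volume ⟨1, one_mem_cone⟩).trans_le (measure_mono fun x hx => ?_)
    exact (hpos x hx).ne'
  · by_cases hx : x ∈ cone V
    · exact (hpos x hx).le
    · simp [gammaFun, hx]

/-- Integrate the Bernstein identity against e^(-tr x): the r integrations by parts replace det(∂)
by its symbol at e, which is det e = 1. -/
theorem bernstein_mul_gammaInt_of_lt {s : ℝ} (hs : (rank V : ℝ) < s + 1) :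
    bernstein V s * gammaInt V s = gammaInt V (s + 1) := by
  have hr : (1 : ℝ) ≤ rank V := by exact_mod_cast rank_pos V
  have hs0 : 0 ≤ s := by linarith
  have h := fun i : Fin (rank V) → Fin (dim V) => setIntegral_exp_mul_iteratedFDeriv (rank V) hs
    (Function.HasTemperateGrowth.const (1 : ℝ)) fun j => stdOrthonormalBasis ℝ V (i j)
  simp only [mul_one] at h
  have h1 : bernstein V s * gammaInt V s =
      ∫ x in cone V, Real.exp (-inner ℝ x (1 : V)) * detOp (fun x : V => det x ^ (s + 1)) x := by
    rw [gammaInt, ← integral_const_mul, ← integral_indicator measurableSet_cone]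
    refine integral_congr_ae (Filter.Eventually.of_forall fun x => ?_)
    by_cases hx : x ∈ cone V
    · simp only [gammaFun, Set.indicator_of_mem hx, detOp_det_rpow s hx]
      ring
    · simp [gammaFun, hx]
  rw [h1]
  simp only [detOp, coordOp, Finset.mul_sum]
  have h2 : ∀ (x : V) (i : Fin (rank V) → Fin (dim V)), Real.exp (-inner ℝ x (1 : V)) *
      (((rank V).factorial : ℝ)⁻¹ * (iteratedFDeriv ℝ (rank V) (det : V → ℝ) 0 fun j =>
        stdOrthonormalBasis ℝ V (i j)) * iteratedFDeriv ℝ (rank V) (fun x : V => det x ^ (s + 1)) x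
          fun j => stdOrthonormalBasis ℝ V (i j)) =
      (((rank V).factorial : ℝ)⁻¹ * (iteratedFDeriv ℝ (rank V) (det : V → ℝ) 0 fun j =>
        stdOrthonormalBasis ℝ V (i j))) * (Real.exp (-inner ℝ x (1 : V)) *
          iteratedFDeriv ℝ (rank V) (fun x : V => det x ^ (s + 1)) x
          fun j => stdOrthonormalBasis ℝ V (i j)) := fun x i => by ring
  simp only [h2]
  rw [integral_finsetSum _ fun i _ => (h i).1.const_mul _]
  simp only [integral_const_mul, (h _).2]
  have h3 := det_eq_sum (1 : V)
  rw [det_one] at h3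
  calc _ = (((rank V).factorial : ℝ)⁻¹ * ∑ i : Fin (rank V) → Fin (dim V),
      iteratedFDeriv ℝ (rank V) (det : V → ℝ) 0 (fun j => stdOrthonormalBasis ℝ V (i j)) *
        ∏ j, inner ℝ (stdOrthonormalBasis ℝ V (i j)) (1 : V)) * gammaInt V (s + 1) := by
        rw [Finset.mul_sum, Finset.sum_mul]
        exact Finset.sum_congr rfl fun i _ => by rw [gammaInt]; ring
    _ = _ := by rw [← h3, one_mul]

/-- The integral is the moment generating function of log det for the measure e^(-tr x) dx on Ω, and
such functions are analytic in the interior of their domain. -/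
theorem analyticOnNhd_gammaInt : AnalyticOnNhd ℝ (gammaInt V) (Set.Ioi 0) := by
  set μ : Measure V := ((volume : Measure V).restrict (cone V)).withDensity
    fun x => ENNReal.ofReal (Real.exp (-inner ℝ x (1 : V))) with hμ
  have hmeas : Measurable fun x : V => Real.exp (-inner ℝ x (1 : V)) :=
    Continuous.measurable (by fun_prop)
  have hexp : ∀ s : ℝ, ∀ x ∈ cone V, (Real.exp (-inner ℝ x (1 : V))) •
      Real.exp (s * Real.log (det x)) = gammaFun s (fun _ => 1) x := by
    intro s x hx
    rw [gammaFun, Set.indicator_of_mem hx, mul_one, smul_eq_mul,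
      Real.rpow_def_of_pos (det_pos hx), mul_comm s]
  have h1 : ∀ s : ℝ, 0 ≤ s → s ∈ ProbabilityTheory.integrableExpSet (fun x : V => Real.log (det x)) μ := by
    intro s hs
    change Integrable _ _
    rw [hμ, integrable_withDensity_iff_integrable_smul' hmeas.ennreal_ofReal
      (Filter.Eventually.of_forall fun _ => ENNReal.ofReal_lt_top)]
    have hi := (integrable_gammaFun (V := V) hs (Function.HasTemperateGrowth.const 1)).integrableOn
      (s := cone V)
    refine (integrableOn_congr_fun (fun x hx => ?_) measurableSet_cone).1 hi
    rw [← hexp s x hx, ENNReal.toReal_ofReal (Real.exp_pos _).le]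
  have h2 : ∀ s, gammaInt V s = ProbabilityTheory.mgf (fun x : V => Real.log (det x)) μ s := by
    intro s
    rw [ProbabilityTheory.mgf, hμ, integral_withDensity_eq_integral_toReal_smul hmeas.ennreal_ofReal
      (Filter.Eventually.of_forall fun _ => ENNReal.ofReal_lt_top), gammaInt,
      ← integral_indicator measurableSet_cone]
    refine integral_congr_ae (Filter.Eventually.of_forall fun x => ?_)
    by_cases hx : x ∈ cone V
    · simp only [Set.indicator_of_mem hx, ENNReal.toReal_ofReal (Real.exp_pos _).le, hexp s x hx]
    · simp [gammaFun, hx]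
  rw [funext h2]
  refine ProbabilityTheory.analyticOnNhd_mgf.mono ?_
  exact interior_maximal (fun s hs => h1 s (le_of_lt hs)) isOpen_Ioi

/-- Both sides of b(s) Γ(s) = Γ(s + 1) are analytic, so the identity extends from large s to all s >
0, where the right side is positive. -/
theorem bernstein_ne_zero {s : ℝ} (hs : 0 < s) : bernstein V s ≠ 0 := by
  have h1 : AnalyticOnNhd ℝ (fun s => bernstein V s * gammaInt V s) (Set.Ioi 0) :=
    (analyticOnNhd_bernstein.mono (Set.subset_univ _)).mul analyticOnNhd_gammaInt
  have h2 : AnalyticOnNhd ℝ (fun s => gammaInt V (s + 1)) (Set.Ioi 0) := by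
    intro t ht
    have : AnalyticAt ℝ (gammaInt V) (t + 1) := analyticOnNhd_gammaInt _ (by
      simp only [Set.mem_Ioi] at ht ⊢; linarith)
    exact this.comp_of_eq (f := fun s => s + 1) (analyticAt_id.add analyticAt_const) rfl
  have h3 := h1.eqOn_of_preconnected_of_eventuallyEq h2 isPreconnected_Ioi
    (z₀ := (rank V : ℝ) + 1) (by simp only [Set.mem_Ioi]; positivity) (by
      filter_upwards [lt_mem_nhds (show (rank V : ℝ) < rank V + 1 by linarith)] with t ht
      exact bernstein_mul_gammaInt_of_lt (by linarith))
  have h4 := h3 hs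
  simp only at h4
  intro h0
  rw [h0, zero_mul] at h4
  exact (gammaInt_pos (V := V) (by linarith : (0 : ℝ) ≤ s + 1)).ne h4

end Bernstein
end EuclideanJordan

namespace EuclideanJordan

/-! ### Nonvanishing of c -/

section Nonvanishing

variable {V : Type*} [NormedAddCommGroup V] [InnerProductSpace ℝ V] [FiniteDimensional ℝ V]
  [SimpleEuclideanJordanAlgebra V]

theorem expMul_smul_one (c : ℝ) (x : V) : expMul (c • (1 : V)) x = Real.exp c • x :=
  exp_apply_of_apply_eq_smul (by simp [one_jmul])

theorem continuous_polarCoeff (u : V →L[ℝ] V) : Continuous (polarCoeff u) := by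
  refine continuous_pi fun σ => continuous_const.mul ?_
  exact (ContinuousMultilinearMap.cont _).comp (by fun_prop)

variable [MeasurableSpace V] [BorelSpace V]

/-- Scaling the second variable alone turns det(∂x - ∂y) at (e, ε⁻¹ e) into det(∂x - ε ∂y) at (e,
e). At ε = 0 the value is a product of b(s + j), nonzero; by continuity it stays nonzero for some ε
> 0. -/
theorem exists_cPoly_one_ne_zero {s : ℝ} (hs : 0 < s) (t : ℝ) (k : ℕ) :
    ∃ c : ℝ, cPoly s t k (1 : V) (Real.exp c • (1 : V)) ≠ 0 := by
  have hcont : Continuous fun ε : ℝ => (coordOp (pairBasis V)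
      (polarCoeff (1 : V →L[ℝ] V) (-(ε • (1 : V →L[ℝ] V)))))^[k] (powFun (s + k) (t + k)) (1, 1) :=
    (continuous_iterate_coordOp (pairBasis V) isOpen_cone_prod k (contDiffOn_powFun _ _)
      one_mem_cone_prod).comp ((continuous_polarCoeff 1).comp (by fun_prop))
  have h0 : (coordOp (pairBasis V) (polarCoeff (1 : V →L[ℝ] V) (-((0 : ℝ) • (1 : V →L[ℝ] V)))))^[k]
      (powFun (s + k) (t + k)) (1, 1) ≠ 0 := by
    rw [zero_smul, neg_zero, ← polarOp_one_zero, iterate_polarOp_one_zero s (t + k) k one_mem_cone_prod]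
    simp only [powFun, det_one, Real.one_rpow, mul_one]
    exact Finset.prod_ne_zero_iff.2 fun j _ => bernstein_ne_zero (by positivity)
  have hev := hcont.continuousAt.eventually_ne h0
  obtain ⟨ε, hne, hε⟩ := ((hev.filter_mono nhdsWithin_le_nhds).and
    (self_mem_nhdsWithin (s := Set.Ioi (0 : ℝ)))).exists
  have hε : 0 < ε := hε
  refine ⟨-Real.log ε, ?_⟩
  have h1 : ∀ x : V, expMul ((-Real.log ε) • (1 : V)) ((ε • (1 : V →L[ℝ] V)) x) = x := by
    intro x
    rw [expMul_smul_one, Real.exp_neg, Real.exp_log hε]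
    simp [smul_smul, hε.ne']
  have h := iterate_polarOp_powFun_expMul (u := 1) (w := -(ε • (1 : V →L[ℝ] V))) (u' := 1) (w' := -1)
    inner_one_apply (fun x y => by simp [inner_smul_left, inner_smul_right])
    (s + k) (t + k) k 0 ((-Real.log ε) • (1 : V))
    (fun x => by simpa using expMul_smul_one (0 : ℝ) x)
    (fun x => by rw [neg_apply, map_neg, h1]; rfl) (one_mem_cone_prod (V := V))
  have h2 : expMul (0 : V) 1 = (1 : V) := by simpa using expMul_smul_one (0 : ℝ) (1 : V)
  rw [← expMul_smul_one, cPoly_eq]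
  simp only [h2] at h
  rw [h]
  have h3 := Real.rpow_pos_of_pos (det_pos (expMul_one_mem_cone ((-Real.log ε) • (1 : V)))) (-t)
  have h4 := expTr_pos (0 : V)
  have h5 := expTr_pos ((-Real.log ε) • (1 : V))
  have h6 : (0 : ℝ) < expTr (0 : V) ^ (s + k) * expTr ((-Real.log ε) • (1 : V)) ^ (t + k) := by positivity
  rw [det_one, Real.one_rpow, one_mul]
  exact mul_ne_zero h3.ne' (mul_ne_zero h6.ne' hne)

/-- By covariance the point (e, τ e) may be scaled by (1 + τ)⁻¹, so that its components add up to e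
and equal (e - v)/2 and (e + v)/2. -/
theorem exists_CPoly_ne_zero {s : ℝ} (hs : 0 < s) (t : ℝ) (k : ℕ) :
    ∃ v ∈ orderInterval V, CPoly s t k v ≠ 0 := by
  obtain ⟨c, hc⟩ := exists_cPoly_one_ne_zero (V := V) hs t k
  have hpos := Real.exp_pos c
  set τ := Real.exp c
  have hρ : 0 < (1 + τ)⁻¹ := by positivity
  have e1 : (1 : V) + (1 - 2 * (1 + τ)⁻¹) • (1 : V) = (2 * τ * (1 + τ)⁻¹) • (1 : V) := by
    have : 2 * τ * (1 + τ)⁻¹ = 1 + (1 - 2 * (1 + τ)⁻¹) := by field_simp; ring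
    rw [this, add_smul, one_smul]
  have e2 : (1 : V) - (1 - 2 * (1 + τ)⁻¹) • (1 : V) = (2 * (1 + τ)⁻¹) • (1 : V) := by
    module
  refine ⟨(1 - 2 * (1 + τ)⁻¹) • (1 : V), ⟨?_, ?_⟩, ?_⟩
  · rw [e1]; exact smul_mem_cone one_mem_cone (by positivity)
  · rw [e2]; exact smul_mem_cone one_mem_cone (by positivity)
  · rw [CPoly, e1, e2, smul_smul, smul_smul]
    have h1 := cPoly_expMul s t k (Real.log (1 + τ)⁻¹ • (1 : V)) (x := 1) (y := τ • 1) one_mem_cone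
      (smul_mem_cone one_mem_cone hpos)
    rw [expMul_smul_one, expMul_smul_one, Real.exp_log hρ, smul_smul] at h1
    have e3 : (1 / 2 : ℝ) * (2 * (1 + τ)⁻¹) = (1 + τ)⁻¹ := by ring
    have e4 : (1 / 2 : ℝ) * (2 * τ * (1 + τ)⁻¹) = (1 + τ)⁻¹ * τ := by ring
    rw [e3, e4, h1]
    exact mul_ne_zero (pow_ne_zero _ (expTr_pos _).ne') hc

end Nonvanishing

/-! ### Convergence and positivity of the constant -/

section NormConst

variable {V : Type*} [NormedAddCommGroup V] [InnerProductSpace ℝ V] [FiniteDimensional ℝ V]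
  [SimpleEuclideanJordanAlgebra V]

theorem ratio_lt_of_lt {lam : ℝ} (h : 1 + charNumber V * ((rank V : ℝ) - 1) < lam) :
    0 < lam - ratio V := by
  linarith [ratio_le V]

theorem isOpen_orderInterval : IsOpen (orderInterval V) :=
  (isOpen_cone.preimage (continuous_const.add continuous_id)).inter
    (isOpen_cone.preimage (continuous_const.sub continuous_id))

theorem norm_le_of_mem_orderInterval {v : V} (hv : v ∈ orderInterval V) : ‖v‖ ≤ ‖(1 : V)‖ :=
  norm_le_of_mem_cone hv.2 hv.1

theorem half_mem_cone_of_mem_orderInterval {v : V} (hv : v ∈ orderInterval V) :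
    (1 / 2 : ℝ) • (1 - v) ∈ cone V ∧ (1 / 2 : ℝ) • (1 + v) ∈ cone V :=
  ⟨smul_mem_cone hv.2 (by norm_num), smul_mem_cone hv.1 (by norm_num)⟩

theorem continuousOn_normDensity (lam mu : ℝ) (k : ℕ) :
    ContinuousOn (normDensity V lam mu k) (orderInterval V) := by
  have h1 : ContinuousOn (CPoly (V := V) (lam - ratio V) (mu - ratio V) k) (orderInterval V) :=
    (continuousOn_cPoly (V := V) (lam - ratio V) (mu - ratio V) k).comp
      (f := fun v : V => ((1 / 2 : ℝ) • (1 - v), (1 / 2 : ℝ) • (1 + v)))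
      (by fun_prop) fun v hv => half_mem_cone_of_mem_orderInterval hv
  refine ((h1.abs.pow 2).mul ?_).mul ?_
  · exact (continuousOn_det_rpow _).comp (f := fun v : V => 1 - v) (by fun_prop) fun v hv => hv.2
  · exact (continuousOn_det_rpow _).comp (f := fun v : V => 1 + v) (by fun_prop) fun v hv => hv.1

/-- The order interval is bounded, c is bounded on bounded sets, and positive powers of det are
bounded there. -/
theorem exists_normDensity_le {lam mu : ℝ} (hlam : 0 < lam - ratio V) (hmu : 0 < mu - ratio V)
    (k : ℕ) : ∃ C, ∀ v ∈ orderInterval V, |normDensity V lam mu k v| ≤ C := by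
  obtain ⟨A, hA⟩ := exists_cPoly_le (V := V) (lam - ratio V) (mu - ratio V) k (2 * ‖(1 : V)‖)
  obtain ⟨B, hB⟩ := (isCompact_closedBall (0 : V) (2 * ‖(1 : V)‖)).exists_bound_of_continuousOn
    (f := (det : V → ℝ)) continuous_det.continuousOn
  refine ⟨A ^ 2 * B ^ (lam - ratio V) * B ^ (mu - ratio V), fun v hv => ?_⟩
  have hn := norm_le_of_mem_orderInterval hv
  have h1 : ‖1 - v‖ ≤ 2 * ‖(1 : V)‖ := (norm_sub_le _ _).trans (by linarith)
  have h2 : ‖1 + v‖ ≤ 2 * ‖(1 : V)‖ := (norm_add_le _ _).trans (by linarith)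
  have h3 : ∀ z : V, ‖z‖ ≤ 2 * ‖(1 : V)‖ → ‖(1 / 2 : ℝ) • z‖ ≤ 2 * ‖(1 : V)‖ := fun z hz => by
    rw [norm_smul, Real.norm_of_nonneg (by norm_num)]
    linarith [norm_nonneg z]
  have h4 := hA _ (half_mem_cone_of_mem_orderInterval hv).1 _
    (half_mem_cone_of_mem_orderInterval hv).2 (h3 _ h1) (h3 _ h2)
  have h5 : ∀ z ∈ cone V, ‖z‖ ≤ 2 * ‖(1 : V)‖ → ∀ a : ℝ, 0 < a → det z ^ a ≤ B ^ a :=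
    fun z hz hz' a ha => Real.rpow_le_rpow (det_pos hz).le
      ((le_abs_self _).trans (hB z (mem_closedBall_zero_iff.2 hz'))) ha.le
  have hB0 : 0 ≤ B := (norm_nonneg _).trans (hB 0 (by simp))
  have h6 := Real.rpow_nonneg (det_pos hv.2).le (lam - ratio V)
  have h7 := Real.rpow_nonneg (det_pos hv.1).le (mu - ratio V)
  have h8 := h5 _ hv.2 h1 _ hlam
  have h9 := h5 _ hv.1 h2 _ hmu
  have h10 : |CPoly (lam - ratio V) (mu - ratio V) k v| ^ 2 ≤ A ^ 2 := by
    gcongr; exact h4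
  rw [normDensity, abs_mul, abs_mul, abs_of_nonneg h6, abs_of_nonneg h7, abs_pow, abs_abs]
  gcongr

theorem normDensity_nonneg (lam mu : ℝ) (k : ℕ) {v : V} (hv : v ∈ orderInterval V) :
    0 ≤ normDensity V lam mu k v :=
  mul_nonneg (mul_nonneg (by positivity) (Real.rpow_nonneg (det_pos hv.2).le _))
    (Real.rpow_nonneg (det_pos hv.1).le _)

variable [MeasurableSpace V] [BorelSpace V]

theorem integrableOn_normDensity {lam mu : ℝ} (hlam : 0 < lam - ratio V) (hmu : 0 < mu - ratio V)
    (k : ℕ) : IntegrableOn (normDensity V lam mu k) (orderInterval V) := by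
  obtain ⟨C, hC⟩ := exists_normDensity_le (V := V) hlam hmu k
  refine IntegrableOn.of_bound ?_ ((continuousOn_normDensity lam mu k).aestronglyMeasurable
    isOpen_orderInterval.measurableSet) C ?_
  · refine (measure_mono fun v hv => ?_).trans_lt
      (measure_closedBall_lt_top (x := (0 : V)) (r := ‖(1 : V)‖))
    exact mem_closedBall_zero_iff.2 (norm_le_of_mem_orderInterval hv)
  · exact (ae_restrict_iff' isOpen_orderInterval.measurableSet).2
      (Filter.Eventually.of_forall hC)

theorem normConst_pos {lam mu : ℝ} (hlam : 0 < lam - ratio V) (hmu : 0 < mu - ratio V)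
    (k : ℕ) : 0 < normConst V lam mu k := by
  refine mul_pos (by positivity) ?_
  obtain ⟨v, hv, hne⟩ := exists_CPoly_ne_zero (V := V) hlam (mu - ratio V) k
  rw [setIntegral_pos_iff_support_of_nonneg_ae]
  -- The density is continuous on the open interval, so one nonzero value gives a nonempty open set
  -- of positive measure.
  · set W := orderInterval V ∩ normDensity V lam mu k ⁻¹' {0}ᶜ with hW
    have hWo : IsOpen W := (continuousOn_normDensity lam mu k).isOpen_inter_preimage
      isOpen_orderInterval isOpen_compl_singleton
    refine (hWo.measure_pos volume ⟨v, hv, ?_⟩).trans_le (measure_mono fun x hx => ⟨hx.2, hx.1⟩)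
    have h1 := Real.rpow_pos_of_pos (det_pos hv.2) (lam - ratio V)
    have h2 := Real.rpow_pos_of_pos (det_pos hv.1) (mu - ratio V)
    have h3 : 0 < |CPoly (lam - ratio V) (mu - ratio V) k v| := abs_pos.2 hne
    have h4 : 0 < normDensity V lam mu k v := by unfold normDensity; positivity
    exact h4.ne'
  · exact (ae_restrict_iff' isOpen_orderInterval.measurableSet).2
      (Filter.Eventually.of_forall fun x hx => normDensity_nonneg lam mu k hx)
  · exact integrableOn_normDensity hlam hmu k

theorem memLp_coneMeasure_of_hasCompactSupport (nu : ℝ) {h : V → ℂ} (hc : Continuous h)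
    (hs : HasCompactSupport h) (hsub : tsupport h ⊆ cone V) : MemLp h 2 (coneMeasure V nu) := by
  have hK : IsCompact (tsupport h) := hs
  have hKm : MeasurableSet (tsupport h) := (isClosed_tsupport h).measurableSet
  obtain ⟨B, hB⟩ := hK.exists_bound_of_continuousOn
    ((continuousOn_det_rpow (V := V) (-nu + ratio V)).mono hsub)
  obtain ⟨D, hD⟩ := hs.exists_bound_of_continuous hc
  have hfin : coneMeasure V nu (tsupport h) < ⊤ := by
    rw [coneMeasure, withDensity_apply _ hKm, Measure.restrict_restrict hKm,
      Set.inter_eq_left.2 hsub]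
    calc ∫⁻ x in tsupport h, ENNReal.ofReal (det x ^ (-nu + ratio V))
        ≤ ∫⁻ x in tsupport h, ENNReal.ofReal B := setLIntegral_mono' hKm fun x hx =>
          ENNReal.ofReal_le_ofReal ((le_abs_self _).trans (hB x hx))
      _ = ENNReal.ofReal B * volume (tsupport h) := setLIntegral_const _ _
      _ < ⊤ := ENNReal.mul_lt_top ENNReal.ofReal_lt_top hK.measure_lt_top
  have h1 : (tsupport h).indicator h = h := Set.indicator_eq_self.2 (subset_tsupport h)
  rw [← h1, memLp_indicator_iff_restrict hKm]
  have : Fact (coneMeasure V nu (tsupport h) < ⊤) := ⟨hfin⟩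
  exact MemLp.of_bound hc.aestronglyMeasurable D (Filter.Eventually.of_forall hD)

end NormConst
end EuclideanJordan

namespace EuclideanJordan

/-! ### The convolution integral of the kernel -/

section Convolution

theorem lintegral_comp_linearMap {V : Type*} [NormedAddCommGroup V] [InnerProductSpace ℝ V]
    [FiniteDimensional ℝ V] [MeasurableSpace V] [BorelSpace V] {L : V →ₗ[ℝ] V}
    (hL : LinearMap.det L ≠ 0) {F : V → ENNReal} (hF : Measurable F) :
    ∫⁻ x, F x = ENNReal.ofReal |LinearMap.det L| * ∫⁻ x, F (L x) := by
  have hLm : Measurable L := (LinearMap.continuous_of_finiteDimensional L).measurable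
  have h := Measure.map_linearMap_addHaar_eq_smul_addHaar (volume : Measure V) hL
  rw [← lintegral_map hF hLm, h, lintegral_smul_measure, smul_eq_mul, ← mul_assoc,
    ← ENNReal.ofReal_mul (abs_nonneg _), ← abs_mul, mul_inv_cancel₀ hL]
  simp

variable {V : Type*} [NormedAddCommGroup V] [InnerProductSpace ℝ V] [FiniteDimensional ℝ V]
  [SimpleEuclideanJordanAlgebra V]

variable (V) in
/-- The function `(det ξ)^s (det ζ)^t c_{s,t}^{(k)}(ξ, ζ)^2` on `Ω × Ω`, extended by zero. -/
noncomputable def kernelFun (s t : ℝ) (k : ℕ) : V × V → ENNReal :=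
  (cone V ×ˢ cone V).indicator fun p =>
    ENNReal.ofReal (det p.1 ^ s * det p.2 ^ t * cPoly s t k p.1 p.2 ^ 2)

theorem kernelFun_expMul (s t : ℝ) (k : ℕ) (a : V) (p : V × V) :
    kernelFun V s t k (expMul a p.1, expMul a p.2) =
      ENNReal.ofReal (expTr a ^ (s + t + 2 * k)) * kernelFun V s t k p := by
  have hχ := expTr_pos a
  by_cases hp : p ∈ cone V ×ˢ cone V
  · have hp' : (expMul a p.1, expMul a p.2) ∈ cone V ×ˢ cone V :=
      ⟨expMul_mem_cone a hp.1, expMul_mem_cone a hp.2⟩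
    rw [kernelFun, Set.indicator_of_mem hp, Set.indicator_of_mem hp',
      ← ENNReal.ofReal_mul (by positivity)]
    congr 1
    simp only [det_expMul', cPoly_expMul s t k a hp.1 hp.2]
    rw [Real.mul_rpow hχ.le (det_pos hp.1).le, Real.mul_rpow hχ.le (det_pos hp.2).le,
      Real.rpow_add hχ, Real.rpow_add hχ, mul_comm (2 : ℝ) k, Real.rpow_mul hχ.le, Real.rpow_natCast,
      mul_pow]
    norm_num
    ring
  · have hp' : (expMul a p.1, expMul a p.2) ∉ cone V ×ˢ cone V := fun h =>
      hp ⟨(expMul_mem_cone_iff a _).1 h.1, (expMul_mem_cone_iff a _).1 h.2⟩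
    rw [kernelFun, Set.indicator_of_notMem hp, Set.indicator_of_notMem hp', mul_zero]

theorem kernelFun_half (s t : ℝ) (k : ℕ) (v : V) :
    kernelFun V s t k ((1 / 2 : ℝ) • (1 - v), (1 / 2 : ℝ) • (1 + v)) =
      ENNReal.ofReal ((2 : ℝ) ^ (-(rank V : ℝ) * (s + t))) * (orderInterval V).indicator (fun v =>
        ENNReal.ofReal (|CPoly s t k v| ^ 2 * det (1 - v) ^ s * det (1 + v) ^ t)) v := by
  have h2 : (0 : ℝ) < 1 / 2 := by norm_num
  by_cases hv : v ∈ orderInterval V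
  · rw [kernelFun, Set.indicator_of_mem (by exact half_mem_cone_of_mem_orderInterval hv),
      Set.indicator_of_mem hv, ← ENNReal.ofReal_mul (by positivity)]
    congr 1
    simp only [det_smul]
    rw [Real.mul_rpow (by positivity) (det_pos hv.2).le, Real.mul_rpow (by positivity) (det_pos hv.1).le,
      sq_abs, CPoly, mul_add, Real.rpow_add two_pos]
    have h3 : ∀ a : ℝ, ((1 / 2 : ℝ) ^ rank V) ^ a = (2 : ℝ) ^ (-(rank V : ℝ) * a) := by
      intro a
      rw [Real.rpow_mul two_pos.le, Real.rpow_neg two_pos.le, Real.rpow_natCast, one_div, inv_pow]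
    rw [h3, h3]
    ring
  · have hp' : ((1 / 2 : ℝ) • (1 - v), (1 / 2 : ℝ) • (1 + v)) ∉ cone V ×ˢ cone V := fun h =>
      hv ⟨(smul_mem_cone_iff h2).1 h.2, (smul_mem_cone_iff h2).1 h.1⟩
    rw [kernelFun, Set.indicator_of_notMem hp', Set.indicator_of_notMem hv, mul_zero]

theorem Phi_add (lam mu : ℝ) (k : ℕ) (f g : V → ℂ) :
    Phi lam mu k (f + g) = Phi lam mu k f + Phi lam mu k g := by
  funext p
  simp only [Phi, Pi.add_apply]
  ring

theorem Phi_smul (lam mu : ℝ) (k : ℕ) (c : ℂ) (f : V → ℂ) :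
    Phi lam mu k (c • f) = c • Phi lam mu k f := by
  funext p
  simp only [Phi, Pi.smul_apply, smul_eq_mul]
  ring

variable [MeasurableSpace V] [BorelSpace V]

theorem measurable_kernelFun (s t : ℝ) (k : ℕ) : Measurable (kernelFun V s t k) := by
  classical
  rw [kernelFun, ← Set.piecewise_eq_indicator]
  refine ContinuousOn.measurable_piecewise ?_ continuousOn_const isOpen_cone_prod.measurableSet
  refine ENNReal.continuous_ofReal.comp_continuousOn ?_
  exact (contDiffOn_powFun (n := ω) s t).continuousOn.mul ((continuousOn_cPoly s t k).pow 2)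

/-- Substitute y = (e - v)/2. The Jacobian 2^(-n) and the factor 2^(-r(s+t)) from the homogeneity of
det combine to 2^(n - rλ - rμ), because r · (n/r) = n. -/
theorem lintegral_kernelFun_one {lam mu : ℝ} (hlam : 0 < lam - ratio V) (hmu : 0 < mu - ratio V)
    (k : ℕ) : ∫⁻ y : V, kernelFun V (lam - ratio V) (mu - ratio V) k (y, 1 - y) =
      ENNReal.ofReal (normConst V lam mu k) := by
  have hint := ofReal_integral_eq_lintegral_ofReal (integrableOn_normDensity hlam hmu k)
    ((ae_restrict_iff' isOpen_orderInterval.measurableSet).2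
      (Filter.Eventually.of_forall fun x hx => normDensity_nonneg lam mu k hx))
  simp only [normDensity] at hint
  simp only [normConst, normDensity]
  set s := lam - ratio V with hs
  set t := mu - ratio V with ht
  have hm : Measurable fun y : V => kernelFun V s t k (y, 1 - y) :=
    (measurable_kernelFun s t k).comp (by fun_prop)
  have hdet : LinearMap.det ((-(1 / 2) : ℝ) • (LinearMap.id : V →ₗ[ℝ] V)) = (-(1 / 2) : ℝ) ^ dim V := by
    rw [LinearMap.det_smul, LinearMap.det_id, mul_one]
  have h1 := lintegral_comp_linearMap (V := V) (L := (-(1 / 2) : ℝ) • LinearMap.id)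
    (by rw [hdet]; positivity) (F := fun y => kernelFun V s t k ((1 / 2 : ℝ) • 1 + y,
      1 - ((1 / 2 : ℝ) • 1 + y))) (hm.comp (measurable_const_add _))
  rw [lintegral_add_left_eq_self (fun y => kernelFun V s t k (y, 1 - y)) ((1 / 2 : ℝ) • 1), hdet] at h1
  rw [h1]
  have h2 : ∀ x : V, kernelFun V s t k ((1 / 2 : ℝ) • 1 + ((-(1 / 2) : ℝ) • LinearMap.id : V →ₗ[ℝ] V) x,
      1 - ((1 / 2 : ℝ) • 1 + ((-(1 / 2) : ℝ) • LinearMap.id : V →ₗ[ℝ] V) x)) =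
      kernelFun V s t k ((1 / 2 : ℝ) • (1 - x), (1 / 2 : ℝ) • (1 + x)) := by
    intro x
    congr 1
    simp only [LinearMap.smul_apply, LinearMap.id_apply]
    refine Prod.ext ?_ ?_
    · simp only; module
    · simp only; module
  simp only [h2, kernelFun_half]
  rw [lintegral_const_mul' _ _ ENNReal.ofReal_ne_top, lintegral_indicator isOpen_orderInterval.measurableSet,
    ← mul_assoc, ← ENNReal.ofReal_mul (abs_nonneg _), ← hint, ← ENNReal.ofReal_mul (by positivity)]
  congr 2
  have hr : (rank V : ℝ) * ratio V = dim V := by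
    rw [ratio, mul_div_cancel₀]
    exact_mod_cast (rank_pos V).ne'
  have e1 : |(-(1 / 2) : ℝ) ^ dim V| = (2 : ℝ) ^ (-(dim V : ℝ)) := by
    rw [abs_pow, abs_neg, abs_of_pos (by norm_num), Real.rpow_neg two_pos.le, Real.rpow_natCast,
      one_div, inv_pow]
  rw [e1, ← Real.rpow_add two_pos]
  congr 1
  rw [hs, ht]
  linear_combination 2 * hr

/-- Write x = g e and substitute y → g y: the Jacobian gives χ^(n/r), the kernel χ^(s+t+2k), and χ =
det x. -/
theorem lintegral_kernelFun {lam mu : ℝ} (hlam : 0 < lam - ratio V) (hmu : 0 < mu - ratio V)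
    (k : ℕ) {x : V} (hx : x ∈ cone V) :
    ∫⁻ y : V, kernelFun V (lam - ratio V) (mu - ratio V) k (y, x - y) =
      ENNReal.ofReal (det x ^ (lam + mu + 2 * k - ratio V)) * ENNReal.ofReal (normConst V lam mu k) := by
  obtain ⟨a, rfl⟩ := exists_expMul_one_eq hx
  have hχ := expTr_pos a
  have hdet : LinearMap.det (expMul a).toLinearMap = expTr a ^ ratio V := linearMap_det_expMul a
  have hdet0 : 0 < expTr a ^ ratio V := Real.rpow_pos_of_pos hχ _
  rw [lintegral_comp_linearMap (L := (expMul a).toLinearMap) (by rw [hdet]; exact hdet0.ne')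
    (F := fun y => kernelFun V (lam - ratio V) (mu - ratio V) k (y, expMul a 1 - y))
    ((measurable_kernelFun _ _ k).comp (by fun_prop)), hdet, abs_of_pos hdet0]
  have h1 : ∀ y, kernelFun V (lam - ratio V) (mu - ratio V) k ((expMul a).toLinearMap y,
      expMul a 1 - (expMul a).toLinearMap y) = _ := fun y => by
    have := kernelFun_expMul (lam - ratio V) (mu - ratio V) k a (y, 1 - y)
    simp only [map_sub] at this
    exact this
  simp only [h1]
  rw [lintegral_const_mul' _ _ ENNReal.ofReal_ne_top, lintegral_kernelFun_one hlam hmu, ← mul_assoc,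
    ← ENNReal.ofReal_mul hdet0.le, ← Real.rpow_add hχ, det_expMul', det_one, mul_one]
  congr 3
  ring

/-- Shear (y, z) → (y, y + z) and exchange the integrals. With values in [0, ∞] no integrability has
to be known beforehand. -/
theorem lintegral_kernelFun_mul {lam mu : ℝ} (hlam : 0 < lam - ratio V) (hmu : 0 < mu - ratio V)
    (k : ℕ) {G : V → ENNReal} (hG : Measurable G) :
    ∫⁻ p : V × V, kernelFun V (lam - ratio V) (mu - ratio V) k p * G (p.1 + p.2)
        ∂((volume : Measure V).prod volume) =
      ENNReal.ofReal (normConst V lam mu k) * ∫⁻ x in cone V,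
        ENNReal.ofReal (det x ^ (lam + mu + 2 * k - ratio V)) * G x := by
  have hKm := measurable_kernelFun (V := V) (lam - ratio V) (mu - ratio V) k
  set K := kernelFun V (lam - ratio V) (mu - ratio V) k with hK
  rw [lintegral_prod _ (by fun_prop)]
  have h1 : ∀ y : V, ∫⁻ z : V, K (y, z) * G (y + z) = ∫⁻ x : V, K (y, x - y) * G x := by
    intro y
    rw [← lintegral_add_left_eq_self (fun x => K (y, x - y) * G x) y]
    simp only [add_sub_cancel_left]
  simp only [h1]
  rw [lintegral_lintegral_swap (by fun_prop), ← lintegral_indicator measurableSet_cone,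
    ← lintegral_const_mul' _ _ ENNReal.ofReal_ne_top]
  refine lintegral_congr fun x => ?_
  rw [lintegral_mul_const _ (by fun_prop)]
  by_cases hx : x ∈ cone V
  · rw [Set.indicator_of_mem hx, hK, lintegral_kernelFun hlam hmu k hx]
    ring
  · have h0 : ∀ y, K (y, x - y) = 0 := fun y => by
      refine Set.indicator_of_notMem (fun h => hx ?_) _
      have := add_mem_cone h.1 h.2
      simpa using this
    simp [h0, hx]

end Convolution

/-! ### The operator on L² spaces -/

section Operator

variable {V : Type*} [NormedAddCommGroup V] [InnerProductSpace ℝ V] [FiniteDimensional ℝ V]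
  [SimpleEuclideanJordanAlgebra V] [MeasurableSpace V] [BorelSpace V]

theorem measurable_det_rpow (a : ℝ) : Measurable fun x : V => det x ^ a :=
  continuous_det.measurable.pow_const a

theorem measurable_det_rpow_mul (a c : ℝ) :
    Measurable fun p : V × V => ENNReal.ofReal (det p.1 ^ a * det p.2 ^ c) :=
  (((measurable_det_rpow a).comp measurable_fst).mul
    ((measurable_det_rpow c).comp measurable_snd)).ennreal_ofReal

theorem coneMeasure₂_absolutelyContinuous (lam mu : ℝ) : coneMeasure₂ V lam mu ≪
    ((volume : Measure V).prod volume).restrict (cone V ×ˢ cone V) :=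
  withDensity_absolutelyContinuous _ _

/-- Addition pulls Lebesgue null sets back to null sets, and the density is positive on Ω. This
makes Φ well defined on classes of functions. -/
theorem ae_coneMeasure₂_add {nu : ℝ} (lam mu : ℝ) {P : V → Prop} (h : ∀ᵐ x ∂coneMeasure V nu, P x) :
    ∀ᵐ p ∂coneMeasure₂ V lam mu, P (p.1 + p.2) := by
  rw [coneMeasure, ae_withDensity_iff (measurable_det_rpow _).ennreal_ofReal,
    ae_restrict_iff' measurableSet_cone] at h
  refine (coneMeasure₂_absolutelyContinuous lam mu).ae_le ?_
  change ∀ᵐ p : V × V ∂_, P (p.1 + p.2)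
  rw [ae_restrict_iff' isOpen_cone_prod.measurableSet]
  have hq := (quasiMeasurePreserving_add (volume : Measure V) (volume : Measure V)).ae h
  filter_upwards [hq] with p hp hpΩ
  have hx := add_mem_cone hpΩ.1 hpΩ.2
  refine hp hx ?_
  simpa using Real.rpow_pos_of_pos (det_pos hx) _

theorem Phi_ae_congr {nu : ℝ} (lam mu : ℝ) (k : ℕ) {h h' : V → ℂ} (hh : h =ᵐ[coneMeasure V nu] h') :
    Phi lam mu k h =ᵐ[coneMeasure₂ V lam mu] Phi lam mu k h' := by
  filter_upwards [ae_coneMeasure₂_add lam mu hh] with p hp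
  rw [Phi, Phi, hp]

theorem aestronglyMeasurable_Phi_of_measurable (lam mu : ℝ) (k : ℕ) {h : V → ℂ} (hh : Measurable h) :
    AEStronglyMeasurable (Phi lam mu k h) (coneMeasure₂ V lam mu) := by
  refine AEStronglyMeasurable.mono_ac (coneMeasure₂_absolutelyContinuous lam mu) ?_
  refine AEStronglyMeasurable.mul ?_ (hh.comp (measurable_fst.add measurable_snd)).aestronglyMeasurable
  refine ContinuousOn.aestronglyMeasurable ?_ isOpen_cone_prod.measurableSet
  refine continuousOn_const.mul (Complex.continuous_ofReal.comp_continuousOn ?_)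
  refine ((contDiffOn_powFun (n := ω) _ _).continuousOn.mul ?_).mul (continuousOn_cPoly _ _ k)
  exact (continuousOn_det_rpow _).comp (f := fun p : V × V => p.1 + p.2) (by fun_prop)
    fun p hp => add_mem_cone hp.1 hp.2

theorem lintegral_enorm_Phi_of_measurable {lam mu : ℝ} (hlam : 0 < lam - ratio V)
    (hmu : 0 < mu - ratio V) (k : ℕ) {h : V → ℂ} (hh : Measurable h) :
    ∫⁻ p, ‖Phi lam mu k h p‖ₑ ^ 2 ∂coneMeasure₂ V lam mu =
      ENNReal.ofReal (normConst V lam mu k) *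
        ∫⁻ x, ‖h x‖ₑ ^ 2 ∂coneMeasure V (lam + mu + 2 * k) := by
  -- G gathers the factors that depend on ξ + ζ alone. In the others, the weight (det ξ)^(-s) meets
  -- (det ξ)^(2s) from |Φh|², leaving the (det ξ)^s of the kernel; likewise for ζ.
  set G : V → ENNReal := fun x =>
    ENNReal.ofReal ((det x ^ (-(lam + mu + 2 * k) + ratio V)) ^ 2) * ‖h x‖ₑ ^ 2 with hG
  have hGm : Measurable G :=
    (((measurable_det_rpow _).pow_const 2).ennreal_ofReal).mul (hh.enorm.pow_const 2)
  have h1 := lintegral_kernelFun_mul (V := V) hlam hmu k hGm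
  rw [coneMeasure₂, lintegral_withDensity_eq_lintegral_mul_non_measurable _ (measurable_det_rpow_mul _ _)
    (Filter.Eventually.of_forall fun _ => ENNReal.ofReal_lt_top),
    ← lintegral_indicator isOpen_cone_prod.measurableSet,
    coneMeasure, lintegral_withDensity_eq_lintegral_mul_non_measurable _ (measurable_det_rpow _).ennreal_ofReal
    (Filter.Eventually.of_forall fun _ => ENNReal.ofReal_lt_top)]
  convert h1 using 1
  · refine lintegral_congr fun p => ?_
    by_cases hp : p ∈ cone V ×ˢ cone V
    · have h2 := det_pos hp.1
      have h3 := det_pos hp.2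
      have h4 := det_pos (add_mem_cone hp.1 hp.2)
      rw [kernelFun, Set.indicator_of_mem hp, Set.indicator_of_mem hp, hG]
      simp only [Pi.mul_apply]
      have h5 : ‖Phi lam mu k h p‖ₑ ^ 2 = ENNReal.ofReal ((det p.1 ^ (lam - ratio V) *
          det p.2 ^ (mu - ratio V) * det (p.1 + p.2) ^ (-lam - mu - 2 * k + ratio V) *
          cPoly (lam - ratio V) (mu - ratio V) k p.1 p.2) ^ 2) * ‖h (p.1 + p.2)‖ₑ ^ 2 := by
        rw [Phi, enorm_mul, enorm_mul, mul_pow, mul_pow]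
        congr 1
        have e1 : ‖Complex.I ^ (rank V * k)‖ₑ = 1 := by
          rw [← ofReal_norm]; simp
        rw [e1, one_pow, one_mul, ← ofReal_norm, Complex.norm_real,
          ← ENNReal.ofReal_pow (norm_nonneg _), Real.norm_eq_abs, sq_abs]
      rw [h5, ← mul_assoc, ← mul_assoc, ← ENNReal.ofReal_mul (by positivity),
        ← ENNReal.ofReal_mul (by positivity)]
      congr 2
      have e2 : det p.1 ^ (-lam + ratio V) = (det p.1 ^ (lam - ratio V))⁻¹ := by
        rw [← Real.rpow_neg h2.le]; congr 1; ring
      have e3 : det p.2 ^ (-mu + ratio V) = (det p.2 ^ (mu - ratio V))⁻¹ := by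
        rw [← Real.rpow_neg h3.le]; congr 1; ring
      have e4 : -(lam + mu + 2 * k) + ratio V = -lam - mu - 2 * k + ratio V := by ring
      have e5 := Real.rpow_pos_of_pos h2 (lam - ratio V)
      have e6 := Real.rpow_pos_of_pos h3 (mu - ratio V)
      rw [e2, e3, e4]
      field_simp
    · rw [kernelFun, Set.indicator_of_notMem hp, Set.indicator_of_notMem hp, zero_mul]
  · congr 1
    refine setLIntegral_congr_fun measurableSet_cone fun x hx => ?_
    have h2 := det_pos hx
    simp only [Pi.mul_apply, hG]
    rw [← mul_assoc, ← ENNReal.ofReal_mul (by positivity)]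
    congr 2
    -- Exponents: (ν - n/r) + 2(n/r - ν) = n/r - ν, the weight of L²_ν.
    rw [← Real.rpow_natCast, ← Real.rpow_mul h2.le, ← Real.rpow_add h2]
    congr 1
    push_cast
    ring

theorem lintegral_enorm_Phi {lam mu : ℝ} (hlam : 0 < lam - ratio V) (hmu : 0 < mu - ratio V) (k : ℕ)
    {h : V → ℂ} (hh : AEStronglyMeasurable h (coneMeasure V (lam + mu + 2 * k))) :
    AEStronglyMeasurable (Phi lam mu k h) (coneMeasure₂ V lam mu) ∧
    ∫⁻ p, ‖Phi lam mu k h p‖ₑ ^ 2 ∂coneMeasure₂ V lam mu =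
      ENNReal.ofReal (normConst V lam mu k) *
        ∫⁻ x, ‖h x‖ₑ ^ 2 ∂coneMeasure V (lam + mu + 2 * k) := by
  obtain ⟨g, hg, hgh⟩ := hh
  have h1 := Phi_ae_congr lam mu k hgh
  refine ⟨(aestronglyMeasurable_Phi_of_measurable lam mu k hg.measurable).congr h1.symm, ?_⟩
  rw [lintegral_congr_ae (g := fun p => ‖Phi lam mu k g p‖ₑ ^ 2)
    (h1.mono fun p hp => by simp only [hp]),
    lintegral_enorm_Phi_of_measurable hlam hmu k hg.measurable]
  congr 1
  exact lintegral_congr_ae (hgh.mono fun x hx => by simp only [hx])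

theorem eLpNorm_Phi {lam mu : ℝ} (hlam : 0 < lam - ratio V) (hmu : 0 < mu - ratio V) (k : ℕ)
    {h : V → ℂ} (hh : AEStronglyMeasurable h (coneMeasure V (lam + mu + 2 * k))) :
    eLpNorm (Phi lam mu k h) 2 (coneMeasure₂ V lam mu) ^ 2 = ENNReal.ofReal (normConst V lam mu k) *
      eLpNorm h 2 (coneMeasure V (lam + mu + 2 * k)) ^ 2 := by
  have h1 := (lintegral_enorm_Phi hlam hmu k hh).2
  have h2 := eLpNorm_nnreal_pow_eq_lintegral (p := 2) (f := Phi lam mu k h)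
    (μ := coneMeasure₂ V lam mu) two_ne_zero
  have h3 := eLpNorm_nnreal_pow_eq_lintegral (p := 2) (f := h)
    (μ := coneMeasure V (lam + mu + 2 * k)) two_ne_zero
  simp only [NNReal.coe_ofNat, ENNReal.rpow_ofNat, ENNReal.coe_ofNat] at h2 h3
  rw [h2, h3, h1]

theorem memLp_Phi {lam mu : ℝ} (hlam : 0 < lam - ratio V) (hmu : 0 < mu - ratio V) (k : ℕ)
    {h : V → ℂ} (hh : MemLp h 2 (coneMeasure V (lam + mu + 2 * k))) :
    MemLp (Phi lam mu k h) 2 (coneMeasure₂ V lam mu) := by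
  refine ⟨(lintegral_enorm_Phi hlam hmu k hh.1).1, ?_⟩
  have h1 := eLpNorm_Phi hlam hmu k hh.1
  have h2 : eLpNorm (Phi lam mu k h) 2 (coneMeasure₂ V lam mu) ^ 2 < ⊤ := by
    rw [h1]
    exact ENNReal.mul_lt_top ENNReal.ofReal_lt_top (ENNReal.pow_lt_top hh.2)
  rw [lt_top_iff_ne_top] at h2 ⊢
  exact fun h3 => h2 (by simp [h3])

theorem norm_toLp_Phi_sq {lam mu : ℝ} (hlam : 0 < lam - ratio V) (hmu : 0 < mu - ratio V) (k : ℕ)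
    {h : V → ℂ} (hh : MemLp h 2 (coneMeasure V (lam + mu + 2 * k))) :
    ‖(memLp_Phi hlam hmu k hh).toLp‖ ^ 2 = normConst V lam mu k * ‖hh.toLp‖ ^ 2 := by
  rw [Lp.norm_toLp, Lp.norm_toLp, ← ENNReal.toReal_pow, eLpNorm_Phi hlam hmu k hh.1, ENNReal.toReal_mul,
    ENNReal.toReal_ofReal (normConst_pos hlam hmu k).le, ENNReal.toReal_pow]

/-- The operator `Φ` on `L²` spaces. -/
noncomputable def PhiLp {lam mu : ℝ} (hlam : 0 < lam - ratio V) (hmu : 0 < mu - ratio V) (k : ℕ) :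
    Lp ℂ 2 (coneMeasure V (lam + mu + 2 * k)) →ₗ[ℂ] Lp ℂ 2 (coneMeasure₂ V lam mu) where
  toFun f := (memLp_Phi hlam hmu k (Lp.memLp f)).toLp
  map_add' f g := by
    rw [← MemLp.toLp_add, MemLp.toLp_eq_toLp_iff, ← Phi_add]
    exact Phi_ae_congr lam mu k (Lp.coeFn_add f g)
  map_smul' c f := by
    rw [RingHom.id_apply, ← MemLp.toLp_const_smul, MemLp.toLp_eq_toLp_iff, ← Phi_smul]
    exact Phi_ae_congr lam mu k (Lp.coeFn_smul c f)

theorem PhiLp_toLp {lam mu : ℝ} (hlam : 0 < lam - ratio V) (hmu : 0 < mu - ratio V) (k : ℕ)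
    {h : V → ℂ} (hh : MemLp h 2 (coneMeasure V (lam + mu + 2 * k))) :
    PhiLp hlam hmu k (hh.toLp h) = (memLp_Phi hlam hmu k hh).toLp := by
  change (memLp_Phi hlam hmu k (Lp.memLp (hh.toLp h))).toLp = _
  rw [MemLp.toLp_eq_toLp_iff]
  exact Phi_ae_congr lam mu k hh.coeFn_toLp

theorem norm_PhiLp_sq {lam mu : ℝ} (hlam : 0 < lam - ratio V) (hmu : 0 < mu - ratio V) (k : ℕ)
    (f : Lp ℂ 2 (coneMeasure V (lam + mu + 2 * k))) :
    ‖PhiLp hlam hmu k f‖ ^ 2 = normConst V lam mu k * ‖f‖ ^ 2 := by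
  have h := norm_toLp_Phi_sq hlam hmu k (Lp.memLp f)
  rw [Lp.toLp_coeFn] at h
  exact h

theorem norm_PhiLp {lam mu : ℝ} (hlam : 0 < lam - ratio V) (hmu : 0 < mu - ratio V) (k : ℕ)
    (f : Lp ℂ 2 (coneMeasure V (lam + mu + 2 * k))) :
    ‖PhiLp hlam hmu k f‖ = Real.sqrt (normConst V lam mu k) * ‖f‖ := by
  rw [← Real.sqrt_sq (norm_nonneg (PhiLp hlam hmu k f)), norm_PhiLp_sq,
    Real.sqrt_mul (normConst_pos hlam hmu k).le, Real.sqrt_sq (norm_nonneg f)]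

end Operator
end EuclideanJordan

theorem mainTheorem5 {V : Type*} [NormedAddCommGroup V] [InnerProductSpace ℝ V]
    [FiniteDimensional ℝ V] [SimpleEuclideanJordanAlgebra V] [MeasurableSpace V] [BorelSpace V]
    (k : ℕ) (lam mu : ℝ)
    (hlam : 1 + charNumber V * ((rank V : ℝ) - 1) < lam)
    (hmu : 1 + charNumber V * ((rank V : ℝ) - 1) < mu) :
    IntegrableOn (normDensity V lam mu k) (orderInterval V) ∧
    0 < normConst V lam mu k ∧
    (∀ h : V → ℂ, ContDiff ℝ ∞ h → HasCompactSupport h → tsupport h ⊆ cone V →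
      MemLp h 2 (coneMeasure V (lam + mu + 2 * k))) ∧
    ∃ T : Lp ℂ 2 (coneMeasure V (lam + mu + 2 * k)) →L[ℂ] Lp ℂ 2 (coneMeasure₂ V lam mu),
      (∀ (h : V → ℂ) (hh : MemLp h 2 (coneMeasure V (lam + mu + 2 * k))),
        ∃ hPhi : MemLp (Phi lam mu k h) 2 (coneMeasure₂ V lam mu),
          T (hh.toLp h) = hPhi.toLp (Phi lam mu k h)) ∧
      (∃ U : Lp ℂ 2 (coneMeasure V (lam + mu + 2 * k)) →L[ℂ] Lp ℂ 2 (coneMeasure₂ V lam mu),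
        IsPartialIsometry U ∧ T = (Real.sqrt (normConst V lam mu k) : ℂ) • U) ∧
      ∀ h, ‖T h‖ ^ 2 = normConst V lam mu k * ‖h‖ ^ 2 := by
  have hs := ratio_lt_of_lt hlam
  have ht := ratio_lt_of_lt hmu
  have hc := normConst_pos (V := V) hs ht k
  have hc' : 0 < Real.sqrt (normConst V lam mu k) := Real.sqrt_pos.2 hc
  set T := (PhiLp hs ht k).mkContinuous (Real.sqrt (normConst V lam mu k))
    fun f => (norm_PhiLp hs ht k f).le with hT
  refine ⟨integrableOn_normDensity hs ht k, hc,
    fun h h1 h2 h3 => memLp_coneMeasure_of_hasCompactSupport _ h1.continuous h2 h3,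
    T, fun h hh => ⟨memLp_Phi hs ht k hh, PhiLp_toLp hs ht k hh⟩,
    -- U = T/√c preserves the norm of every vector, in particular on the orthogonal complement of
    -- its kernel.
    ⟨(Real.sqrt (normConst V lam mu k) : ℂ)⁻¹ • T, fun f _ => ?_, ?_⟩, norm_PhiLp_sq hs ht k⟩
  · rw [smul_apply, norm_smul, norm_inv, Complex.norm_real, Real.norm_of_nonneg hc'.le]
    change _ * ‖PhiLp hs ht k f‖ = _
    rw [norm_PhiLp, inv_mul_cancel_left₀ hc'.ne']
  · rw [smul_inv_smul₀]
    exact_mod_cast hc'.ne'
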